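/- Let $m\ge 1$ be an integer, let $a(x)=(x^{2m}+1)^{1/(2m)}$, and consider $\mathbb{R}_t\times\mathbb{R}_x\times\mathbb{S}^2$ with the Lorentzian metric $\mathfrak g=-dt^2+dx^2+a(x)^2d\sigma^2_{\mathbb{S}^2}$, so that $$\Box_{\mathfrak g}u=-\partial_t^2u+a^{-2}\partial_x\bigl(a^2\partial_xu\bigr)+a^{-2}\Delta_{\mathbb{S}^2}u,\qquad dV=a(x)^2\,dx\,d\sigma .$$ Let $\nabla_0$ be the gradient of the round unit sphere, $\langle x\rangle=(1+x^2)^{1/2}$, $\partial u=(\partial_tu,\partial_xu,\nabla_0u)$ with $|\partial u|^2=(\partial_tu)^2+(\partial_xu)^2+a^{-2}|\nabla_0u|^2$, and $E[u](t)=\int|\partial u|^2\,dV$ at time $t$. For $T>0$ and $A_j=\{2^j\le\langle x\rangle<2^{j+1}\}$ put $$\|f\|_{LE}=\sup_{j\ge0}2^{-j/2}\|f\|_{L^2L^2([0,T]\times A_j\times\mathbb{S}^2)},\qquad \|F\|_{LE^*}=\sum_{j\ge0}2^{j/2}\|F\|_{L^2L^2([0,T]\times A_j\times\mathbb{S}^2)},$$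 with the measure $dV\,dt$; $\|F\|_{L^1L^2}=\int_0^T\|F(t)\|_{L^2(dV)}dt$; and $$\|F\|_{L^1L^2+(|x|/\langle x\rangle)^mLE^*}=\inf_{F=F_1+F_2}\Bigl(\|F_1\|_{L^1L^2}+\bigl\|(|x|/\langle x\rangle)^{-m}F_2\bigr\|_{LE^*}\Bigr).$$ Let $D_\omega=(-a(x)^{-2}\Delta_{\mathbb{S}^2})^{1/2}$ and $\langle D_\omega\rangle=(1+D_\omega^2)^{1/2}$, defined for each fixed $x$ by the spectral decomposition of $\Delta_{\mathbb{S}^2}$ on $L^2(\mathbb{S}^2)$; on angular gradients $\langle D_\omega\rangle^s\nabla_0u=\nabla_0\langle D_\omega\rangle^su$. A norm of $\langle D_\omega\rangle^sF$ is $+\infty$ when $\langle D_\omega\rangle^sF$ fails to be in $L^2(\mathbb S^2)$ on a set of positive measure of points $(t,x)\in[0,T]\times\mathbb{R}$. Then there is a constant $C$ depending only on $m$ such that for every $T>0$ and every real-valued $u\in C^2(\mathbb{R}\times\mathbb{R}\times\mathbb{S}^2)$ such that for each $t\in[0,T]$ the function $u(t,\cdot)$ vanishes for sufficiently large $|x|$,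 the quantity $$\mathcal{L}(u)=\sup_{0\le t\le T}E[u](t)^{1/2}+\|\partial_xu\|_{LE}+\Bigl\|\tfrac{|x|^m}{\langle x\rangle^m}\partial_tu\Bigr\|_{LE}+\Bigl\|\tfrac{|x|^m}{\langle x\rangle^m}\tfrac1{a}|\nabla_0u|\Bigr\|_{LE}+\|\langle x\rangle^{-1}u\|_{LE}$$ satisfies both $$\mathcal{L}(u)\le C\Bigl(E[u](0)^{1/2}+\|\Box_{\mathfrak g}u\|_{L^1L^2+(|x|/\langle x\rangle)^mLE^*}\Bigr)$$ and $$\mathcal{L}(u)\le C\Bigl(E[u](0)^{1/2}+\bigl\|\langle D_\omega\rangle^{\frac{m-1}{2(m+1)}}\Box_{\mathfrak g}u\bigr\|_{LE^*}^{1/2}\bigl\|\langle D_\omega\rangle^{-\frac{m-1}{2(m+1)}}\partial u\bigr\|_{LE}^{1/2}+\|\Box_{\mathfrak g}u\|_{LE^*}\Bigr).$$ (Norms and energies take values in $[0,+\infty]$; products use $0\cdot\infty=0$.) -/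

import Mathlib

open MeasureTheory Set
open scoped ENNReal NNReal Manifold ContDiff

noncomputable section

namespace DegTrap

/-! ### The round unit sphere -/

/-- Euclidean three-space. -/
abbrev E3 : Type := EuclideanSpace ℝ (Fin 3)

/-- Mathlib's smooth structure on the unit sphere of `E3` needs this dimension count. -/
instance finrankE3 : Fact (Module.finrank ℝ E3 = 2 + 1) := ⟨by simp⟩

/-- The unit sphere `S²`. -/
abbrev S2 : Type := Metric.sphere (0 : E3) 1

/-- The surface measure `dσ` of the round sphere (total mass `4π`). -/
def sphMeas : Measure S2 := (volume : Measure E3).toSphere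

theorem normalize_mem {y : E3} (hy : y ≠ 0) : ‖y‖⁻¹ • y ∈ Metric.sphere (0 : E3) 1 := by
  have : ‖y‖ ≠ 0 := norm_ne_zero_iff.mpr hy
  simp [norm_smul, this]

open Classical in
/-- The extension of `f : S² → ℝ` to `ℝ³ ∖ {0}` that is constant along rays:
`y ↦ f (y / |y|)` (with the irrelevant value `0` at the origin). -/
def radialExt (f : S2 → ℝ) (y : E3) : ℝ :=
  if hy : y ≠ 0 then f ⟨‖y‖⁻¹ • y, normalize_mem hy⟩ else 0

/-- The gradient of `f` on the round unit sphere, as a tangent vector in `ℝ³`. It is the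
Euclidean gradient of the radially constant extension, at a point of the sphere. -/
def sphGrad (f : S2 → ℝ) (θ : S2) : E3 := gradient (radialExt f) (θ : E3)

/-- The Laplace–Beltrami operator of the round unit sphere. It is the
Euclidean Laplacian of the radially constant extension, at a point of the sphere. -/
def sphLaplacian (f : S2 → ℝ) (θ : S2) : ℝ :=
  Laplacian.laplacian (radialExt f) (θ : E3)

/-! ### Functional calculus of the spherical Laplacian -/

/-- The eigenspace of `-Δ_{S²}` in `L²(S²)` for the eigenvalue `l (l + 1)`, that is, the
spherical harmonics of degree `l`. -/
def harmonicSpace (l : ℕ) : Submodule ℝ (Lp ℝ 2 sphMeas) :=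
  (Submodule.span ℝ {h : Lp ℝ 2 sphMeas | ∃ Y : S2 → ℝ, ContMDiff (𝓡 2) 𝓘(ℝ, ℝ) ∞ Y ∧
    (∀ θ, - sphLaplacian Y θ = (l : ℝ) * ((l : ℝ) + 1) * Y θ) ∧
    (h : S2 → ℝ) =ᵐ[sphMeas] Y}).topologicalClosure

/-- The `L²(S²)`-orthogonal projection onto the spherical harmonics of degree `l`. -/
def harmonicProj (l : ℕ) (f : Lp ℝ 2 sphMeas) : Lp ℝ 2 sphMeas :=
  haveI : CompleteSpace (harmonicSpace l) := by
    unfold harmonicSpace; infer_instance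
  (harmonicSpace l).starProjection f

open Classical in
/-- For `φ ≥ 0` on `[0, ∞)`, the squared `L²(S²)` norm of `φ(-Δ_{S²})^{1/2} f`, that is
`∑ₗ φ(l (l + 1)) ‖Pₗ f‖²`, with value `∞` if `f` is not in the domain of this operator. -/
def spectralSq (φ : ℝ → ℝ) (f : S2 → ℝ) : ℝ≥0∞ :=
  if hf : MemLp f 2 sphMeas then
    ∑' l : ℕ, ENNReal.ofReal (φ ((l : ℝ) * ((l : ℝ) + 1))) * ‖harmonicProj l (hf.toLp f)‖ₑ ^ 2
  else ⊤

/-! ### The geometry -/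

/-- The japanese bracket `⟨x⟩ = (1 + x²)^{1/2}`. -/
def jb (x : ℝ) : ℝ := Real.sqrt (1 + x ^ 2)

/-- The generating function `a(x) = (x^{2m} + 1)^{1/(2m)}`. -/
def aFun (m : ℕ) (x : ℝ) : ℝ := (x ^ (2 * m) + 1) ^ (1 / (2 * (m : ℝ)))

/-- The weight `(|x| / ⟨x⟩)^m`. -/
def wt (m : ℕ) (x : ℝ) : ℝ := (|x| / jb x) ^ m

/-- `∂_t u`. Functions on the space-time `ℝ × ℝ × S²` are written as `u t x θ`. -/
def dt (u : ℝ → ℝ → S2 → ℝ) (t x : ℝ) (θ : S2) : ℝ := deriv (fun s => u s x θ) t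

/-- `∂_x u`. -/
def dx (u : ℝ → ℝ → S2 → ℝ) (t x : ℝ) (θ : S2) : ℝ := deriv (fun y => u t y θ) x

/-- `a(x)⁻¹ |∇₀ u|`, with `∇₀` the gradient of the unit sphere. -/
def angGrad (m : ℕ) (u : ℝ → ℝ → S2 → ℝ) (t x : ℝ) (θ : S2) : ℝ :=
  (aFun m x)⁻¹ * ‖sphGrad (u t x) θ‖

/-- The d'Alembertian of `-dt² + dx² + a(x)² dσ²`:
`□u = -∂_t² u + a⁻² ∂_x (a² ∂_x u) + a⁻² Δ_{S²} u`. -/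
def box (m : ℕ) (u : ℝ → ℝ → S2 → ℝ) (t x : ℝ) (θ : S2) : ℝ :=
  - dt (dt u) t x θ
    + (aFun m x)⁻¹ ^ 2 * deriv (fun y => aFun m y ^ 2 * dx u t y θ) x
    + (aFun m x)⁻¹ ^ 2 * sphLaplacian (u t x) θ

/-! ### Norms

A space-time norm is computed from the squared angular norms `G t x`, where `G t x` is the
square of the `L²(S²)` norm at `(t, x)` of the function that is measured. The volume element is
`dV = a(x)² dx dσ`. -/

/-- The squared `L²(S²)` norm at `(t, x)` of a function on space-time. -/
def angSq (f : ℝ → ℝ → S2 → ℝ) (t x : ℝ) : ℝ≥0∞ := ∫⁻ θ, ‖f t x θ‖ₑ ^ 2 ∂sphMeas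

/-- The dyadic region `⟨x⟩ ≈ 2^j`, as `2^j ≤ ⟨x⟩ < 2^{j+1}`. -/
def annulus (j : ℕ) : Set ℝ := {x | (2 : ℝ) ^ j ≤ jb x ∧ jb x < 2 ^ (j + 1)}

/-- The `L²L²` norm on `[0,T] × {⟨x⟩ ≈ 2^j} × S²`. -/
def annL2 (m : ℕ) (T : ℝ) (j : ℕ) (G : ℝ → ℝ → ℝ≥0∞) : ℝ≥0∞ :=
  (∫⁻ t in Icc 0 T, ∫⁻ x in annulus j, G t x * ENNReal.ofReal (aFun m x ^ 2)) ^ (1 / 2 : ℝ)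

/-- The local energy norm `sup_j 2^{-j/2} ‖·‖_{L²L²([0,T] × {⟨x⟩ ≈ 2^j})}`. -/
def LE (m : ℕ) (T : ℝ) (G : ℝ → ℝ → ℝ≥0∞) : ℝ≥0∞ :=
  ⨆ j : ℕ, (2 : ℝ≥0∞) ^ (-(j : ℝ) / 2) * annL2 m T j G

/-- The dual norm `∑_j 2^{j/2} ‖·‖_{L²L²([0,T] × {⟨x⟩ ≈ 2^j})}`. -/
def LEStar (m : ℕ) (T : ℝ) (G : ℝ → ℝ → ℝ≥0∞) : ℝ≥0∞ :=
  ∑' j : ℕ, (2 : ℝ≥0∞) ^ ((j : ℝ) / 2) * annL2 m T j G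

/-- The `L¹L²` norm on `[0,T] × ℝ × S²`. -/
def L1L2 (m : ℕ) (T : ℝ) (G : ℝ → ℝ → ℝ≥0∞) : ℝ≥0∞ :=
  ∫⁻ t in Icc 0 T, (∫⁻ x, G t x * ENNReal.ofReal (aFun m x ^ 2)) ^ (1 / 2 : ℝ)

/-- A function on space-time is (Borel) measurable. -/
def StMeasurable (F : ℝ → ℝ → S2 → ℝ) : Prop :=
  Measurable fun p : ℝ × ℝ × S2 => F p.1 p.2.1 p.2.2

/-- The norm of the sum space `L¹L² + (|x|/⟨x⟩)^m LE*`, where `‖F‖_{wX} = ‖w⁻¹ F‖_X`. -/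
def sumNorm (m : ℕ) (T : ℝ) (F : ℝ → ℝ → S2 → ℝ) : ℝ≥0∞ :=
  ⨅ (F₁ : ℝ → ℝ → S2 → ℝ) (F₂ : ℝ → ℝ → S2 → ℝ) (_ : StMeasurable F₁) (_ : StMeasurable F₂)
    (_ : ∀ t x θ, F t x θ = F₁ t x θ + F₂ t x θ),
    L1L2 m T (angSq F₁) + LEStar m T (angSq fun t x θ => (wt m x)⁻¹ * F₂ t x θ)

/-- The energy `E[u](t) = ∫ (∂_t u)² + (∂_x u)² + a⁻² |∇₀ u|² dV`. -/
def energy (m : ℕ) (u : ℝ → ℝ → S2 → ℝ) (t : ℝ) : ℝ≥0∞ :=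
  ∫⁻ x, (angSq (dt u) t x + angSq (dx u) t x + angSq (angGrad m u) t x)
    * ENNReal.ofReal (aFun m x ^ 2)

/-! ### The angular operator `D_ω = (-a⁻² Δ_{S²})^{1/2}` and `⟨D_ω⟩ = (1 + D_ω²)^{1/2}` -/

/-- The squared `L²(S²)` norm at `(t, x)` of `⟨D_ω⟩^s f`. -/
def bracketSq (m : ℕ) (s : ℝ) (f : ℝ → ℝ → S2 → ℝ) (t x : ℝ) : ℝ≥0∞ :=
  spectralSq (fun lam => (1 + lam / aFun m x ^ 2) ^ s) (f t x)

/-- The squared `L²(S²)` norm at `(t, x)` of `a⁻¹ ∇₀ ⟨D_ω⟩^s f`, which is that of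
`D_ω ⟨D_ω⟩^s f`. -/
def bracketGradSq (m : ℕ) (s : ℝ) (f : ℝ → ℝ → S2 → ℝ) (t x : ℝ) : ℝ≥0∞ :=
  spectralSq (fun lam => lam / aFun m x ^ 2 * (1 + lam / aFun m x ^ 2) ^ s) (f t x)

/-- The squared `L²(S²)` norm at `(t, x)` of `⟨D_ω⟩^s ∂u`, where
`∂u = (∂_t u, ∂_x u, ∇₀ u)`, the last component is measured with the factor `a⁻¹`, and
`⟨D_ω⟩^s ∇₀ u = ∇₀ ⟨D_ω⟩^s u`. -/
def bracketDerivSq (m : ℕ) (s : ℝ) (u : ℝ → ℝ → S2 → ℝ) (t x : ℝ) : ℝ≥0∞ :=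
  bracketSq m s (dt u) t x + bracketSq m s (dx u) t x + bracketGradSq m s u t x

/-- The exponent `(m - 1) / (2 (m + 1))`. -/
def loss (m : ℕ) : ℝ := ((m : ℝ) - 1) / (2 * ((m : ℝ) + 1))

/-! ### The quantity to be estimated -/

/-- `sup_t E[u](t)^{1/2} + ‖∂_x u‖_{LE} + ‖(|x|/⟨x⟩)^m ∂_t u‖_{LE}
  + ‖(|x|/⟨x⟩)^m a⁻¹ |∇₀ u|‖_{LE} + ‖⟨x⟩⁻¹ u‖_{LE}` on the time interval `[0,T]`. -/
def lossyLHS (m : ℕ) (T : ℝ) (u : ℝ → ℝ → S2 → ℝ) : ℝ≥0∞ :=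
  (⨆ t ∈ Icc 0 T, energy m u t ^ (1 / 2 : ℝ))
    + LE m T (angSq (dx u))
    + LE m T (angSq fun t x θ => wt m x * dt u t x θ)
    + LE m T (angSq fun t x θ => wt m x * angGrad m u t x θ)
    + LE m T (angSq fun t x θ => (jb x)⁻¹ * u t x θ)

end DegTrap

end

open DegTrap
open scoped ENNReal NNReal Manifold ContDiff

noncomputable section

namespace DegTrap

/-! Integration over the spheres reduces everything to 1+1 dimensions. The hard analysis sees only
the angular integrals collected in `Moments` and three identities between them, obtained by pairing
□u with ∂_t u, ∂_x u and u and using Green's identity on S².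

The local energy bound comes from the multiplier f(x) ∂_x u + g(x) u: the space-time integral of the
quadratic form `Multiplier.bulk` is bounded by boundary terms, controlled by the energy and Hardy's
inequality (`Moments.hardy`), plus the work of the forcing. Trapping at x = 0 shows in the factor x
a'/a = x^{2m}/(x^{2m}+1), which vanishes to order 2m there, so (∂_t u)² and |∇₀u|² are controlled
only with the weight W = (|x|/⟨x⟩)^{2m}. Three multipliers are combined. The core multiplier is
positive by itself, but its density decays like ⟨x⟩⁻². The angular multiplier has f = 0 and trades
time derivatives for angular ones. The multiplier at scale b has f = W x/(⟨x⟩+b) and gains 1/b where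
⟨x⟩ ≈ b; its errors are of relative size ⟨x⟩⁻² and are absorbed by a large multiple of the first two
(`exists_multiplier`). With b = 2^j and the supremum over j this gives 𝓛² ≲ E(0) + work
(`exists_lossy_le`).

The work is estimated by duality. An L¹L² forcing is paired with the supremum of the energy, an LE*
forcing with LE norms. The only degenerate pairing is the one with ∂_t u. In the first estimate its
weight is carried by F₂ (`work_le_of_split`). In the second, ⟨D_ω⟩^s is moved between the two
factors by expansion in spherical harmonics (`work_le_of_loss`); this works for every real s, and
the particular exponent plays no role.

Both cases end with 𝓛² ≤ C(E(0) + d + b𝓛), and b𝓛 is absorbed. This requires 𝓛 < ∞ beforehand. The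
support of u(t,·) need not be bounded uniformly in t, so finiteness is proved from the energy
inequality in truncated cones, where finite propagation speed gives the cutoff terms the right sign
(`exists_en_le`). If E(0) or a forcing norm entering additively is infinite, there is nothing to
prove.

On the sphere, functions are extended to be constant along rays and differentiated in ℝ³. Green's
identity is then the Euclidean divergence theorem in polar coordinates, and completeness of the
spherical harmonics follows from Stone–Weierstrass once homogeneous functions are split into
harmonics. -/

/-! ### The area function and its logarithmic derivative -/

/-- The area `a(x)²` of the sphere at `x`, up to the factor `4π`. -/
def area (m : ℕ) (x : ℝ) : ℝ := aFun m x ^ 2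

/-- The logarithmic derivative `a' / a`. -/
def logDer (m : ℕ) (x : ℝ) : ℝ := x ^ (2 * m - 1) / (x ^ (2 * m) + 1)

/-- The square of the weight `(|x| / ⟨x⟩)^m`. -/
def wtSq (m : ℕ) (x : ℝ) : ℝ := (x ^ 2 / (1 + x ^ 2)) ^ m

theorem pow_two_mul_add_one_pos (m : ℕ) (x : ℝ) : 0 < x ^ (2 * m) + 1 := by
  rw [pow_mul]; positivity

theorem aFun_pos (m : ℕ) (x : ℝ) : 0 < aFun m x :=
  Real.rpow_pos_of_pos (pow_two_mul_add_one_pos m x) _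

theorem area_pos (m : ℕ) (x : ℝ) : 0 < area m x := pow_pos (aFun_pos m x) 2

theorem area_eq {m : ℕ} (hm : 1 ≤ m) (x : ℝ) :
    area m x = (x ^ (2 * m) + 1) ^ (1 / (m : ℝ)) := by
  have h0 := pow_two_mul_add_one_pos m x
  have hm' : (m : ℝ) ≠ 0 := by positivity
  rw [area, aFun, ← Real.rpow_natCast, ← Real.rpow_mul h0.le]
  congr 1; push_cast; field_simp

theorem jb_sq (x : ℝ) : jb x ^ 2 = 1 + x ^ 2 := Real.sq_sqrt (by positivity)

theorem jb_pos (x : ℝ) : 0 < jb x := Real.sqrt_pos.2 (by positivity)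

theorem one_le_jb (x : ℝ) : 1 ≤ jb x := Real.one_le_sqrt.2 (by nlinarith [sq_nonneg x])

theorem abs_le_jb (x : ℝ) : |x| ≤ jb x := Real.abs_le_sqrt (by linarith)

theorem continuous_jb : Continuous jb := by unfold jb; fun_prop

theorem hasDerivAt_jb (x : ℝ) : HasDerivAt jb (x / jb x) x := by
  have h : HasDerivAt (fun x : ℝ => 1 + x ^ 2) (2 * x) x := by
    simpa using (hasDerivAt_pow 2 x).const_add 1
  have h2 := h.sqrt (by positivity)
  have e : 2 * x / (2 * √(1 + x ^ 2)) = x / jb x := by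
    unfold jb; rw [mul_div_mul_left _ _ two_ne_zero]
  exact e ▸ h2

/-- Removes the fractional exponent: a² is compared with polynomials by comparing m-th powers. -/
theorem area_pow {m : ℕ} (hm : 1 ≤ m) (x : ℝ) : area m x ^ m = x ^ (2 * m) + 1 := by
  rw [area_eq hm, ← Real.rpow_mul_natCast (pow_two_mul_add_one_pos m x).le,
    one_div_mul_cancel (by positivity), Real.rpow_one]

theorem area_le {m : ℕ} (hm : 1 ≤ m) (x : ℝ) : area m x ≤ 1 + x ^ 2 := by
  rw [← pow_le_pow_iff_left₀ (area_pos m x).le (by positivity) (by omega : m ≠ 0), area_pow hm]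
  have := pow_add_pow_le (sq_nonneg x) zero_le_one (by omega : m ≠ 0)
  rw [one_pow, ← pow_mul, add_comm (x ^ 2)] at this
  exact this

theorem one_le_area {m : ℕ} (hm : 1 ≤ m) (x : ℝ) : 1 ≤ area m x := by
  rw [← pow_le_pow_iff_left₀ zero_le_one (area_pos m x).le (by omega : m ≠ 0), area_pow hm, one_pow,
    pow_mul]
  have : 0 ≤ (x ^ 2) ^ m := by positivity
  linarith

theorem sq_le_area {m : ℕ} (hm : 1 ≤ m) (x : ℝ) : x ^ 2 ≤ area m x := by
  rw [← pow_le_pow_iff_left₀ (sq_nonneg x) (area_pos m x).le (by omega : m ≠ 0), area_pow hm,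
    pow_mul]
  linarith

theorem jb_sq_le_area {m : ℕ} (hm : 1 ≤ m) (x : ℝ) : 1 + x ^ 2 ≤ 2 * area m x := by
  linarith [one_le_area hm x, sq_le_area hm x]

theorem hasDerivAt_area {m : ℕ} (hm : 1 ≤ m) (x : ℝ) :
    HasDerivAt (area m) (2 * logDer m x * area m x) x := by
  have hm' : (m : ℝ) ≠ 0 := by positivity
  have h0 := pow_two_mul_add_one_pos m x
  have h1 : HasDerivAt (fun y : ℝ => y ^ (2 * m) + 1) (((2 * m : ℕ) : ℝ) * x ^ (2 * m - 1)) x :=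
    (hasDerivAt_pow (2 * m) x).add_const 1
  have h2 := h1.rpow_const (p := 1 / (m : ℝ)) (Or.inl h0.ne')
  have e : (fun y => (y ^ (2 * m) + 1) ^ (1 / (m : ℝ))) = area m :=
    funext fun y => (area_eq hm y).symm
  rw [e] at h2
  convert h2 using 1
  rw [Real.rpow_sub h0, Real.rpow_one, ← area_eq hm, logDer]
  push_cast
  field_simp

theorem continuous_area {m : ℕ} (hm : 1 ≤ m) : Continuous (area m) :=
  continuous_iff_continuousAt.2 fun x => (hasDerivAt_area hm x).continuousAt

theorem continuous_logDer (m : ℕ) : Continuous (logDer m) := by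
  unfold logDer
  exact Continuous.div (by fun_prop) (by fun_prop) fun x => (pow_two_mul_add_one_pos m x).ne'

/-- This quantity measures the trapping: it vanishes to order 2m at x = 0 and tends to 1 at
infinity, as in flat space. -/
theorem mul_logDer {m : ℕ} (hm : 1 ≤ m) (x : ℝ) :
    x * logDer m x = x ^ (2 * m) / (x ^ (2 * m) + 1) := by
  rw [logDer, ← mul_div_assoc, ← pow_succ', Nat.sub_add_cancel (by omega)]

theorem mul_logDer_nonneg {m : ℕ} (hm : 1 ≤ m) (x : ℝ) : 0 ≤ x * logDer m x := by
  rw [mul_logDer hm, pow_mul]; positivity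

theorem mul_logDer_le_one {m : ℕ} (hm : 1 ≤ m) (x : ℝ) : x * logDer m x ≤ 1 := by
  rw [mul_logDer hm, div_le_one (pow_two_mul_add_one_pos m x)]; linarith

/-- Comparison with m = 1, where x a'/a = x²/(1+x²). That value is an upper bound for all m when |x|
≤ 1 and a lower bound when |x| ≥ 1 (`le_mul_logDer`), so the numerical constants of the core
multiplier do not depend on m. -/
theorem mul_logDer_le {m : ℕ} (hm : 1 ≤ m) {x : ℝ} (hx : |x| ≤ 1) :
    (x * logDer m x) * (1 + x ^ 2) ≤ x ^ 2 := by
  have h : x ^ (2 * m) ≤ x ^ 2 := by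
    rw [pow_mul]
    exact pow_le_of_le_one (sq_nonneg x) ((sq_le_one_iff_abs_le_one x).2 hx) (by omega)
  rw [mul_logDer hm, div_mul_eq_mul_div, div_le_iff₀ (pow_two_mul_add_one_pos m x)]
  nlinarith

theorem le_mul_logDer {m : ℕ} (hm : 1 ≤ m) {x : ℝ} (hx : 1 ≤ |x|) :
    x ^ 2 ≤ (x * logDer m x) * (1 + x ^ 2) := by
  have h : x ^ 2 ≤ x ^ (2 * m) := by
    rw [pow_mul]
    exact le_self_pow₀ ((one_le_sq_iff_one_le_abs x).2 hx) (by omega)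
  rw [mul_logDer hm, div_mul_eq_mul_div, le_div_iff₀ (pow_two_mul_add_one_pos m x)]
  nlinarith

/-- Everywhere `1 - x a'/a` is at most `2 / ⟨x⟩²`. -/
theorem one_sub_mul_logDer_le {m : ℕ} (hm : 1 ≤ m) (x : ℝ) :
    (1 - x * logDer m x) * (1 + x ^ 2) ≤ 2 := by
  rcases le_total |x| 1 with h | h
  · have := mul_logDer_nonneg hm x
    have := (sq_le_one_iff_abs_le_one x).2 h
    nlinarith [sq_nonneg x]
  · linarith [le_mul_logDer hm h]

theorem wtSq_nonneg (m : ℕ) (x : ℝ) : 0 ≤ wtSq m x := by unfold wtSq; positivity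

theorem wtSq_le_one (m : ℕ) (x : ℝ) : wtSq m x ≤ 1 :=
  pow_le_one₀ (by positivity) ((div_le_one (by positivity)).2 (by linarith))

theorem wtSq_le_pow (m : ℕ) (x : ℝ) : wtSq m x ≤ x ^ (2 * m) := by
  rw [pow_mul]
  exact pow_le_pow_left₀ (by positivity) (div_le_self (sq_nonneg x) (by nlinarith [sq_nonneg x])) m

theorem wtSq_eq (m : ℕ) (x : ℝ) : wtSq m x = wt m x ^ 2 := by
  rw [wtSq, wt, ← pow_mul, mul_comm m 2, pow_mul, div_pow |x|, sq_abs, jb_sq]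

/-- The derivative of `wtSq`. -/
def wtSqDer (m : ℕ) (x : ℝ) : ℝ := 2 * m * x ^ (2 * m - 1) / (1 + x ^ 2) ^ (m + 1)

theorem hasDerivAt_wtSq {m : ℕ} (hm : 1 ≤ m) (x : ℝ) :
    HasDerivAt (wtSq m) (wtSqDer m x) x := by
  have hp : (1 + x ^ 2 : ℝ) ≠ 0 := by positivity
  have h1 : HasDerivAt (fun x : ℝ => 1 + x ^ 2) (2 * x) x := by
    simpa using (hasDerivAt_pow 2 x).const_add 1
  have h2 : HasDerivAt (fun x : ℝ => x ^ 2) (2 * x) x := by simpa using hasDerivAt_pow 2 x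
  have h := (h2.div h1 hp).pow m
  refine HasDerivAt.congr_deriv h ?_
  obtain ⟨k, rfl⟩ : ∃ k, m = k + 1 := ⟨m - 1, by omega⟩
  simp only [wtSqDer, Nat.add_sub_cancel, Pi.div_apply, show 2 * (k + 1) - 1 = 2 * k + 1 by omega]
  rw [div_pow]
  field_simp
  ring

theorem continuous_wtSq (m : ℕ) : Continuous (wtSq m) := by
  unfold wtSq
  exact (Continuous.div (by fun_prop) (by fun_prop) fun x => by positivity).pow m

theorem continuous_wtSqDer (m : ℕ) : Continuous (wtSqDer m) := by
  unfold wtSqDer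
  exact Continuous.div (by fun_prop) (by fun_prop) fun x => by positivity

theorem mul_wtSqDer {m : ℕ} (hm : 1 ≤ m) (x : ℝ) :
    x * wtSqDer m x = 2 * m * wtSq m x / (1 + x ^ 2) := by
  obtain ⟨k, rfl⟩ : ∃ k, m = k + 1 := ⟨m - 1, by omega⟩
  simp only [wtSqDer, wtSq, show 2 * (k + 1) - 1 = 2 * k + 1 by omega]
  rw [div_pow]
  field_simp
  ring

/-- The weight is 1 + O(⟨x⟩⁻²) at infinity. The resulting cubic decay of its derivative keeps the
errors it creates within the density ⟨x⟩⁻² that the core multiplier can absorb. -/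
theorem abs_wtSqDer_le {m : ℕ} (hm : 1 ≤ m) (x : ℝ) : |wtSqDer m x| * jb x ^ 3 ≤ 2 * m := by
  have hj := jb_pos x
  have e : (1 + x ^ 2 : ℝ) ^ (m + 1) = jb x ^ (2 * m - 1) * jb x ^ 3 := by
    rw [← jb_sq, ← pow_mul, ← pow_add]; congr 1; omega
  rw [wtSqDer, abs_div, abs_mul, abs_pow, abs_of_nonneg (by positivity : (0 : ℝ) ≤ 2 * m),
    abs_of_pos (by positivity : (0 : ℝ) < (1 + x ^ 2) ^ (m + 1)), e, div_mul_eq_mul_div,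
    div_le_iff₀ (by positivity), mul_assoc (2 * (m : ℝ))]
  gcongr
  exact abs_le_jb x

/-! ### Multipliers -/

/-- A multiplier `f ∂_x u + g u` with a lower-order correction `z`, and the derivatives
of these functions away from `±1`. -/
structure Multiplier where
  f : ℝ → ℝ
  g : ℝ → ℝ
  z : ℝ → ℝ
  f' : ℝ → ℝ
  g' : ℝ → ℝ
  z' : ℝ → ℝ
  cf : Continuous f
  cg : Continuous g
  cz : Continuous z
  df : ∀ x, |x| ≠ 1 → HasDerivAt f (f' x) x
  dg : ∀ x, |x| ≠ 1 → HasDerivAt g (g' x) x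
  dz : ∀ x, |x| ≠ 1 → HasDerivAt z (z' x) x
  mf : Measurable f'
  mg : Measurable g'
  mz : Measurable z'
  bdd : ∀ R : ℝ, ∃ C, ∀ x, |x| ≤ R → |f' x| ≤ C ∧ |g' x| ≤ C ∧ |z' x| ≤ C

namespace Multiplier

/-- The sum of two multipliers. -/
def add (M N : Multiplier) : Multiplier where
  f x := M.f x + N.f x
  g x := M.g x + N.g x
  z x := M.z x + N.z x
  f' x := M.f' x + N.f' x
  g' x := M.g' x + N.g' x
  z' x := M.z' x + N.z' x
  cf := M.cf.add N.cf
  cg := M.cg.add N.cg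
  cz := M.cz.add N.cz
  df x hx := (M.df x hx).add (N.df x hx)
  dg x hx := (M.dg x hx).add (N.dg x hx)
  dz x hx := (M.dz x hx).add (N.dz x hx)
  mf := M.mf.add N.mf
  mg := M.mg.add N.mg
  mz := M.mz.add N.mz
  bdd R := by
    obtain ⟨C, hC⟩ := M.bdd R
    obtain ⟨D, hD⟩ := N.bdd R
    refine ⟨C + D, fun x hx => ?_⟩
    obtain ⟨h1, h2, h3⟩ := hC x hx
    obtain ⟨k1, k2, k3⟩ := hD x hx
    exact ⟨(abs_add_le _ _).trans (add_le_add h1 k1), (abs_add_le _ _).trans (add_le_add h2 k2),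
      (abs_add_le _ _).trans (add_le_add h3 k3)⟩

/-- A multiple of a multiplier. -/
def smul (c : ℝ) (M : Multiplier) : Multiplier where
  f x := c * M.f x
  g x := c * M.g x
  z x := c * M.z x
  f' x := c * M.f' x
  g' x := c * M.g' x
  z' x := c * M.z' x
  cf := M.cf.const_mul c
  cg := M.cg.const_mul c
  cz := M.cz.const_mul c
  df x hx := (M.df x hx).const_mul c
  dg x hx := (M.dg x hx).const_mul c
  dz x hx := (M.dz x hx).const_mul c
  mf := M.mf.const_mul c
  mg := M.mg.const_mul c
  mz := M.mz.const_mul c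
  bdd R := by
    obtain ⟨C, hC⟩ := M.bdd R
    refine ⟨|c| * C, fun x hx => ?_⟩
    obtain ⟨h1, h2, h3⟩ := hC x hx
    simp only [abs_mul]
    exact ⟨by gcongr, by gcongr, by gcongr⟩

/-- The quadratic form in the bulk term of the multiplier identity, in terms of the angular
integrals `p = ∫ (∂_t u)²`, `q = ∫ (∂_x u)²`, `r = ∫ |∇₀ u|²`, `l = ∫ u ∂_x u`, `n = ∫ u²`. -/
def bulk (M : Multiplier) (m : ℕ) (x p q r l n : ℝ) : ℝ :=
  area m x * (M.f' x / 2 + logDer m x * M.f x - M.g x) * p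
    + area m x * (M.f' x / 2 - logDer m x * M.f x + M.g x) * q
    + (M.g x - M.f' x / 2) * r + (area m x * M.g' x + 2 * M.z x) * l + M.z' x * n

theorem bulk_add (M N : Multiplier) (m : ℕ) (x p q r l n : ℝ) :
    (M.add N).bulk m x p q r l n = M.bulk m x p q r l n + N.bulk m x p q r l n := by
  simp only [bulk, add]; ring

theorem bulk_smul (c : ℝ) (M : Multiplier) (m : ℕ) (x p q r l n : ℝ) :
    (M.smul c).bulk m x p q r l n = c * M.bulk m x p q r l n := by
  simp only [bulk, smul]; ring

/-- Bounds for the size of a multiplier. -/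
def BddBy (M : Multiplier) (C : ℝ) : Prop :=
  ∀ x, |M.f x| ≤ C ∧ |M.g x| * jb x ≤ C ∧ |M.z x| ≤ C

theorem BddBy.add {M N : Multiplier} {C D : ℝ} (hM : M.BddBy C) (hN : N.BddBy D) :
    (M.add N).BddBy (C + D) := by
  intro x
  obtain ⟨h1, h2, h3⟩ := hM x
  obtain ⟨k1, k2, k3⟩ := hN x
  refine ⟨(abs_add_le _ _).trans (add_le_add h1 k1), ?_,
    (abs_add_le _ _).trans (add_le_add h3 k3)⟩
  refine (mul_le_mul_of_nonneg_right (abs_add_le _ _) (jb_pos x).le).trans ?_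
  rw [add_mul]
  exact add_le_add h2 k2

theorem BddBy.smul {M : Multiplier} {C : ℝ} (hM : M.BddBy C) (c : ℝ) :
    (M.smul c).BddBy (|c| * C) := by
  intro x
  obtain ⟨h1, h2, h3⟩ := hM x
  simp only [Multiplier.smul, abs_mul, mul_assoc]
  exact ⟨by gcongr, by gcongr, by gcongr⟩

end Multiplier

theorem exists_bound_of_continuous {h : ℝ → ℝ} (hh : Continuous h) (R : ℝ) :
    ∃ C, ∀ x, |x| ≤ R → |h x| ≤ C := by
  obtain ⟨C, hC⟩ := (isCompact_Icc (a := -R) (b := R)).exists_bound_of_continuousOn hh.continuousOn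
  exact ⟨C, fun x hx => hC x (abs_le.1 hx)⟩

theorem exists_bound_three {h₁ h₂ h₃ : ℝ → ℝ} {R : ℝ} (b₁ : ∃ C, ∀ x, |x| ≤ R → |h₁ x| ≤ C)
    (b₂ : ∃ C, ∀ x, |x| ≤ R → |h₂ x| ≤ C) (b₃ : ∃ C, ∀ x, |x| ≤ R → |h₃ x| ≤ C) :
    ∃ C, ∀ x, |x| ≤ R → |h₁ x| ≤ C ∧ |h₂ x| ≤ C ∧ |h₃ x| ≤ C := by
  obtain ⟨C₁, h1⟩ := b₁
  obtain ⟨C₂, h2⟩ := b₂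
  obtain ⟨C₃, h3⟩ := b₃
  exact ⟨max C₁ (max C₂ C₃), fun x hx => ⟨(h1 x hx).trans (le_max_left _ _),
    (h2 x hx).trans ((le_max_left _ _).trans (le_max_right _ _)),
    (h3 x hx).trans ((le_max_right _ _).trans (le_max_right _ _))⟩⟩

/-- A multiplier with continuous derivatives. -/
def Multiplier.ofContinuous (f g z f' g' z' : ℝ → ℝ) (df : ∀ x, HasDerivAt f (f' x) x)
    (dg : ∀ x, HasDerivAt g (g' x) x) (dz : ∀ x, HasDerivAt z (z' x) x)
    (mf : Continuous f') (mg : Continuous g') (mz : Continuous z') : Multiplier where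
  f := f
  g := g
  z := z
  f' := f'
  g' := g'
  z' := z'
  cf := continuous_iff_continuousAt.2 fun x => (df x).continuousAt
  cg := continuous_iff_continuousAt.2 fun x => (dg x).continuousAt
  cz := continuous_iff_continuousAt.2 fun x => (dz x).continuousAt
  df x _ := df x
  dg x _ := dg x
  dz x _ := dz x
  mf := mf.measurable
  mg := mg.measurable
  mz := mz.measurable
  bdd R := exists_bound_three (exists_bound_of_continuous mf R) (exists_bound_of_continuous mg R)
    (exists_bound_of_continuous mz R)

/-- Extend a derivative formula from `x > 1` to `|x| > 1`, for a function that is given by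
`h₀` on `|x| ≤ 1` and by `h₁` on `|x| > 1`. -/
theorem hasDerivAt_piecewise {h₀ h₁ h₂ h₃ d₀ d₁ : ℝ → ℝ} (e₂ : ∀ x, 1 < x → h₁ x = h₂ x)
    (e₃ : ∀ x, x < -1 → h₁ x = h₃ x)
    (k₀ : ∀ x, |x| < 1 → HasDerivAt h₀ (d₀ x) x) (k₂ : ∀ x, 1 < x → HasDerivAt h₂ (d₁ x) x)
    (k₃ : ∀ x, x < -1 → HasDerivAt h₃ (d₁ x) x) (x : ℝ) (hx : |x| ≠ 1) :
    HasDerivAt (fun y => if |y| ≤ 1 then h₀ y else h₁ y) (if |x| ≤ 1 then d₀ x else d₁ x) x := by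
  rcases lt_or_gt_of_ne hx with h | h
  · rw [if_pos h.le]
    refine (k₀ x h).congr_of_eventuallyEq ?_
    filter_upwards [continuous_abs.continuousAt.preimage_mem_nhds (Iio_mem_nhds h)] with y hy
    exact if_pos (le_of_lt hy)
  · rw [if_neg (not_le.2 h)]
    rcases lt_abs.1 h with h' | h'
    · refine (k₂ x h').congr_of_eventuallyEq ?_
      filter_upwards [Ioi_mem_nhds h'] with y hy
      have hy' : (1 : ℝ) < y := hy
      rw [if_neg (not_le.2 (lt_abs.2 (Or.inl hy'))), e₂ y hy']
    · refine (k₃ x (by linarith)).congr_of_eventuallyEq ?_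
      filter_upwards [Iio_mem_nhds (show x < -1 by linarith)] with y hy
      have hy' : y < -1 := hy
      rw [if_neg (not_le.2 (lt_abs.2 (Or.inr (by linarith)))), e₃ y hy']

/-! ### The core multiplier and its positivity -/

/-- A bounded substitute for the sign of `x`, exact for `|x| ≥ 1`. -/
def sgn1 (x : ℝ) : ℝ := x / max |x| 1

theorem sgn1_of_one_le {x : ℝ} (h : 1 ≤ x) : sgn1 x = 1 := by
  have : |x| = x := abs_of_pos (by linarith)
  rw [sgn1, this, max_eq_left h, div_self (by linarith)]

theorem sgn1_of_le {x : ℝ} (h : x ≤ -1) : sgn1 x = -1 := by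
  have : |x| = -x := abs_of_neg (by linarith)
  rw [sgn1, this, max_eq_left (by linarith), div_neg, div_self (by linarith)]

theorem continuous_sgn1 : Continuous sgn1 :=
  continuous_id.div (by fun_prop) fun x => (lt_max_of_lt_right one_pos).ne'

theorem abs_sgn1_le (x : ℝ) : |sgn1 x| ≤ 1 := by
  rw [sgn1, abs_div, div_le_one (by positivity)]
  exact (le_max_left _ _).trans (le_abs_self _)

/-- The multiplier that is positive in the trapping region. Only `z` depends on `m`. -/
def coreMultiplier {m : ℕ} (hm : 1 ≤ m) : Multiplier where
  -- For |x| ≤ 1, f' = 2g kills the coefficient of r and leaves A (a'/a) f ≥ 0 in front of p. For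
  -- |x| > 1, z = -A g'/2 kills the cross term l. The two pieces agree at |x| = 1 (|f| = 8/3, g = 2,
  -- |z| = A/5), but their derivatives jump.
  f x := if |x| ≤ 1 then 2 * x + 2 / 3 * x ^ 3 else (10 * x + 2 / 3 * sgn1 x) / (|x| + 3)
  g x := if |x| ≤ 1 then 1 + x ^ 2 else 10 / (|x| + 4)
  z x := if |x| ≤ 1 then area m x * (x * (1 + x ^ 2) / 10)
    else area m x * (5 * sgn1 x / (|x| + 4) ^ 2)
  f' x := if |x| ≤ 1 then 2 + 2 * x ^ 2 else 88 / 3 / (|x| + 3) ^ 2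
  g' x := if |x| ≤ 1 then 2 * x else -10 * sgn1 x / (|x| + 4) ^ 2
  z' x := if |x| ≤ 1 then
      area m x * (logDer m x * x * (1 + x ^ 2) / 5 + (1 + 3 * x ^ 2) / 10)
    else area m x * (10 * (sgn1 x * logDer m x - 1 / (|x| + 4)) / (|x| + 4) ^ 2)
  cf := by
    refine Continuous.if_le (by fun_prop) ?_ continuous_abs continuous_const ?_
    · exact Continuous.div (by have := continuous_sgn1; fun_prop) (by fun_prop)
        fun x => by positivity
    · intro x hx
      rcases (abs_eq zero_le_one).1 hx with rfl | rfl
      · rw [sgn1_of_one_le le_rfl]; norm_num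
      · rw [sgn1_of_le le_rfl]; norm_num
  cg := by
    refine Continuous.if_le (by fun_prop) ?_ continuous_abs continuous_const ?_
    · exact Continuous.div (by fun_prop) (by fun_prop) fun x => by positivity
    · intro x hx
      rw [hx, ← sq_abs, hx]; norm_num
  cz := by
    have := continuous_area hm
    refine Continuous.if_le (by fun_prop) ?_ continuous_abs continuous_const ?_
    · exact this.mul (Continuous.div (by have := continuous_sgn1; fun_prop) (by fun_prop)
        fun x => by positivity)
    · intro x hx
      congr 1
      rcases (abs_eq zero_le_one).1 hx with rfl | rfl
      · rw [sgn1_of_one_le le_rfl]; norm_num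
      · rw [sgn1_of_le le_rfl]; norm_num
  df := by
    refine hasDerivAt_piecewise (h₂ := fun x => (10 * x + 2 / 3) / (x + 3))
      (h₃ := fun x => (10 * x - 2 / 3) / (-x + 3)) ?_ ?_ ?_ ?_ ?_
    · intro x hx; rw [sgn1_of_one_le hx.le, abs_of_pos (by linarith)]; ring
    · intro x hx; rw [sgn1_of_le hx.le, abs_of_neg (by linarith)]; ring
    · intro x _
      refine (((hasDerivAt_id x).const_mul 2).add
        ((hasDerivAt_pow 3 x).const_mul (2 / 3))).congr_deriv ?_
      norm_num; ring
    · intro x hx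
      have hx3 : x + 3 ≠ 0 := by linarith
      refine ((((hasDerivAt_id x).const_mul 10).add_const (2 / 3)).div
        ((hasDerivAt_id x).add_const 3) hx3).congr_deriv ?_
      simp only [id]
      rw [abs_of_pos (by linarith)]; field_simp; ring
    · intro x hx
      have hx3 : -x + 3 ≠ 0 := by linarith
      refine ((((hasDerivAt_id x).const_mul 10).sub_const (2 / 3)).div
        ((hasDerivAt_id x).neg.add_const 3) hx3).congr_deriv ?_
      simp only [id, Pi.neg_apply]
      rw [abs_of_neg (by linarith)]; field_simp; ring
  dg := by
    refine hasDerivAt_piecewise (h₂ := fun x => 10 / (x + 4))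
      (h₃ := fun x => 10 / (-x + 4)) ?_ ?_ ?_ ?_ ?_
    · intro x hx; rw [abs_of_pos (by linarith)]
    · intro x hx; rw [abs_of_neg (by linarith)]
    · intro x _
      refine ((hasDerivAt_pow 2 x).const_add 1).congr_deriv ?_
      norm_num
    · intro x hx
      have hx3 : x + 4 ≠ 0 := by linarith
      refine ((hasDerivAt_const x 10).div
        ((hasDerivAt_id x).add_const 4) hx3).congr_deriv ?_
      simp only [id]
      rw [abs_of_pos (by linarith), sgn1_of_one_le hx.le]; field_simp; ring
    · intro x hx
      have hx3 : -x + 4 ≠ 0 := by linarith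
      refine ((hasDerivAt_const x 10).div
        ((hasDerivAt_id x).neg.add_const 4) hx3).congr_deriv ?_
      simp only [id, Pi.neg_apply]
      rw [abs_of_neg (by linarith), sgn1_of_le hx.le]; field_simp; ring
  dz := by
    refine hasDerivAt_piecewise (h₂ := fun x => area m x * (5 / (x + 4) ^ 2))
      (h₃ := fun x => area m x * (-5 / (-x + 4) ^ 2)) ?_ ?_ ?_ ?_ ?_
    · intro x hx; rw [sgn1_of_one_le hx.le, abs_of_pos (by linarith), mul_one]
    · intro x hx; rw [sgn1_of_le hx.le, abs_of_neg (by linarith)]; ring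
    · intro x _
      refine ((hasDerivAt_area hm x).mul (((hasDerivAt_id x).mul
        ((hasDerivAt_pow 2 x).const_add 1)).div_const 10)).congr_deriv ?_
      simp only [id, Pi.mul_apply]
      norm_num; ring
    · intro x hx
      have hx3 : x + 4 ≠ 0 := by linarith
      refine ((hasDerivAt_area hm x).mul ((hasDerivAt_const x 5).div
        (((hasDerivAt_id x).add_const 4).pow 2) (pow_ne_zero 2 hx3))).congr_deriv ?_
      simp only [id, Pi.pow_apply, Pi.div_apply]
      rw [abs_of_pos (by linarith), sgn1_of_one_le hx.le]; field_simp; ring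
    · intro x hx
      have hx3 : -x + 4 ≠ 0 := by linarith
      refine ((hasDerivAt_area hm x).mul ((hasDerivAt_const x (-5)).div
        (((hasDerivAt_id x).neg.add_const 4).pow 2) (pow_ne_zero 2 hx3))).congr_deriv ?_
      simp only [id, Pi.pow_apply, Pi.neg_apply, Pi.div_apply]
      rw [abs_of_neg (by linarith), sgn1_of_le hx.le]; field_simp; ring
  mf := by
    refine Measurable.ite (measurableSet_le (by fun_prop) (by fun_prop)) (by fun_prop) (by fun_prop)
  mg := by
    have := continuous_sgn1.measurable
    refine Measurable.ite (measurableSet_le (by fun_prop) (by fun_prop)) (by fun_prop) (by fun_prop)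
  mz := by
    have := continuous_sgn1.measurable
    have := (continuous_area hm).measurable
    have := (continuous_logDer m).measurable
    refine Measurable.ite (measurableSet_le (by fun_prop) (by fun_prop)) (by fun_prop) (by fun_prop)
  bdd R := by
    have h1 := continuous_sgn1
    have h2 := continuous_area hm
    have h3 := continuous_logDer m
    have key : ∀ {u v : ℝ → ℝ}, Continuous u → Continuous v →
        ∃ C, ∀ x, |x| ≤ R → |if |x| ≤ 1 then u x else v x| ≤ C := by
      intro u v hu hv
      obtain ⟨C, hC⟩ := exists_bound_of_continuous hu R
      obtain ⟨D, hD⟩ := exists_bound_of_continuous hv R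
      refine ⟨max C D, fun x hx => ?_⟩
      split_ifs
      · exact (hC x hx).trans (le_max_left _ _)
      · exact (hD x hx).trans (le_max_right _ _)
    refine exists_bound_three (key (by fun_prop) ?_) (key (by fun_prop) ?_)
      (key (by fun_prop) ?_)
    · exact Continuous.div (by fun_prop) (by fun_prop) fun x => by positivity
    · exact Continuous.div (by fun_prop) (by fun_prop) fun x => by positivity
    · refine h2.mul (Continuous.div ?_ (by fun_prop) fun x => by positivity)
      refine continuous_const.mul ((h1.mul h3).sub ?_)
      exact Continuous.div (by fun_prop) (by fun_prop) fun x => by positivity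

/-- Since l² ≤ q n, the integrated form is bounded below by a binary quadratic form in √q and √n, so
the usual discriminant test applies. -/
theorem quadForm_nonneg {a b c q l n : ℝ} (ha : 0 ≤ a) (hc : 0 ≤ c) (hb : b ^ 2 ≤ 4 * a * c)
    (hq : 0 ≤ q) (hn : 0 ≤ n) (hl : l ^ 2 ≤ q * n) : 0 ≤ a * q + b * l + c * n := by
  have h1 : (b * l) ^ 2 ≤ (a * q + c * n) ^ 2 := by
    have : (b * l) ^ 2 ≤ 4 * a * c * (q * n) := by
      rw [mul_pow]; exact mul_le_mul hb hl (sq_nonneg _) (by positivity)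
    nlinarith [sq_nonneg (a * q - c * n)]
  have := abs_le_of_sq_le_sq' h1 (by positivity)
  linarith [this.1]

/-- The discriminant condition for the core multiplier. -/
theorem core_discriminant {s t : ℝ} (ht : 0 ≤ t) (hts : t ≤ s) (hs : s ≤ 1) :
    s * (11 + s) ^ 2 / 25
      ≤ 4 * (199 / 100 + 2 * s - t * (2 - 2 / 3 * s)) * (t / 5 + 9 / 100 + 3 / 10 * s) := by
  have h0 : 0 ≤ s := ht.trans hts
  -- The right-hand side is concave in t, so only the endpoints matter: `e0` is the gap at t = 0,
  -- `e1` the gap at t = s with its cubic coefficient rounded down.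
  have e0 : 0 < 7164 / 10000 - 1732 / 1000 * s + 152 / 100 * s ^ 2 - 4 / 100 * s ^ 3 := by
    nlinarith [sq_nonneg (s - 57 / 100), mul_nonneg (sq_nonneg s) (sub_nonneg.2 hs)]
  have e1 : 0 < 7164 / 10000 - 86 / 100 * s - 64 / 100 * s ^ 2 + 129 / 100 * s ^ 3 := by
    nlinarith [mul_nonneg h0 (sq_nonneg (s - 65 / 100)), sq_nonneg (s - 65 / 100)]
  rcases h0.eq_or_lt with rfl | hpos
  · obtain rfl : t = 0 := le_antisymm hts ht
    norm_num
  have k := mul_nonneg ht (sub_nonneg.2 hts)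
  have k2 : 0 ≤ (s - t) * (7164 / 10000 - 1732 / 1000 * s + 152 / 100 * s ^ 2 - 4 / 100 * s ^ 3) :=
    mul_nonneg (sub_nonneg.2 hts) e0.le
  have k3 : 0 ≤ t * (7164 / 10000 - 86 / 100 * s - 64 / 100 * s ^ 2 + 129 / 100 * s ^ 3) :=
    mul_nonneg ht e1.le
  have k4 : 0 ≤ t * (s - t) * s * (2 - 2 / 3 * s) :=
    mul_nonneg (mul_nonneg k h0) (by linarith)
  have k5 : 0 ≤ t * s ^ 3 := by positivity
  -- Multiplying by s clears the convex weights (s-t)/s and t/s of the two endpoints.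
  refine le_of_mul_le_mul_left (a := s) ?_ hpos
  nlinarith

/-- The r-term is absent, the p-coefficient A (x a'/a)(2 + 2x²/3) dominates the weight because W ≤ 2
x a'/a on this region, and the form in q, l, n is nonnegative by `core_discriminant` with s = x². -/
theorem core_bulk_inner {m : ℕ} (hm : 1 ≤ m) {x p q r l n : ℝ} (hx : |x| ≤ 1) (hp : 0 ≤ p)
    (hq : 0 ≤ q) (hn : 0 ≤ n) (hl : l ^ 2 ≤ q * n) :
    1 / 200 * (area m x * q + area m x * wtSq m x * p + n) / (1 + x ^ 2)
      ≤ (coreMultiplier hm).bulk m x p q r l n := by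
  have hA := one_le_area hm x
  have hs1 : x ^ 2 ≤ 1 := (sq_le_one_iff_abs_le_one x).2 hx
  have hr0 := mul_logDer_nonneg hm x
  have hr1 := mul_logDer_le hm hx
  have hW : wtSq m x ≤ 2 * (x * logDer m x) := by
    have h1 : x ^ (2 * m) ≤ 1 := by rw [pow_mul]; exact pow_le_one₀ (sq_nonneg x) hs1
    have h2 : 0 ≤ x ^ (2 * m) := by rw [pow_mul]; positivity
    refine (wtSq_le_pow m x).trans ?_
    rw [mul_logDer hm, ← mul_div_assoc, le_div_iff₀ (by positivity)]
    nlinarith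
  have hW0 := wtSq_nonneg m x
  simp only [Multiplier.bulk, coreMultiplier, if_pos hx]
  set L := logDer m x
  set A := area m x
  set W := wtSq m x
  -- In terms of t ∈ [0, x²] the coefficients depend on m only through t.
  set t := x * L * (1 + x ^ 2) with ht
  have key : (x * L) * (2 + 2 / 3 * x ^ 2) ≤ t * (2 - 2 / 3 * x ^ 2) := by
    rw [ht]
    have : 0 ≤ x * L * (x ^ 2 * (1 - x ^ 2)) := by
      exact mul_nonneg hr0 (mul_nonneg (sq_nonneg x) (by linarith))
    nlinarith
  have hta : 0 ≤ t := by positivity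
  have disc := core_discriminant hta hr1 hs1
  have a1 : 0 ≤ 199 / 100 + 2 * x ^ 2 - t * (2 - 2 / 3 * x ^ 2) := by nlinarith
  -- The true coefficients have 2 and 1/10 in place of 199/100 and 9/100; the two reserved
  -- hundredths pay for the q- and n-terms to be bounded.
  have Q := quadForm_nonneg (a := 199 / 100 + 2 * x ^ 2 - t * (2 - 2 / 3 * x ^ 2))
    (b := x * (11 + x ^ 2) / 5) (c := t / 5 + 9 / 100 + 3 / 10 * x ^ 2) a1 (by positivity)
    (by rw [div_pow, mul_pow]; linarith) hq hn hl
  have Q2 := mul_nonneg (zero_le_one.trans hA) Q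
  have P1 : 0 ≤ A * p * (x * L * (2 + 2 / 3 * x ^ 2) - W / 200) := by
    refine mul_nonneg (by positivity) ?_
    nlinarith [mul_nonneg hr0 (sq_nonneg x)]
  have Q3 : 0 ≤ A * q * (t * (2 - 2 / 3 * x ^ 2) - (x * L) * (2 + 2 / 3 * x ^ 2)) :=
    mul_nonneg (by positivity) (by linarith)
  have N1 : 0 ≤ (A - 1) * n := mul_nonneg (by linarith) hn
  have AQ : 0 ≤ A * q := by positivity
  have top : 1 / 200 * (A * q + A * W * p + n) / (1 + x ^ 2) ≤ 1 / 200 * (A * q + A * W * p + n) :=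
    div_le_self (by positivity) (by nlinarith [sq_nonneg x])
  refine top.trans ?_
  rw [ht] at *
  nlinarith

/-- Coefficient of p for y = |x| ≥ 1. Here and in `ext_q` and `ext_n`, L is replaced by its worst
admissible value; in the variable v = y - 1 ≥ 0 what remains is a polynomial with nonnegative
coefficients. -/
theorem ext_p {y L : ℝ} (hy : 1 ≤ y) (hL : y ≤ L * (1 + y ^ 2)) :
    1 / 200 / (1 + y ^ 2)
      ≤ 88 / 3 / (y + 3) ^ 2 / 2 + L * ((10 * y + 2 / 3) / (y + 3)) - 10 / (y + 4) := by
  have h1 : y / (1 + y ^ 2) ≤ L := (div_le_iff₀ (by positivity)).2 hL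
  have h2 : y / (1 + y ^ 2) * ((10 * y + 2 / 3) / (y + 3)) ≤ L * ((10 * y + 2 / 3) / (y + 3)) :=
    mul_le_mul_of_nonneg_right h1 (by positivity)
  have h3 : 1 / 200 / (1 + y ^ 2) + 10 / (y + 4)
      ≤ 44 / 3 / (y + 3) ^ 2 + (y * (10 * y + 2 / 3)) / ((1 + y ^ 2) * (y + 3)) := by
    obtain ⟨v, rfl⟩ : ∃ v, y = 1 + v := ⟨y - 1, by ring⟩
    have hv : 0 ≤ v := by linarith
    rw [div_add_div _ _ (by positivity) (by positivity),
      div_add_div _ _ (by positivity) (by positivity), div_le_div_iff₀ (by positivity)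
      (by positivity), ← sub_nonneg]
    ring_nf
    positivity
  rw [div_mul_div_comm] at h2
  have e : (88 : ℝ) / 3 / (y + 3) ^ 2 / 2 = 44 / 3 / (y + 3) ^ 2 := by ring
  linarith

theorem ext_q {y L : ℝ} (hy : 1 ≤ y) (hL : y * L ≤ 1) :
    1 / 200 / (1 + y ^ 2)
      ≤ 88 / 3 / (y + 3) ^ 2 / 2 - L * ((10 * y + 2 / 3) / (y + 3)) + 10 / (y + 4) := by
  have hy0 : 0 < y := by linarith
  have h1 : L ≤ 1 / y := (le_div_iff₀ hy0).2 (by linarith)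
  have h2 : L * ((10 * y + 2 / 3) / (y + 3)) ≤ 1 / y * ((10 * y + 2 / 3) / (y + 3)) :=
    mul_le_mul_of_nonneg_right h1 (by positivity)
  have h3 : 1 / 200 / (1 + y ^ 2) + (1 * (10 * y + 2 / 3)) / (y * (y + 3))
      ≤ 44 / 3 / (y + 3) ^ 2 + 10 / (y + 4) := by
    obtain ⟨v, rfl⟩ : ∃ v, y = 1 + v := ⟨y - 1, by ring⟩
    have hv : 0 ≤ v := by linarith
    rw [div_add_div _ _ (by positivity) (by positivity),
      div_add_div _ _ (by positivity) (by positivity), div_le_div_iff₀ (by positivity)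
      (by positivity), ← sub_nonneg]
    ring_nf
    positivity
  rw [div_mul_div_comm] at h2
  have e : (88 : ℝ) / 3 / (y + 3) ^ 2 / 2 = 44 / 3 / (y + 3) ^ 2 := by ring
  linarith

theorem ext_r {y : ℝ} (hy : 1 ≤ y) : 0 ≤ 10 / (y + 4) - 88 / 3 / (y + 3) ^ 2 / 2 := by
  have e : (88 : ℝ) / 3 / (y + 3) ^ 2 / 2 = 44 / 3 / (y + 3) ^ 2 := by ring
  rw [e, sub_nonneg, div_le_div_iff₀ (by positivity) (by positivity)]
  nlinarith

theorem ext_n {y L A : ℝ} (hy : 1 ≤ y) (hL : y ≤ L * (1 + y ^ 2)) (hA : 1 + y ^ 2 ≤ 2 * A) :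
    1 / 200 / (1 + y ^ 2) ≤ A * (10 * (L - 1 / (y + 4)) / (y + 4) ^ 2) := by
  have h1 : y / (1 + y ^ 2) - 1 / (y + 4) ≤ L - 1 / (y + 4) :=
    sub_le_sub_right ((div_le_iff₀ (by positivity)).2 hL) _
  have h2 : y / (1 + y ^ 2) - 1 / (y + 4) = (4 * y - 1) / ((1 + y ^ 2) * (y + 4)) := by
    field_simp; ring
  have h3 : (1 + y ^ 2) / 2 * (10 * ((4 * y - 1) / ((1 + y ^ 2) * (y + 4))) / (y + 4) ^ 2)
      ≤ A * (10 * (L - 1 / (y + 4)) / (y + 4) ^ 2) := by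
    rw [← h2]
    have : 0 ≤ y / (1 + y ^ 2) - 1 / (y + 4) := by
      rw [h2]; exact div_nonneg (by linarith) (by positivity)
    have hA' : (1 + y ^ 2) / 2 ≤ A := by linarith
    have hA0 : 0 ≤ A := le_trans (by positivity) hA'
    gcongr
  refine le_trans ?_ h3
  have h4 : (1 + y ^ 2) / 2 * (10 * ((4 * y - 1) / ((1 + y ^ 2) * (y + 4))) / (y + 4) ^ 2)
      = 5 * (4 * y - 1) / (y + 4) ^ 3 := by field_simp; ring
  rw [h4, div_div, div_le_div_iff₀ (by positivity) (by positivity), ← sub_nonneg]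
  obtain ⟨v, rfl⟩ : ∃ v, y = 1 + v := ⟨y - 1, by ring⟩
  have hv : 0 ≤ v := by linarith
  ring_nf
  positivity

/-- As f and z are odd and a'/a is odd, everything reduces to y = |x|, where the four coefficients
are handled separately by `ext_p`, `ext_q`, `ext_r`, `ext_n`. -/
theorem core_bulk_outer {m : ℕ} (hm : 1 ≤ m) {x p q r l n : ℝ} (hx : 1 < |x|) (hp : 0 ≤ p)
    (hq : 0 ≤ q) (hr : 0 ≤ r) (hn : 0 ≤ n) :
    1 / 200 * (area m x * q + area m x * wtSq m x * p + n) / (1 + x ^ 2)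
      ≤ (coreMultiplier hm).bulk m x p q r l n := by
  have hA2 := jb_sq_le_area hm x
  have hA := area_pos m x
  have hr1 := mul_logDer_le_one hm x
  have hr2 := le_mul_logDer hm hx.le
  have hW0 := wtSq_nonneg m x
  have hW1 := wtSq_le_one m x
  obtain ⟨hσ, hxσ⟩ : sgn1 x ^ 2 = 1 ∧ x = sgn1 x * |x| := by
    rcases lt_abs.1 hx with h | h
    · rw [sgn1_of_one_le h.le, abs_of_pos (by linarith)]; norm_num
    · rw [sgn1_of_le (by linarith), abs_of_neg (by linarith)]; norm_num
  simp only [Multiplier.bulk, coreMultiplier, if_neg (not_le.2 hx)]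
  set L := logDer m x
  set A := area m x
  set W := wtSq m x
  set σ := sgn1 x
  set y := |x| with hy
  have hx2 : x ^ 2 = y ^ 2 := (sq_abs x).symm
  have hxL : x * L = y * (σ * L) := by rw [hxσ]; ring
  have hf : L * ((10 * x + 2 / 3 * σ) / (y + 3)) = σ * L * ((10 * y + 2 / 3) / (y + 3)) := by
    rw [hxσ]; ring
  rw [hxL] at hr1 hr2
  rw [hx2] at hr2 hA2 ⊢
  have hL : y ≤ σ * L * (1 + y ^ 2) := by
    refine le_of_mul_le_mul_left (a := y) ?_ (by linarith)
    linarith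
  have e1 := ext_p hx.le hL
  have e2 := ext_q hx.le hr1
  have e3 := ext_r hx.le
  have e4 := ext_n hx.le hL hA2
  rw [hf]
  -- The choice of z removes the cross term, so no discriminant is needed outside.
  have e5 : A * (-10 * σ / (y + 4) ^ 2) + 2 * (A * (5 * σ / (y + 4) ^ 2)) = 0 := by ring
  rw [e5, zero_mul, add_zero]
  have k1 := mul_le_mul_of_nonneg_left e1 (mul_nonneg hA.le hp)
  have k2 := mul_le_mul_of_nonneg_left e2 (mul_nonneg hA.le hq)
  have k3 := mul_nonneg e3 hr
  have k4 := mul_le_mul_of_nonneg_right e4 hn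
  have k5 : A * p * W * (1 / 200 / (1 + y ^ 2)) ≤ A * p * 1 * (1 / 200 / (1 + y ^ 2)) := by gcongr
  have e6 : 1 / 200 * (A * q + A * W * p + n) / (1 + y ^ 2)
      = A * q * (1 / 200 / (1 + y ^ 2)) + A * p * W * (1 / 200 / (1 + y ^ 2))
        + 1 / 200 / (1 + y ^ 2) * n := by ring
  rw [e6]
  linarith

theorem core_bulk {m : ℕ} (hm : 1 ≤ m) {x p q r l n : ℝ} (hp : 0 ≤ p)
    (hq : 0 ≤ q) (hr : 0 ≤ r) (hn : 0 ≤ n) (hl : l ^ 2 ≤ q * n) :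
    1 / 200 * (area m x * q + area m x * wtSq m x * p + n) / (1 + x ^ 2)
      ≤ (coreMultiplier hm).bulk m x p q r l n := by
  rcases le_or_gt |x| 1 with h | h
  · exact core_bulk_inner hm h hp hq hn hl
  · exact core_bulk_outer hm h hp hq hr hn

theorem core_bddBy {m : ℕ} (hm : 1 ≤ m) : (coreMultiplier hm).BddBy 20 := by
  intro x
  have hA := area_le hm x
  have hA0 := area_pos m x
  have hσ := abs_sgn1_le x
  have hy := abs_nonneg x
  have hx2 : x ^ 2 = |x| ^ 2 := (sq_abs x).symm
  have hj : jb x ≤ 1 + |x| := by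
    rw [jb, Real.sqrt_le_left (by positivity)]; nlinarith
  have hj0 := jb_pos x
  simp only [coreMultiplier]
  split_ifs with h
  · have h2 : |x| ^ 2 ≤ 1 := by nlinarith
    have h3 : |x| ^ 3 ≤ 1 := pow_le_one₀ hy h
    refine ⟨?_, ?_, ?_⟩
    · refine (abs_add_le _ _).trans ?_
      rw [abs_mul, abs_mul, abs_pow, abs_of_pos (by norm_num : (0 : ℝ) < 2),
        abs_of_pos (by norm_num : (0 : ℝ) < 2 / 3)]
      linarith
    · rw [abs_of_pos (by positivity)]
      nlinarith
    · rw [abs_mul, abs_of_pos hA0, abs_div, abs_mul, abs_of_pos (by norm_num : (0 : ℝ) < 10),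
        abs_of_pos (by positivity : 0 < 1 + x ^ 2)]
      have : |x| * (1 + x ^ 2) ≤ 1 * 2 := by gcongr; linarith
      have : area m x * (|x| * (1 + x ^ 2) / 10) ≤ 2 * (2 / 10) := by gcongr <;> linarith
      linarith
  · refine ⟨?_, ?_, ?_⟩
    · rw [abs_div, abs_of_pos (by positivity : 0 < |x| + 3), div_le_iff₀ (by positivity)]
      refine (abs_add_le _ _).trans ?_
      rw [abs_mul, abs_mul, abs_of_pos (by norm_num : (0 : ℝ) < 10),
        abs_of_pos (by norm_num : (0 : ℝ) < 2 / 3)]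
      linarith
    · rw [abs_of_pos (by positivity), div_mul_eq_mul_div, div_le_iff₀ (by positivity)]
      linarith
    · rw [abs_mul, abs_of_pos hA0, abs_div, abs_mul, abs_of_pos (by norm_num : (0 : ℝ) < 5),
        abs_of_pos (by positivity : 0 < (|x| + 4) ^ 2), ← mul_div_assoc,
        div_le_iff₀ (by positivity)]
      have : area m x * (5 * |sgn1 x|) ≤ (1 + x ^ 2) * (5 * 1) := by gcongr
      nlinarith

/-- Arithmetic–geometric mean after Cauchy–Schwarz. One factor 1/⟨x⟩ turns a product of u with a
derivative into terms that the energy and Hardy's inequality control. -/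
theorem abs_div_jb_le {l q n : ℝ} (x : ℝ) (hl : l ^ 2 ≤ q * n) (hq : 0 ≤ q) (hn : 0 ≤ n) :
    |l| / jb x ≤ (q + n / (1 + x ^ 2)) / 2 := by
  have hj := jb_pos x
  rw [← jb_sq]
  have h : (|l| / jb x) ^ 2 ≤ ((q + n / jb x ^ 2) / 2) ^ 2 := by
    have : (|l| / jb x) ^ 2 ≤ q * (n / jb x ^ 2) := by
      rw [div_pow, sq_abs, ← mul_div_assoc]; gcongr
    nlinarith [sq_nonneg (q - n / jb x ^ 2)]
  exact le_of_sq_le_sq h (by positivity)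

/-! ### The angular multiplier -/

theorem hasDerivAt_one_add_sq (x : ℝ) : HasDerivAt (fun x : ℝ => 1 + x ^ 2) (2 * x) x := by
  simpa using (hasDerivAt_pow 2 x).const_add 1

/-- The multiplier that recovers the angular derivatives. -/
def angularMultiplier {m : ℕ} (hm : 1 ≤ m) : Multiplier :=
  Multiplier.ofContinuous (fun _ => 0) (fun x => wtSq m x / (1 + x ^ 2)) (fun _ => 0) (fun _ => 0)
    (fun x => (wtSqDer m x * (1 + x ^ 2) - wtSq m x * (2 * x)) / (1 + x ^ 2) ^ 2) (fun _ => 0)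
    (fun x => hasDerivAt_const x 0)
    (fun x => (hasDerivAt_wtSq hm x).div (hasDerivAt_one_add_sq x) (by positivity))
    (fun x => hasDerivAt_const x 0) continuous_const
    (Continuous.div (by
      have := continuous_wtSq m
      have := continuous_wtSqDer m
      fun_prop) (by fun_prop) fun x => by positivity) continuous_const

theorem angular_bddBy {m : ℕ} (hm : 1 ≤ m) : (angularMultiplier hm).BddBy 1 := by
  intro x
  have h := wtSq_le_one m x
  have h0 := wtSq_nonneg m x
  have hj := one_le_jb x
  have hs := jb_sq x
  refine ⟨by simp [angularMultiplier, Multiplier.ofContinuous], ?_, by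
    simp [angularMultiplier, Multiplier.ofContinuous]⟩
  simp only [angularMultiplier, Multiplier.ofContinuous]
  rw [← hs, abs_of_nonneg (by positivity), div_mul_eq_mul_div, div_le_one (by positivity)]
  nlinarith

/-- With f = z = 0 the bulk is g (r - A p + A q) + A g' l: angular derivatives are bought with time
derivatives of the same weight g = W/⟨x⟩². As A g' = O(1/⟨x⟩), the cross term is an error in q and
n. -/
theorem angular_bulk {m : ℕ} (hm : 1 ≤ m) {x p q r l n : ℝ} (hq : 0 ≤ q) (hn : 0 ≤ n)
    (hl : l ^ 2 ≤ q * n) :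
    (wtSq m x * r - area m x * wtSq m x * p - (2 * m + 2) * (area m x * q + n)) / (1 + x ^ 2)
      ≤ (angularMultiplier hm).bulk m x p q r l n := by
  have hA := area_le hm x
  have hA0 := area_pos m x
  have hA2 := jb_sq_le_area hm x
  have hW0 := wtSq_nonneg m x
  have hW1 := wtSq_le_one m x
  have hj := jb_pos x
  have hj1 := one_le_jb x
  have hs := jb_sq x
  have hxj := abs_le_jb x
  have hW' : |wtSqDer m x| ≤ 2 * m / jb x ^ 3 := (le_div_iff₀ (by positivity)).2 (abs_wtSqDer_le hm x)
  have hg : |area m x * ((wtSqDer m x * (1 + x ^ 2) - wtSq m x * (2 * x)) / (1 + x ^ 2) ^ 2)|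
      ≤ (2 * m + 2) / jb x := by
    rw [← hs] at hA ⊢
    rw [abs_mul, abs_div, abs_of_pos hA0, abs_of_pos (by positivity : 0 < (jb x ^ 2) ^ 2)]
    have h1 : |wtSqDer m x * jb x ^ 2 - wtSq m x * (2 * x)| ≤ (2 * m + 2) * jb x := by
      refine (abs_sub _ _).trans ?_
      rw [abs_mul, abs_mul, abs_mul, abs_of_nonneg hW0, abs_of_pos (by positivity : 0 < jb x ^ 2),
        abs_of_pos (by norm_num : (0 : ℝ) < 2)]
      have a1 : |wtSqDer m x| * jb x ^ 2 ≤ 2 * m / jb x ^ 3 * jb x ^ 2 := by gcongr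
      have a2 : 2 * (m : ℝ) / jb x ^ 3 * jb x ^ 2 = 2 * m / jb x := by field_simp
      have a3 : 2 * (m : ℝ) / jb x ≤ 2 * m * jb x := by
        rw [div_le_iff₀ hj]
        have : (0 : ℝ) ≤ 2 * m := by positivity
        nlinarith
      have a4 : wtSq m x * (2 * |x|) ≤ 1 * (2 * jb x) := by gcongr
      linarith
    calc area m x * (|wtSqDer m x * jb x ^ 2 - wtSq m x * (2 * x)| / (jb x ^ 2) ^ 2)
        ≤ jb x ^ 2 * ((2 * m + 2) * jb x / (jb x ^ 2) ^ 2) := by gcongr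
      _ = (2 * m + 2) / jb x := by field_simp
  have hl' := abs_div_jb_le x hl hq hn
  have hgl : -((2 * m + 2) * ((q + n / (1 + x ^ 2)) / 2)) ≤
      area m x * ((wtSqDer m x * (1 + x ^ 2) - wtSq m x * (2 * x)) / (1 + x ^ 2) ^ 2) * l := by
    refine neg_le_of_abs_le ?_
    rw [abs_mul]
    calc _ ≤ (2 * m + 2) / jb x * |l| := by gcongr
      _ = (2 * m + 2) * (|l| / jb x) := by ring
      _ ≤ _ := by gcongr
  have hq2 : q ≤ 2 * (area m x * q / (1 + x ^ 2)) := by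
    rw [← mul_div_assoc, le_div_iff₀ (by positivity)]; nlinarith
  simp only [Multiplier.bulk, angularMultiplier, Multiplier.ofContinuous]
  have e : (wtSq m x * r - area m x * wtSq m x * p - (2 * m + 2) * (area m x * q + n)) / (1 + x ^ 2)
      = wtSq m x / (1 + x ^ 2) * r - area m x * (wtSq m x / (1 + x ^ 2)) * p
        - (2 * m + 2) * (area m x * q / (1 + x ^ 2)) - (2 * m + 2) * (n / (1 + x ^ 2)) := by ring
  rw [e]
  have k1 : 0 ≤ area m x * (wtSq m x / (1 + x ^ 2)) * q := by positivity
  have k2 : 0 ≤ (2 * m + 2) * (n / (1 + x ^ 2)) := by positivity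
  have k3 : (2 * (m : ℝ) + 2) * q ≤ (2 * m + 2) * (2 * (area m x * q / (1 + x ^ 2))) := by gcongr
  linarith

/-! ### The multiplier at scale b, and the combination of the three multipliers -/

/-- The derivative of `x / (⟨x⟩ (⟨x⟩ + b)²)`. -/
theorem hasDerivAt_div_jb_mul {b : ℝ} (hb : 0 < b) (x : ℝ) :
    HasDerivAt (fun x => x / (jb x * (jb x + b) ^ 2))
      (1 / (jb x ^ 3 * (jb x + b) ^ 2) - 2 * x ^ 2 / (jb x ^ 2 * (jb x + b) ^ 3)) x := by
  have hj := jb_pos x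
  have hs := jb_sq x
  refine ((hasDerivAt_id x).div ((hasDerivAt_jb x).mul (((hasDerivAt_jb x).add_const b).pow 2))
    (by simp only [Pi.mul_apply, Pi.pow_apply]; positivity)).congr_deriv ?_
  simp only [id, Pi.mul_apply, Pi.pow_apply]
  have hx2 : x ^ 2 = jb x ^ 2 - 1 := by linarith
  field_simp
  rw [show x ^ 2 = jb x ^ 2 - 1 from hx2]
  ring

/-- The multiplier adapted to the scale `b`. -/
def scaleMultiplier {m : ℕ} (hm : 1 ≤ m) {b : ℝ} (hb : 0 < b) : Multiplier :=
  have hjb : ∀ x, 0 < jb x + b := fun x => add_pos (jb_pos x) hb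
  have c1 := continuous_jb
  have c2 := continuous_wtSq m
  have c3 := continuous_wtSqDer m
  have c4 := continuous_area hm
  have c5 := continuous_logDer m
  -- The function x/(⟨x⟩+b) is bounded by 1 uniformly in b, and its derivative is at least
  -- b/(⟨x⟩+b)², of size 1/b where ⟨x⟩ ≈ b. The correction z cancels the part of A g' l in which the
  -- derivative falls on 1/(⟨x⟩+b).
  Multiplier.ofContinuous (fun x => wtSq m x * (x / (jb x + b))) (fun x => wtSq m x / (jb x + b))
    (fun x => area m x * (wtSq m x * (x / (jb x * (jb x + b) ^ 2))) / 2)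
    (fun x => wtSqDer m x * (x / (jb x + b))
      + wtSq m x * ((1 * (jb x + b) - x * (x / jb x)) / (jb x + b) ^ 2))
    (fun x => (wtSqDer m x * (jb x + b) - wtSq m x * (x / jb x)) / (jb x + b) ^ 2)
    (fun x => (2 * logDer m x * area m x * (wtSq m x * (x / (jb x * (jb x + b) ^ 2)))
      + area m x * (wtSqDer m x * (x / (jb x * (jb x + b) ^ 2)) + wtSq m x *
        (1 / (jb x ^ 3 * (jb x + b) ^ 2) - 2 * x ^ 2 / (jb x ^ 2 * (jb x + b) ^ 3)))) / 2)
    (fun x => (hasDerivAt_wtSq hm x).mul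
      ((hasDerivAt_id x).div ((hasDerivAt_jb x).add_const b) (hjb x).ne'))
    (fun x => (hasDerivAt_wtSq hm x).div ((hasDerivAt_jb x).add_const b) (hjb x).ne')
    (fun x => ((hasDerivAt_area hm x).mul
      ((hasDerivAt_wtSq hm x).mul (hasDerivAt_div_jb_mul hb x))).div_const 2)
    (by
      refine (c3.mul (continuous_id.div (by fun_prop) fun x => (hjb x).ne')).add
        (c2.mul (Continuous.div (Continuous.sub (by fun_prop)
          (continuous_id.mul (continuous_id.div c1 fun x => (jb_pos x).ne'))) (by fun_prop)
          fun x => (pow_pos (hjb x) 2).ne')))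
    (by
      refine Continuous.div (Continuous.sub (by fun_prop)
        (c2.mul (continuous_id.div c1 fun x => (jb_pos x).ne'))) (by fun_prop)
        fun x => (pow_pos (hjb x) 2).ne')
    (by
      have k : Continuous fun x => x / (jb x * (jb x + b) ^ 2) :=
        continuous_id.div (by fun_prop) fun x => (mul_pos (jb_pos x) (pow_pos (hjb x) 2)).ne'
      have k2 : Continuous fun x =>
          1 / (jb x ^ 3 * (jb x + b) ^ 2) - 2 * x ^ 2 / (jb x ^ 2 * (jb x + b) ^ 3) :=
        (Continuous.div (by fun_prop) (by fun_prop) fun x =>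
          (mul_pos (pow_pos (jb_pos x) 3) (pow_pos (hjb x) 2)).ne').sub
        (Continuous.div (by fun_prop) (by fun_prop) fun x =>
          (mul_pos (pow_pos (jb_pos x) 2) (pow_pos (hjb x) 3)).ne')
      fun_prop)

theorem scale_bddBy {m : ℕ} (hm : 1 ≤ m) {b : ℝ} (hb : 0 < b) :
    (scaleMultiplier hm hb).BddBy 1 := by
  intro x
  have h := wtSq_le_one m x
  have h0 := wtSq_nonneg m x
  have hj := one_le_jb x
  have hj0 := jb_pos x
  have hs := jb_sq x
  have hxj := abs_le_jb x
  have hA := area_le hm x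
  have hA0 := area_pos m x
  rw [← hs] at hA
  have hjb : 0 < jb x + b := by linarith
  simp only [scaleMultiplier, Multiplier.ofContinuous]
  refine ⟨?_, ?_, ?_⟩
  · rw [abs_mul, abs_div, abs_of_nonneg h0, abs_of_pos hjb]
    refine mul_le_one₀ h (by positivity) ((div_le_one hjb).2 (by linarith))
  · rw [abs_of_nonneg (by positivity), div_mul_eq_mul_div, div_le_one hjb]
    nlinarith
  · rw [abs_div, abs_mul, abs_mul, abs_div, abs_of_nonneg h0, abs_of_pos hA0,
      abs_of_pos (by norm_num : (0 : ℝ) < 2), abs_of_pos (by positivity : 0 < jb x * (jb x + b) ^ 2)]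
    have k1 : |x| / (jb x * (jb x + b) ^ 2) ≤ jb x / (jb x * (jb x) ^ 2) := by
      gcongr; linarith
    have k2 : area m x * (wtSq m x * (|x| / (jb x * (jb x + b) ^ 2)))
        ≤ jb x ^ 2 * (1 * (jb x / (jb x * (jb x) ^ 2))) := by gcongr
    have k3 : jb x ^ 2 * (1 * (jb x / (jb x * (jb x) ^ 2))) = 1 := by field_simp
    linarith

-- The errors come from derivatives of W and from 1 - x a'/a, both of relative size ⟨x⟩⁻², with
-- constants independent of b. The factor W in the multiplier ensures that the p- and r-errors carry
-- the weight W, without which they could not be absorbed at the trapped sphere.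
set_option maxHeartbeats 1000000 in
theorem scale_bulk {m : ℕ} (hm : 1 ≤ m) {b : ℝ} (hb : 1 ≤ b) {x p q r l n : ℝ}
    (hp : 0 ≤ p) (hq : 0 ≤ q) (hr : 0 ≤ r) (hn : 0 ≤ n) (hl : l ^ 2 ≤ q * n) :
    wtSq m x * (area m x * (b / (2 * (jb x + b) ^ 2)) * (p + q) + 1 / (2 * (jb x + b)) * r
        + area m x * (b / (jb x * (jb x + b) ^ 3)) * n)
      - (2 * m + 2) * (area m x * q + area m x * wtSq m x * p + wtSq m x * r + n) / (1 + x ^ 2)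
      ≤ (scaleMultiplier hm (zero_lt_one.trans_le hb)).bulk m x p q r l n := by
  have hA := area_le hm x
  have hA0 := area_pos m x
  have hA2 := jb_sq_le_area hm x
  have hW0 := wtSq_nonneg m x
  have hW1 := wtSq_le_one m x
  have hj := jb_pos x
  have hj1 := one_le_jb x
  have hs := jb_sq x
  have hW' : |wtSqDer m x| ≤ 2 * m / jb x ^ 3 := (le_div_iff₀ (by positivity)).2 (abs_wtSqDer_le hm x)
  have hxW := mul_wtSqDer hm x
  have hρ0 := mul_logDer_nonneg hm x
  have hρ1 := mul_logDer_le_one hm x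
  have hρ2 := one_sub_mul_logDer_le hm x
  have hl' := abs_div_jb_le x hl hq hn
  have hb0 : 0 < b := by linarith
  have hx2 : x ^ 2 = jb x ^ 2 - 1 := by linarith
  simp only [Multiplier.bulk, scaleMultiplier, Multiplier.ofContinuous]
  rw [← hs] at hA hA2 hxW hρ2 hl' ⊢
  set J := jb x
  set A := area m x
  set W := wtSq m x
  set V := wtSqDer m x
  set L := logDer m x
  have hJb : 0 < J + b := by linarith
  clear_value J A W V L
  -- the derivative of `x / (⟨x⟩ + b)`
  set φ := (1 * (J + b) - x * (x / J)) / (J + b) ^ 2 with hφ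
  have hφe : φ = (b + 1 / J) / (J + b) ^ 2 := by
    rw [hφ]; congr 1; field_simp; rw [hx2]; ring
  have hφ1 : b / (J + b) ^ 2 ≤ φ := by
    rw [hφe]; gcongr; linarith [one_div_pos.2 hj]
  have hφ2 : φ ≤ 1 / (J + b) := by
    rw [hφe, div_le_div_iff₀ (by positivity) hJb]
    have : 1 / J ≤ J := by rw [div_le_iff₀ hj]; nlinarith
    nlinarith
  have hVx : V * (x / (J + b)) = 2 * m * W / J ^ 2 / (J + b) := by rw [← hxW]; ring
  have hρ3 : 1 - x * L ≤ 2 / J ^ 2 := (le_div_iff₀ (by positivity)).2 hρ2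
  have inv1 : 1 / (J + b) ≤ 1 := (div_le_one hJb).2 (by linarith)
  have hm0 : (0 : ℝ) ≤ m := Nat.cast_nonneg m
  -- the coefficient of `p`
  have cp : W * (b / (2 * (J + b) ^ 2)) - 2 * W / J ^ 2 ≤
      (V * (x / (J + b)) + W * φ) / 2 + L * (W * (x / (J + b))) - W / (J + b) := by
    have k1 : 0 ≤ V * (x / (J + b)) := by rw [hVx]; positivity
    have k2 : L * (W * (x / (J + b))) - W / (J + b) = -(W * ((1 - x * L) * (1 / (J + b)))) := by
      ring
    have k3 : (1 - x * L) * (1 / (J + b)) ≤ 2 / J ^ 2 * 1 := by gcongr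
    have k4 := mul_le_mul_of_nonneg_left k3 hW0
    have k5 := mul_le_mul_of_nonneg_left hφ1 hW0
    have k6 : W * (b / (2 * (J + b) ^ 2)) = W * (b / (J + b) ^ 2) / 2 := by
      rw [div_mul_eq_div_div_swap]; ring
    have k7 : 2 * W / J ^ 2 = W * (2 / J ^ 2 * 1) := by ring
    linarith
  have cq : W * (b / (2 * (J + b) ^ 2)) ≤
      (V * (x / (J + b)) + W * φ) / 2 - L * (W * (x / (J + b))) + W / (J + b) := by
    have k1 : 0 ≤ V * (x / (J + b)) := by rw [hVx]; positivity
    have k2 : -(L * (W * (x / (J + b)))) + W / (J + b) = W * ((1 - x * L) * (1 / (J + b))) := by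
      ring
    have k3 : 0 ≤ W * ((1 - x * L) * (1 / (J + b))) :=
      mul_nonneg hW0 (mul_nonneg (by linarith) (by positivity))
    have k5 := mul_le_mul_of_nonneg_left hφ1 hW0
    have k6 : W * (b / (2 * (J + b) ^ 2)) = W * (b / (J + b) ^ 2) / 2 := by
      rw [div_mul_eq_div_div_swap]; ring
    linarith
  have cr : W * (1 / (2 * (J + b))) - m * W / J ^ 2 ≤
      W / (J + b) - (V * (x / (J + b)) + W * φ) / 2 := by
    rw [hVx]
    have k1 : 2 * m * W / J ^ 2 / (J + b) ≤ 2 * m * W / J ^ 2 :=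
      div_le_self (by positivity) (by linarith)
    have k2 := mul_le_mul_of_nonneg_left hφ2 hW0
    have k3 : W * (1 / (2 * (J + b))) = W * (1 / (J + b)) / 2 := by
      rw [div_mul_eq_div_div_swap]; ring
    have k4 : W / (J + b) = W * (1 / (J + b)) := by ring
    have k5 : 2 * m * W / J ^ 2 = 2 * (m * W / J ^ 2) := by ring
    linarith
  -- After the cancellation by z only the derivative of W survives in the cross term.
  have cl : A * ((V * (J + b) - W * (x / J)) / (J + b) ^ 2)
      + 2 * (A * (W * (x / (J * (J + b) ^ 2))) / 2) = A * V / (J + b) := by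
    field_simp; ring
  have cl2 : -(m * (q + n / J ^ 2)) ≤ A * V / (J + b) * l := by
    refine neg_le_of_abs_le ?_
    rw [abs_mul, abs_div, abs_mul, abs_of_pos hA0, abs_of_pos hJb]
    calc A * |V| / (J + b) * |l| ≤ J ^ 2 * (2 * m / J ^ 3) / 1 * |l| := by
          gcongr
          linarith
      _ = 2 * m * (|l| / J) := by field_simp
      _ ≤ 2 * m * ((q + n / J ^ 2) / 2) := by gcongr
      _ = m * (q + n / J ^ 2) := by ring
  -- The gain b/(⟨x⟩+b) is 1 - ⟨x⟩/(⟨x⟩+b): the 1 approximates x a'/a from above, up to 2/⟨x⟩², and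
  -- the subtracted term bounds x²/(⟨x⟩(⟨x⟩+b)).
  have cn : W * (A * (b / (J * (J + b) ^ 3))) - 2 / J ^ 2 ≤
      (2 * L * A * (W * (x / (J * (J + b) ^ 2))) + A * (V * (x / (J * (J + b) ^ 2)) + W *
        (1 / (J ^ 3 * (J + b) ^ 2) - 2 * x ^ 2 / (J ^ 2 * (J + b) ^ 3)))) / 2 := by
    have k1 : 0 ≤ A * (V * (x / (J * (J + b) ^ 2))) := by
      have : V * (x / (J * (J + b) ^ 2)) = 2 * m * W / J ^ 2 / (J * (J + b) ^ 2) := by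
        rw [← hxW]; ring
      rw [this]; positivity
    have k2 : 0 ≤ A * (W * (1 / (J ^ 3 * (J + b) ^ 2))) := by positivity
    have k3 : (J ^ 2 - 1) / (J * (J + b)) ≤ J / (J + b) := by
      rw [div_le_div_iff₀ (by positivity) hJb]; nlinarith
    have k4 : b / (J + b) - 2 / J ^ 2 ≤ x * L - x ^ 2 / (J * (J + b)) := by
      rw [hx2]
      have : b / (J + b) = 1 - J / (J + b) := by field_simp; ring
      linarith
    have k5 : 0 ≤ A * W / (J * (J + b) ^ 2) := by positivity
    have k6 := mul_le_mul_of_nonneg_left k4 k5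
    have k7 : A * W / (J * (J + b) ^ 2) * (2 / J ^ 2) ≤ 2 / J ^ 2 := by
      refine mul_le_of_le_one_left (by positivity) ((div_le_one (by positivity)).2 ?_)
      calc A * W ≤ J ^ 2 * 1 := by gcongr
        _ ≤ J * J ^ 2 := by rw [mul_comm]; exact mul_le_mul_of_nonneg_right hj1 (sq_nonneg J)
        _ ≤ J * (J + b) ^ 2 := by gcongr; linarith
    have k8 : A * W / (J * (J + b) ^ 2) * (b / (J + b) - 2 / J ^ 2)
        = W * (A * (b / (J * (J + b) ^ 3))) - A * W / (J * (J + b) ^ 2) * (2 / J ^ 2) := by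
      field_simp
    have k9 : A * W / (J * (J + b) ^ 2) * (x * L - x ^ 2 / (J * (J + b)))
        = (2 * L * A * (W * (x / (J * (J + b) ^ 2)))
          - A * (W * (2 * x ^ 2 / (J ^ 2 * (J + b) ^ 3)))) / 2 := by
      field_simp
    linarith
  rw [cl]
  have hq2 : q ≤ 2 * (A * q / J ^ 2) := by
    rw [← mul_div_assoc, le_div_iff₀ (by positivity)]; nlinarith
  have t1 := mul_le_mul_of_nonneg_left cp (mul_nonneg hA0.le hp)
  have t2 := mul_le_mul_of_nonneg_left cq (mul_nonneg hA0.le hq)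
  have t3 := mul_le_mul_of_nonneg_right cr hr
  have t4 := mul_le_mul_of_nonneg_right cn hn
  have s1 : 0 ≤ (m : ℝ) * (A * W * p / J ^ 2) := by positivity
  have s2 : 0 ≤ (m + 2 : ℝ) * (W * r / J ^ 2) := by positivity
  have s3 : 0 ≤ (m : ℝ) * (n / J ^ 2) := by positivity
  have s4 : 0 ≤ (A * q / J ^ 2) := by positivity
  have s5 : (m : ℝ) * q ≤ m * (2 * (A * q / J ^ 2)) := by gcongr
  have e : (2 * (m : ℝ) + 2) * (A * q + A * W * p + W * r + n) / J ^ 2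
      = (2 * m + 2) * (A * q / J ^ 2) + (2 * m + 2) * (A * W * p / J ^ 2)
        + (2 * m + 2) * (W * r / J ^ 2) + (2 * m + 2) * (n / J ^ 2) := by ring
  rw [e]
  have e2 : A * p * (W * (b / (2 * (J + b) ^ 2)) - 2 * W / J ^ 2)
      = A * W * (b / (2 * (J + b) ^ 2)) * p - 2 * (A * W * p / J ^ 2) := by ring
  have e3 : (W * (1 / (2 * (J + b))) - m * W / J ^ 2) * r
      = W * (1 / (2 * (J + b))) * r - m * (W * r / J ^ 2) := by ring
  have e4 : (W * (A * (b / (J * (J + b) ^ 3))) - 2 / J ^ 2) * n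
      = W * (A * (b / (J * (J + b) ^ 3))) * n - 2 * (n / J ^ 2) := by ring
  rw [e2] at t1
  rw [e3] at t3
  rw [e4] at t4
  linarith

/-- The small factor δ satisfies δ (2m+2) = 1/400, half of the core constant 1/200, so the q- and
n-losses of the angular multiplier are absorbed; δ ≤ 1/800 takes care of its p-loss. -/
theorem core_add_angular_bulk {m : ℕ} (hm : 1 ≤ m) {x p q r l n : ℝ} (hp : 0 ≤ p)
    (hq : 0 ≤ q) (hr : 0 ≤ r) (hn : 0 ≤ n) (hl : l ^ 2 ≤ q * n) :
    1 / (400 * (2 * m + 2)) *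
        ((area m x * q + area m x * wtSq m x * p + wtSq m x * r + n) / (1 + x ^ 2))
      ≤ ((coreMultiplier hm).add
          ((angularMultiplier hm).smul (1 / (400 * (2 * m + 2))))).bulk m x p q r l n := by
  rw [Multiplier.bulk_add, Multiplier.bulk_smul]
  have h1 := core_bulk hm (x := x) hp hq hr hn hl
  have h2 := angular_bulk hm (x := x) (p := p) (r := r) hq hn hl
  have hA := area_pos m x
  have hW := wtSq_nonneg m x
  set δ : ℝ := 1 / (400 * (2 * m + 2)) with hδ
  have hδ0 : 0 < δ := by positivity
  have h3 := mul_le_mul_of_nonneg_left h2 hδ0.le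
  have hδ1 : δ * (2 * m + 2) = 1 / 400 := by rw [hδ]; field_simp
  have hδ2 : δ ≤ 1 / 800 := by
    rw [hδ]; apply one_div_le_one_div_of_le (by norm_num)
    have : (0 : ℝ) ≤ m := Nat.cast_nonneg m
    linarith
  set S := (1 + x ^ 2) with hS
  have hS0 : 0 < S := by positivity
  have a1 : 0 ≤ area m x * q / S := by positivity
  have a2 : 0 ≤ area m x * wtSq m x * p / S := by positivity
  have a4 : 0 ≤ n / S := by positivity
  have e1 : 1 / 200 * (area m x * q + area m x * wtSq m x * p + n) / S
      = 1 / 200 * (area m x * q / S) + 1 / 200 * (area m x * wtSq m x * p / S)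
        + 1 / 200 * (n / S) := by ring
  have e2 : δ * ((wtSq m x * r - area m x * wtSq m x * p
      - (2 * m + 2) * (area m x * q + n)) / S)
      = δ * (wtSq m x * r / S) - δ * (area m x * wtSq m x * p / S)
        - δ * (2 * m + 2) * (area m x * q / S) - δ * (2 * m + 2) * (n / S) := by ring
  have e3 : δ * ((area m x * q + area m x * wtSq m x * p + wtSq m x * r + n) / S)
      = δ * (area m x * q / S) + δ * (area m x * wtSq m x * p / S) + δ * (wtSq m x * r / S)
        + δ * (n / S) := by ring
  rw [e3]
  rw [e1] at h1
  rw [e2, hδ1] at h3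
  have b1 := mul_le_mul_of_nonneg_right hδ2 a1
  have b2 := mul_le_mul_of_nonneg_right hδ2 a2
  have b4 := mul_le_mul_of_nonneg_right hδ2 a4
  linarith

theorem half_pow_le_wtSq {m : ℕ} {x : ℝ} (hx : 1 ≤ x ^ 2) : (1 / 2 : ℝ) ^ m ≤ wtSq m x :=
  pow_le_pow_left₀ (by norm_num) ((div_le_div_iff₀ (by norm_num) (by positivity)).2 (by linarith)) m

/-- On the region `⟨x⟩ ≈ b`, the positive terms of the multiplier at scale `b`. -/
theorem annulus_lower_bound {m : ℕ} (hm : 1 ≤ m) {b : ℝ} (hb : 1 ≤ b) {x p q r n : ℝ}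
    (hp : 0 ≤ p) (hq : 0 ≤ q) (hr : 0 ≤ r) (hn : 0 ≤ n) (h1 : b ≤ jb x) (h2 : jb x ≤ 2 * b) :
    (1 / 2 : ℝ) ^ m / 54 / b * (area m x * q + area m x * wtSq m x * p + wtSq m x * r
        + area m x * n / (1 + x ^ 2))
      ≤ wtSq m x * (area m x * (b / (2 * (jb x + b) ^ 2)) * (p + q) + 1 / (2 * (jb x + b)) * r
          + area m x * (b / (jb x * (jb x + b) ^ 3)) * n)
        + (area m x * q + area m x * wtSq m x * p + wtSq m x * r + n) / (1 + x ^ 2) := by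
  have hA := area_pos m x
  have hA1 := area_le hm x
  have hW := wtSq_nonneg m x
  have hW1 := wtSq_le_one m x
  have hs := jb_sq x
  have hj := jb_pos x
  have hb0 : 0 < b := by linarith
  set A := area m x
  set W := wtSq m x
  set J := jb x
  set c : ℝ := (1 / 2 : ℝ) ^ m with hc
  have hc0 : 0 < c := by positivity
  have hc1 : c ≤ 1 := pow_le_one₀ (by norm_num) (by norm_num)
  have e : c / 54 / b * (A * q + A * W * p + W * r + A * n / (1 + x ^ 2))
      = c / 54 / b * (A * q) + c / 54 / b * (A * W * p) + c / 54 / b * (W * r)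
        + c / 54 / b * (A * n / (1 + x ^ 2)) := by ring
  rw [e]
  -- If x² ≤ 1 the last term alone suffices, as 1 + x² ≤ 2. If x² ≥ 1 then W ≥ 2^{-m} and the scale
  -- terms suffice; 54 = 2·3³ comes from the n-coefficient with ⟨x⟩ ≤ 2b and ⟨x⟩ + b ≤ 3b.
  rcases le_total (x ^ 2) 1 with hx | hx
  · have k0 : c / 54 / b ≤ 1 / (1 + x ^ 2) := by
      rw [div_div, div_le_div_iff₀ (by positivity) (by positivity)]
      nlinarith
    have k1 := mul_le_mul_of_nonneg_right k0 (show 0 ≤ A * q + A * W * p + W * r + n by positivity)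
    have k2 : A * n / (1 + x ^ 2) ≤ n := by
      rw [div_le_iff₀ (by positivity)]; nlinarith
    have k3 : c / 54 / b * (A * n / (1 + x ^ 2)) ≤ c / 54 / b * n := by gcongr
    have k4 : 0 ≤ W * (A * (b / (2 * (J + b) ^ 2)) * (p + q) + 1 / (2 * (J + b)) * r
          + A * (b / (J * (J + b) ^ 3)) * n) := by positivity
    have e2 : (A * q + A * W * p + W * r + n) / (1 + x ^ 2)
      = 1 / (1 + x ^ 2) * (A * q + A * W * p + W * r + n) := by ring
    rw [e2]
    linarith
  · have hcW : c ≤ W := half_pow_le_wtSq hx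
    have hJb : J + b ≤ 3 * b := by linarith
    have k1 : 1 / 54 / b ≤ b / (2 * (J + b) ^ 2) := by
      have : b / (2 * (3 * b) ^ 2) ≤ b / (2 * (J + b) ^ 2) := by gcongr
      refine le_trans ?_ this
      rw [div_div, div_le_div_iff₀ (by positivity) (by positivity)]
      nlinarith
    have k2 : 1 / 54 / b ≤ 1 / (2 * (J + b)) := by
      rw [div_div]
      exact one_div_le_one_div_of_le (by positivity) (by linarith)
    have k3 : 1 / 54 / b / (1 + x ^ 2) ≤ b / (J * (J + b) ^ 3) := by
      have a1 : b / (2 * b * (3 * b) ^ 3) ≤ b / (J * (J + b) ^ 3) := by gcongr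
      have a2 : 1 / 54 / b / (1 + x ^ 2) ≤ 1 / 54 / b / b ^ 2 := by
        rw [← hs]; gcongr
      refine a2.trans (le_trans (le_of_eq ?_) a1)
      field_simp; norm_num
    have t1 : c / 54 / b * (A * q) ≤ W * (A * (b / (2 * (J + b) ^ 2)) * q) := by
      calc c / 54 / b * (A * q) = c * (A * (1 / 54 / b) * q) := by ring
        _ ≤ _ := by gcongr
    have t2 : c / 54 / b * (A * W * p) ≤ W * (A * (b / (2 * (J + b) ^ 2)) * p) := by
      calc c / 54 / b * (A * W * p) = c * (W * (A * (1 / 54 / b) * p)) := by ring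
        _ ≤ 1 * (W * (A * (b / (2 * (J + b) ^ 2)) * p)) := by gcongr
        _ = _ := one_mul _
    have t3 : c / 54 / b * (W * r) ≤ W * (1 / (2 * (J + b)) * r) := by
      calc c / 54 / b * (W * r) = c * (W * ((1 / 54 / b) * r)) := by ring
        _ ≤ 1 * (W * (1 / (2 * (J + b)) * r)) := by gcongr
        _ = _ := one_mul _
    have t4 : c / 54 / b * (A * n / (1 + x ^ 2)) ≤ W * (A * (b / (J * (J + b) ^ 3)) * n) := by
      calc c / 54 / b * (A * n / (1 + x ^ 2)) = c * (A * (1 / 54 / b / (1 + x ^ 2)) * n) := by ring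
        _ ≤ _ := by gcongr
    have t5 : 0 ≤ (A * q + A * W * p + W * r + n) / (1 + x ^ 2) := by positivity
    linarith

/-- For each scale `b` there is a multiplier whose bulk term is nonnegative, and coercive in the
region `⟨x⟩ ≈ b`. -/
theorem exists_multiplier {m : ℕ} (hm : 1 ≤ m) : ∃ C c : ℝ, 0 < c ∧ ∀ b : ℝ, 1 ≤ b →
    ∃ M : Multiplier, M.BddBy C ∧ ∀ x p q r l n : ℝ, 0 ≤ p → 0 ≤ q → 0 ≤ r → 0 ≤ n →
      l ^ 2 ≤ q * n → 0 ≤ M.bulk m x p q r l n ∧ (b ≤ jb x → jb x ≤ 2 * b →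
        c / b * (area m x * q + area m x * wtSq m x * p + wtSq m x * r
          + area m x * n / (1 + x ^ 2)) ≤ M.bulk m x p q r l n) := by
  set δ : ℝ := 1 / (400 * (2 * m + 2)) with hδ
  have hδ0 : 0 < δ := by positivity
  -- Then κδ = (2m+2) + 1: the first part absorbs the errors of the scale multiplier, and the
  -- remaining unit is the last term in `annulus_lower_bound`. Neither κ nor the size bound depends
  -- on b.
  set κ : ℝ := (2 * m + 3) / δ with hκ
  have hκ0 : 0 < κ := by positivity
  refine ⟨|κ| * (20 + |δ| * 1) + 1, (1 / 2 : ℝ) ^ m / 54, by positivity, fun b hb => ?_⟩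
  have hb0 : 0 < b := by linarith
  refine ⟨(((coreMultiplier hm).add ((angularMultiplier hm).smul δ)).smul κ).add
    (scaleMultiplier hm hb0), (((core_bddBy hm).add ((angular_bddBy hm).smul δ)).smul κ).add
      (scale_bddBy hm hb0), fun x p q r l n hp hq hr hn hl => ?_⟩
  have k1 := core_add_angular_bulk hm (x := x) hp hq hr hn hl
  have k2 := scale_bulk hm hb (x := x) hp hq hr hn hl
  rw [← hδ] at k1
  have k3 := mul_le_mul_of_nonneg_left k1 hκ0.le
  have hκδ : κ * δ = 2 * m + 3 := div_mul_cancel₀ _ hδ0.ne'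
  rw [← mul_assoc, hκδ] at k3
  rw [Multiplier.bulk_add, Multiplier.bulk_smul]
  have hA := area_pos m x
  have hW := wtSq_nonneg m x
  have hj := jb_pos x
  have e1 : (2 * (m : ℝ) + 2) * (area m x * q + area m x * wtSq m x * p + wtSq m x * r + n)
      / (1 + x ^ 2)
      = (2 * m + 2) * ((area m x * q + area m x * wtSq m x * p + wtSq m x * r + n)
        / (1 + x ^ 2)) := by ring
  rw [e1] at k2
  have k4 : 0 ≤ (area m x * q + area m x * wtSq m x * p + wtSq m x * r + n) / (1 + x ^ 2) := by
    positivity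
  have k5 : 0 ≤ wtSq m x * (area m x * (b / (2 * (jb x + b) ^ 2)) * (p + q)
      + 1 / (2 * (jb x + b)) * r + area m x * (b / (jb x * (jb x + b) ^ 3)) * n) := by positivity
  refine ⟨by linarith, fun h1 h2 => ?_⟩
  have k6 := annulus_lower_bound hm hb hp hq hr hn h1 h2
  linarith

/-! ### Angular moments of a wave -/

/-- The angular integrals of a function `u` with forcing `F = □u`, together with the differential
identities between them: `p = ∫ (∂_t u)²`, `q = ∫ (∂_x u)²`, `r = ∫ |∇₀ u|²`, `k = ∫ ∂_t u ∂_x u`,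
`n = ∫ u²`, `l = ∫ u ∂_x u`, `j = ∫ u ∂_t u`, `Ft = ∫ F ∂_t u`, `Fx = ∫ F ∂_x u`, `Fu = ∫ F u`. -/
structure Moments (m : ℕ) (T : ℝ) where
  p : ℝ → ℝ → ℝ
  q : ℝ → ℝ → ℝ
  r : ℝ → ℝ → ℝ
  k : ℝ → ℝ → ℝ
  n : ℝ → ℝ → ℝ
  l : ℝ → ℝ → ℝ
  j : ℝ → ℝ → ℝ
  Ft : ℝ → ℝ → ℝ
  Fx : ℝ → ℝ → ℝ
  Fu : ℝ → ℝ → ℝ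
  et : ℝ → ℝ → ℝ
  kt : ℝ → ℝ → ℝ
  jt : ℝ → ℝ → ℝ
  kx : ℝ → ℝ → ℝ
  sx : ℝ → ℝ → ℝ
  lx : ℝ → ℝ → ℝ
  cp : Continuous fun z : ℝ × ℝ => p z.1 z.2
  cq : Continuous fun z : ℝ × ℝ => q z.1 z.2
  cr : Continuous fun z : ℝ × ℝ => r z.1 z.2
  ck : Continuous fun z : ℝ × ℝ => k z.1 z.2
  cn : Continuous fun z : ℝ × ℝ => n z.1 z.2
  cl : Continuous fun z : ℝ × ℝ => l z.1 z.2
  cj : Continuous fun z : ℝ × ℝ => j z.1 z.2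
  cFt : Continuous fun z : ℝ × ℝ => Ft z.1 z.2
  cFx : Continuous fun z : ℝ × ℝ => Fx z.1 z.2
  cFu : Continuous fun z : ℝ × ℝ => Fu z.1 z.2
  cet : Continuous fun z : ℝ × ℝ => et z.1 z.2
  ckt : Continuous fun z : ℝ × ℝ => kt z.1 z.2
  cjt : Continuous fun z : ℝ × ℝ => jt z.1 z.2
  ckx : Continuous fun z : ℝ × ℝ => kx z.1 z.2
  csx : Continuous fun z : ℝ × ℝ => sx z.1 z.2
  clx : Continuous fun z : ℝ × ℝ => lx z.1 z.2
  p_nonneg : ∀ t x, 0 ≤ p t x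
  q_nonneg : ∀ t x, 0 ≤ q t x
  r_nonneg : ∀ t x, 0 ≤ r t x
  n_nonneg : ∀ t x, 0 ≤ n t x
  k_le : ∀ t x, |k t x| ≤ (p t x + q t x) / 2
  l_sq : ∀ t x, l t x ^ 2 ≤ q t x * n t x
  j_sq : ∀ t x, j t x ^ 2 ≤ p t x * n t x
  hasDeriv_e : ∀ t x, HasDerivAt
    (fun t => (area m x * p t x + area m x * q t x + r t x) / 2) (et t x) t
  hasDeriv_k : ∀ t x, HasDerivAt (fun t => k t x) (kt t x) t
  hasDeriv_j : ∀ t x, HasDerivAt (fun t => j t x) (jt t x) t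
  hasDeriv_kx : ∀ t x, HasDerivAt (fun x => area m x * k t x) (kx t x) x
  hasDeriv_s : ∀ t x, HasDerivAt
    (fun x => (area m x * p t x + area m x * q t x - r t x) / 2) (sx t x) x
  hasDeriv_lx : ∀ t x, HasDerivAt (fun x => area m x * l t x) (lx t x) x
  hasDeriv_n : ∀ t x, HasDerivAt (fun x => n t x) (2 * l t x) x
  energy_identity : ∀ t x, et t x - kx t x = -(area m x * Ft t x)
  radial_identity : ∀ t x, sx t x - area m x * kt t x
    = area m x * Fx t x + logDer m x * area m x * (p t x - q t x)
  lagrangian_identity : ∀ t x, lx t x - area m x * jt t x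
    = area m x * Fu t x - area m x * p t x + area m x * q t x + r t x
  -- R may depend on t, so this gives no fixed rectangle outside which everything vanishes; the
  -- integrations by parts in space-time therefore need cutoffs.
  support : ∀ t ∈ Icc 0 T, ∃ R : ℝ, ∀ x : ℝ, R < |x| → n t x = 0

/-! ### Integration by parts on a rectangle -/

theorem isCompact_rect (T R : ℝ) : IsCompact (Icc 0 T ×ˢ Icc (-R) R : Set (ℝ × ℝ)) :=
  isCompact_Icc.prod isCompact_Icc

/-- Each term is integrated first in its own variable. Continuity of Y suffices at x = ±1, where the
core multiplier has corners, because a countable exceptional set is harmless. -/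
theorem setIntegral_divergence {T R : ℝ} (hT : 0 ≤ T) (hR : 0 ≤ R) {X Xt Y Yx : ℝ → ℝ → ℝ}
    (hX : ∀ t x, HasDerivAt (fun t => X t x) (Xt t x) t)
    (hY : ∀ t x, |x| ≠ 1 → HasDerivAt (fun x => Y t x) (Yx t x) x)
    (cY : ∀ t, Continuous (Y t)) (Y0 : ∀ t ∈ Icc 0 T, Y t R = 0 ∧ Y t (-R) = 0)
    (iX : IntegrableOn (fun z : ℝ × ℝ => Xt z.1 z.2) (Icc 0 T ×ˢ Icc (-R) R))
    (iXt : ∀ x, IntegrableOn (fun t => Xt t x) (Icc 0 T))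
    (iY : IntegrableOn (fun z : ℝ × ℝ => Yx z.1 z.2) (Icc 0 T ×ˢ Icc (-R) R))
    (iYx : ∀ t, IntegrableOn (fun x => Yx t x) (Icc (-R) R)) :
    ∫ z in Icc 0 T ×ˢ Icc (-R) R, (Xt z.1 z.2 + Yx z.1 z.2)
      = ∫ x in Icc (-R) R, (X T x - X 0 x) := by
  rw [integral_add iX iY]
  have h1 : ∫ z in Icc 0 T ×ˢ Icc (-R) R, Yx z.1 z.2 = 0 := by
    rw [Measure.volume_eq_prod, setIntegral_prod _ (by rwa [← Measure.volume_eq_prod])]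
    refine (setIntegral_congr_fun (g := fun _ => 0) measurableSet_Icc fun t ht => ?_).trans (by simp)
    show ∫ x in Icc (-R) R, Yx t x = 0
    rw [integral_Icc_eq_integral_Ioc, ← intervalIntegral.integral_of_le (by linarith),
      MeasureTheory.integral_eq_of_hasDerivAt_off_countable (Y t) (Yx t)
        (s := {x | |x| = 1}) ?_ (cY t).continuousOn ?_ ?_, (Y0 t ht).1, (Y0 t ht).2, sub_zero]
    · refine (Set.Finite.subset (Set.toFinite {1, -1}) fun x hx => ?_).countable
      simpa using (abs_eq zero_le_one).1 hx
    · exact fun x hx => hY t x hx.2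
    · rw [intervalIntegrable_iff_integrableOn_Icc_of_le (by linarith)]
      exact iYx t
  have h2 : ∫ z in Icc 0 T ×ˢ Icc (-R) R, Xt z.1 z.2 = ∫ x in Icc (-R) R, (X T x - X 0 x) := by
    rw [Measure.volume_eq_prod, ← Measure.prod_restrict, integral_prod_symm _ (by
      rwa [Measure.prod_restrict, ← Measure.volume_eq_prod])]
    refine setIntegral_congr_fun measurableSet_Icc fun x _ => ?_
    show ∫ t in Icc 0 T, Xt t x = _
    rw [integral_Icc_eq_integral_Ioc, ← intervalIntegral.integral_of_le hT]
    refine intervalIntegral.integral_eq_sub_of_hasDerivAt (fun t _ => hX t x) ?_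
    rw [intervalIntegrable_iff_integrableOn_Icc_of_le hT]
    exact iXt x
  rw [h1, h2, add_zero]

/-! ### Cutoff functions -/

/-- The `C¹` function `max(0, s)²`. -/
def ramp (s : ℝ) : ℝ := max 0 s ^ 2

theorem hasDerivAt_ramp (s : ℝ) : HasDerivAt ramp (2 * max 0 s) s := by
  have key : ∀ y : ℝ, y ≠ 0 → HasDerivAt ramp (2 * max 0 y) y := by
    intro y hy
    rcases lt_or_gt_of_ne hy with h | h
    · rw [max_eq_left h.le, mul_zero]
      refine (hasDerivAt_const y (0 : ℝ)).congr_of_eventuallyEq ?_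
      filter_upwards [Iio_mem_nhds h] with z hz
      have hz' : z < 0 := hz
      simp [ramp, max_eq_left hz'.le]
    · rw [max_eq_right h.le]
      have := hasDerivAt_pow 2 y
      simp only [Nat.cast_ofNat, Nat.add_one_sub_one, pow_one] at this
      refine this.congr_of_eventuallyEq ?_
      filter_upwards [Ioi_mem_nhds h] with z hz
      have hz' : 0 < z := hz
      simp [ramp, max_eq_right hz'.le]
  rcases eq_or_ne s 0 with rfl | h
  · exact hasDerivAt_of_hasDerivAt_of_ne key (by unfold ramp; fun_prop) (by fun_prop)
  · exact key s h

/-- A cutoff to the truncated cone `t + ⟨x⟩ < R`. -/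
def coneCut (R t x : ℝ) : ℝ := ramp (1 - (t + jb x) / R)

/-- Minus the time derivative of `coneCut`. -/
def coneCutDer (R t x : ℝ) : ℝ := 2 / R * max 0 (1 - (t + jb x) / R)

theorem coneCut_nonneg (R t x : ℝ) : 0 ≤ coneCut R t x := sq_nonneg _

theorem coneCut_le_one {R t : ℝ} (hR : 0 < R) (ht : 0 ≤ t) (x : ℝ) : coneCut R t x ≤ 1 := by
  have : 0 ≤ (t + jb x) / R := div_nonneg (add_nonneg ht (jb_pos x).le) hR.le
  exact pow_le_one₀ (le_max_left _ _) (max_le zero_le_one (by linarith))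

theorem coneCutDer_nonneg {R : ℝ} (hR : 0 < R) (t x : ℝ) : 0 ≤ coneCutDer R t x := by
  unfold coneCutDer; positivity

theorem coneCutDer_le {R t : ℝ} (hR : 0 < R) (ht : 0 ≤ t) (x : ℝ) : coneCutDer R t x ≤ 2 / R := by
  have : 0 ≤ (t + jb x) / R := div_nonneg (add_nonneg ht (jb_pos x).le) hR.le
  exact mul_le_of_le_one_right (by positivity) (max_le zero_le_one (by linarith))

theorem coneCut_eq_zero {R t x : ℝ} (hR : 0 < R) (ht : 0 ≤ t) (hx : R ≤ |x|) :
    coneCut R t x = 0 := by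
  have : 1 ≤ (t + jb x) / R := (one_le_div hR).2 (by linarith [abs_le_jb x])
  rw [coneCut, ramp, max_eq_left (by linarith)]
  norm_num

theorem hasDerivAt_coneCut_t (R t x : ℝ) :
    HasDerivAt (fun t => coneCut R t x) (-coneCutDer R t x) t := by
  have h := (hasDerivAt_ramp (1 - (t + jb x) / R)).comp t
    ((((hasDerivAt_id t).add_const (jb x)).div_const R).const_sub 1)
  refine h.congr_deriv ?_
  simp only [coneCutDer]; ring

theorem hasDerivAt_coneCut_x (R t x : ℝ) :
    HasDerivAt (fun x => coneCut R t x) (-(x / jb x * coneCutDer R t x)) x := by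
  have h := (hasDerivAt_ramp (1 - (t + jb x) / R)).comp x
    ((((hasDerivAt_jb x).const_add t).div_const R).const_sub 1)
  refine h.congr_deriv ?_
  simp only [coneCutDer]; ring

theorem continuous_coneCut (R : ℝ) : Continuous fun z : ℝ × ℝ => coneCut R z.1 z.2 := by
  have := continuous_jb
  unfold coneCut ramp
  fun_prop

theorem continuous_coneCutDer (R : ℝ) : Continuous fun z : ℝ × ℝ => coneCutDer R z.1 z.2 := by
  have := continuous_jb
  unfold coneCutDer
  fun_prop

theorem tendsto_coneCut (t x : ℝ) :
    Filter.Tendsto (fun N : ℕ => coneCut (N + 1) t x) Filter.atTop (nhds 1) := by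
  have h1 : Filter.Tendsto (fun N : ℕ => (t + jb x) / ((N : ℝ) + 1)) Filter.atTop (nhds 0) :=
    tendsto_const_nhds.div_atTop (Filter.tendsto_atTop_add_const_right _ _
      tendsto_natCast_atTop_atTop)
  have h2 : Continuous fun s : ℝ => ramp (1 - s) := by unfold ramp; fun_prop
  have h3 := (h2.tendsto 0).comp h1
  simpa [ramp, Function.comp_def, coneCut] using h3

theorem abs_div_jb_le_one (x : ℝ) : |x / jb x| ≤ 1 := by
  rw [abs_div, abs_of_pos (jb_pos x), div_le_one (jb_pos x)]
  exact abs_le_jb x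

/-- Fatou's lemma, in the form used to remove cutoffs. -/
theorem lintegral_le_of_tendsto {α : Type*} [MeasurableSpace α] {μ : Measure α}
    {F : ℕ → α → ℝ≥0∞} {G : α → ℝ≥0∞} (hF : ∀ N, Measurable (F N))
    (hG : ∀ a, Filter.Tendsto (fun N => F N a) Filter.atTop (nhds (G a))) {c : ℕ → ℝ≥0∞} {b : ℝ≥0∞}
    (hc : ∀ N, ∫⁻ a, F N a ∂μ ≤ c N) (hb : Filter.Tendsto c Filter.atTop (nhds b)) :
    ∫⁻ a, G a ∂μ ≤ b := by
  have h : ∀ a, G a = Filter.liminf (fun N => F N a) Filter.atTop := fun a => (hG a).liminf_eq.symm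
  simp_rw [h]
  refine (lintegral_liminf_le hF).trans ?_
  rw [← hb.liminf_eq]
  exact Filter.liminf_le_liminf (Filter.Eventually.of_forall hc)

/-! ### Energy inequality, finiteness of the energy, Hardy's inequality -/

namespace Moments

variable {m : ℕ} {T : ℝ} (S : Moments m T)

/-- The energy density. -/
def e (t x : ℝ) : ℝ := (area m x * S.p t x + area m x * S.q t x + S.r t x) / 2

theorem e_nonneg (t x : ℝ) : 0 ≤ S.e t x := by
  have := area_pos m x
  have := S.p_nonneg t x
  have := S.q_nonneg t x
  have := S.r_nonneg t x
  unfold e; positivity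

theorem continuous_e (hm : 1 ≤ m) : Continuous fun z : ℝ × ℝ => S.e z.1 z.2 := by
  have := continuous_area hm
  have := S.cp
  have := S.cq
  have := S.cr
  unfold e
  fun_prop

/-- The energy inequality in a truncated cone. -/
theorem energy_cone_le (hm : 1 ≤ m) {R τ : ℝ} (hR : 0 < R) (hτ : 0 ≤ τ) :
    ∫⁻ x, ENNReal.ofReal (coneCut R τ x * S.e τ x) ≤
      (∫⁻ x, ENNReal.ofReal (coneCut R 0 x * S.e 0 x))
      + ∫⁻ t in Icc 0 τ, ∫⁻ x, ENNReal.ofReal (coneCut R t x * (area m x * |S.Ft t x|)) := by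
  have cA := continuous_area hm
  have cω := continuous_coneCut R
  have cω' := continuous_coneCutDer R
  have ce := S.continuous_e hm
  have ck := S.ck
  have ckx := S.ckx
  have cet := S.cet
  have cF := S.cFt
  have cj := continuous_jb
  have cxj : Continuous fun x : ℝ => x / jb x := continuous_id.div cj fun x => (jb_pos x).ne'
  set X : ℝ → ℝ → ℝ := fun t x => coneCut R t x * S.e t x with hX
  set Xt : ℝ → ℝ → ℝ := fun t x => -coneCutDer R t x * S.e t x + coneCut R t x * S.et t x with hXt
  set Y : ℝ → ℝ → ℝ := fun t x => -(coneCut R t x * (area m x * S.k t x)) with hY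
  set Yx : ℝ → ℝ → ℝ := fun t x => -(-(x / jb x * coneCutDer R t x) * (area m x * S.k t x)
    + coneCut R t x * S.kx t x) with hYx
  have cX : Continuous fun z : ℝ × ℝ => X z.1 z.2 := cω.mul ce
  have cXt : Continuous fun z : ℝ × ℝ => Xt z.1 z.2 := by simp only [hXt]; fun_prop
  have cYx : Continuous fun z : ℝ × ℝ => Yx z.1 z.2 :=
    ((((cxj.comp continuous_snd).mul cω').neg.mul ((cA.comp continuous_snd).mul ck)).add
      (cω.mul ckx)).neg
  have cY : Continuous fun z : ℝ × ℝ => Y z.1 z.2 := by simp only [hY]; fun_prop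
  have hz : ∀ t, 0 ≤ t → ∀ x, R ≤ |x| → coneCut R t x = 0 := fun t ht x hx => coneCut_eq_zero hR ht hx
  have main := setIntegral_divergence (X := X) (Xt := Xt) (Y := Y) (Yx := Yx) hτ hR.le
    (fun t x => (hasDerivAt_coneCut_t R t x).mul (S.hasDeriv_e t x))
    (fun t x _ => ((hasDerivAt_coneCut_x R t x).mul (S.hasDeriv_kx t x)).neg)
    (fun t => cY.comp (Continuous.prodMk_right t)) (fun t ht => by
      simp only [hY]
      rw [hz t ht.1 R (le_abs_self R), hz t ht.1 (-R) (by rw [abs_neg]; exact le_abs_self R)]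
      simp)
    (cXt.continuousOn.integrableOn_compact (isCompact_rect τ R))
    (fun x => (cXt.comp (Continuous.prodMk_left x)).continuousOn.integrableOn_compact isCompact_Icc)
    (cYx.continuousOn.integrableOn_compact (isCompact_rect τ R))
    (fun t => (cYx.comp (Continuous.prodMk_right t)).continuousOn.integrableOn_compact isCompact_Icc)
  set D : ℝ × ℝ → ℝ := fun z => coneCut R z.1 z.2 * (area m z.2 * |S.Ft z.1 z.2|) with hD
  have cD : Continuous D := by simp only [hD]; fun_prop
  have iD : IntegrableOn D (Icc 0 τ ×ˢ Icc (-R) R) :=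
    cD.continuousOn.integrableOn_compact (isCompact_rect τ R)
  have D0 : ∀ z, 0 ≤ D z := fun z => mul_nonneg (coneCut_nonneg _ _ _)
    (mul_nonneg (area_pos m _).le (abs_nonneg _))
  -- Finite speed of propagation: the derivatives of the cutoff contribute `coneCutDer` times -e +
  -- (x/⟨x⟩) A k, which is nonpositive because |x/⟨x⟩| ≤ 1 and A|k| ≤ e.
  have le1 : ∫ z in Icc 0 τ ×ˢ Icc (-R) R, (Xt z.1 z.2 + Yx z.1 z.2)
      ≤ ∫ z in Icc 0 τ ×ˢ Icc (-R) R, D z := by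
    refine integral_mono ((cXt.add cYx).continuousOn.integrableOn_compact (isCompact_rect τ R)) iD
      fun z => ?_
    obtain ⟨t, x⟩ := z
    simp only [hXt, hYx, hD]
    have i1 := S.energy_identity t x
    have w0 := coneCut_nonneg R t x
    have w1 := coneCutDer_nonneg hR t x
    have A0 := area_pos m x
    have k1 : |area m x * S.k t x| ≤ S.e t x := by
      rw [abs_mul, abs_of_pos A0, e]
      have := mul_le_mul_of_nonneg_left (S.k_le t x) A0.le
      have := S.r_nonneg t x
      linarith
    have k2 : x / jb x * (area m x * S.k t x) ≤ S.e t x := by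
      refine (le_abs_self _).trans ?_
      rw [abs_mul]
      calc _ ≤ 1 * S.e t x := mul_le_mul (abs_div_jb_le_one x) k1 (abs_nonneg _) zero_le_one
        _ = _ := one_mul _
    have k3 := mul_le_mul_of_nonneg_left k2 w1
    have k4 : -(area m x * S.Ft t x) ≤ area m x * |S.Ft t x| := by
      rw [← mul_neg]; exact mul_le_mul_of_nonneg_left (neg_le_abs _) A0.le
    have k5 := mul_le_mul_of_nonneg_left k4 w0
    rw [← i1] at k5
    linarith
  rw [main] at le1
  have iX : ∀ t, IntegrableOn (X t) (Icc (-R) R) := fun t =>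
    (cX.comp (Continuous.prodMk_right t)).continuousOn.integrableOn_compact isCompact_Icc
  rw [integral_sub (iX τ) (iX 0)] at le1
  have le2 : ∫ x in Icc (-R) R, X τ x
      ≤ (∫ x in Icc (-R) R, X 0 x) + ∫ z in Icc 0 τ ×ˢ Icc (-R) R, D z := by linarith
  have X0 : ∀ t x, 0 ≤ X t x := fun t x => mul_nonneg (coneCut_nonneg _ _ _) (S.e_nonneg t x)
  have eX : ∀ t, 0 ≤ t → ∫⁻ x, ENNReal.ofReal (X t x)
      = ENNReal.ofReal (∫ x in Icc (-R) R, X t x) := by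
    intro t ht
    rw [ofReal_integral_eq_lintegral_ofReal (iX t) (Filter.Eventually.of_forall (X0 t)),
      setLIntegral_eq_of_support_subset]
    intro x hx
    by_contra hx'
    apply hx
    have : R ≤ |x| := by
      by_contra h
      exact hx' (abs_le.1 (not_le.1 h).le)
    simp only [hX, hz t ht x this, zero_mul, ENNReal.ofReal_zero]
  have eD : ENNReal.ofReal (∫ z in Icc 0 τ ×ˢ Icc (-R) R, D z)
      ≤ ∫⁻ t in Icc 0 τ, ∫⁻ x, ENNReal.ofReal (D (t, x)) := by
    rw [ofReal_integral_eq_lintegral_ofReal iD (Filter.Eventually.of_forall D0),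
      Measure.volume_eq_prod, ← Measure.prod_restrict, lintegral_prod _ (by fun_prop)]
    exact lintegral_mono fun t => setLIntegral_le_lintegral _ _
  rw [eX τ hτ, eX 0 le_rfl]
  refine (ENNReal.ofReal_le_ofReal le2).trans (ENNReal.ofReal_add_le.trans ?_)
  gcongr

end Moments

theorem lintegral_sqrt_mul_sqrt_le {α : Type*} [MeasurableSpace α] {μ : Measure α} {f g : α → ℝ≥0∞}
    (hf : AEMeasurable f μ) (hg : AEMeasurable g μ) :
    ∫⁻ a, f a ^ (1 / 2 : ℝ) * g a ^ (1 / 2 : ℝ) ∂μ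
      ≤ (∫⁻ a, f a ∂μ) ^ (1 / 2 : ℝ) * (∫⁻ a, g a ∂μ) ^ (1 / 2 : ℝ) := by
  have h := ENNReal.lintegral_mul_le_Lp_mul_Lq μ Real.HolderConjugate.two_two
    (hf.pow_const (1 / 2 : ℝ)) (hg.pow_const (1 / 2 : ℝ))
  have e : ∀ y : ℝ≥0∞, (y ^ (1 / 2 : ℝ)) ^ (2 : ℝ) = y := fun y => by
    rw [← ENNReal.rpow_mul]; norm_num
  simpa only [Pi.mul_apply, e] using h

theorem ENNReal.sqrt_mul_self (y : ℝ≥0∞) : y ^ (1 / 2 : ℝ) * y ^ (1 / 2 : ℝ) = y := by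
  rw [← ENNReal.rpow_add_of_nonneg _ _ (by norm_num) (by norm_num)]; norm_num

/-- The absorption step. Finiteness of s is essential, since s = ∞ satisfies the quadratic
inequality as soon as b ≠ 0; this is why finiteness is proved separately before each use. -/
theorem ENNReal.le_add_of_sq_le {s a b : ℝ≥0∞} (hs : s ≠ ⊤) (h : s ^ 2 ≤ a ^ 2 + b * s) :
    s ≤ a + b := by
  rcases eq_or_ne a ⊤ with rfl | ha
  · simp
  rcases eq_or_ne b ⊤ with rfl | hb
  · simp
  lift s to ℝ≥0 using hs
  lift a to ℝ≥0 using ha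
  lift b to ℝ≥0 using hb
  norm_cast at h ⊢
  by_contra! hlt
  have h1 : (a : ℝ) + b < s := by exact_mod_cast hlt
  have h2 : (s : ℝ) ^ 2 ≤ a ^ 2 + b * s := by exact_mod_cast h
  have ha0 := a.coe_nonneg
  have hb0 := b.coe_nonneg
  nlinarith

namespace Moments

variable {m : ℕ} {T : ℝ} (S : Moments m T)

/-- Half of the energy at time `t`. -/
def en (t : ℝ) : ℝ≥0∞ := ∫⁻ x, ENNReal.ofReal (S.e t x)

theorem tendsto_cut_mul (t x y : ℝ) : Filter.Tendsto
    (fun N : ℕ => ENNReal.ofReal (coneCut (N + 1) t x * y)) Filter.atTop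
    (nhds (ENNReal.ofReal y)) := by
  refine (ENNReal.continuous_ofReal.tendsto y).comp ?_
  simpa using (tendsto_coneCut t x).mul_const y

theorem measurable_cut_mul (hm : 1 ≤ m) (R t : ℝ) :
    Measurable fun x => ENNReal.ofReal (coneCut R t x * S.e t x) := by
  have h1 := (continuous_coneCut R).comp (Continuous.prodMk_right t)
  have h2 := (S.continuous_e hm).comp (Continuous.prodMk_right t)
  exact (h1.mul h2).measurable.ennreal_ofReal

theorem en_le (hm : 1 ≤ m) {τ : ℝ} (hτ : 0 ≤ τ) :
    S.en τ ≤ S.en 0 + ∫⁻ t in Icc 0 τ, ∫⁻ x, ENNReal.ofReal (area m x * |S.Ft t x|) := by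
  refine lintegral_le_of_tendsto (F := fun (N : ℕ) x => ENNReal.ofReal
    (coneCut (N + 1) τ x * S.e τ x)) (fun N => S.measurable_cut_mul hm _ _)
    (fun x => tendsto_cut_mul τ x _) (fun N => ?_) tendsto_const_nhds
  have hN : (0 : ℝ) < N + 1 := by positivity
  refine (S.energy_cone_le hm hN hτ).trans (add_le_add ?_ ?_)
  · refine lintegral_mono fun x => ENNReal.ofReal_le_ofReal ?_
    exact mul_le_of_le_one_left (S.e_nonneg _ _) (coneCut_le_one hN le_rfl x)
  · refine setLIntegral_mono' measurableSet_Icc fun t ht => lintegral_mono fun x =>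
      ENNReal.ofReal_le_ofReal ?_
    exact mul_le_of_le_one_left (mul_nonneg (area_pos m x).le (abs_nonneg _))
      (coneCut_le_one hN ht.1 x)

/-- The energy stays finite if the forcing is in `L¹L²`. -/
theorem exists_en_le (hm : 1 ≤ m) {Φ : ℝ → ℝ → ℝ≥0∞}
    (hΦ : Measurable fun z : ℝ × ℝ => Φ z.1 z.2)
    (hF : ∀ t x, ENNReal.ofReal |S.Ft t x|
      ≤ Φ t x ^ (1 / 2 : ℝ) * ENNReal.ofReal (S.p t x) ^ (1 / 2 : ℝ))
    (h0 : S.en 0 ≠ ⊤) (hL : L1L2 m T Φ ≠ ⊤) : ∃ K : ℝ≥0∞, K ≠ ⊤ ∧ ∀ t ∈ Icc 0 T, S.en t ≤ K := by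
  -- The factor √2 comes from A p ≤ 2e, as e is half of the energy density.
  set c : ℝ≥0∞ := 2 ^ (1 / 2 : ℝ) with hc
  set B := S.en 0 ^ (1 / 2 : ℝ) + c * L1L2 m T Φ with hB
  have hBt : B ≠ ⊤ := ENNReal.add_ne_top.2 ⟨ENNReal.rpow_ne_top_of_nonneg (by norm_num) h0,
    ENNReal.mul_ne_top (ENNReal.rpow_ne_top_of_nonneg (by norm_num) (by simp)) hL⟩
  -- The bound is uniform in R, so Fatou's lemma removes the cutoff at the end.
  have key : ∀ R : ℝ, 0 < R → ∀ t ∈ Icc 0 T,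
      ∫⁻ x, ENNReal.ofReal (coneCut R t x * S.e t x) ≤ B ^ 2 := by
    intro R hR
    set eR : ℝ → ℝ≥0∞ := fun t => ∫⁻ x, ENNReal.ofReal (coneCut R t x * S.e t x) with heR
    set s : ℝ≥0∞ := ⨆ t ∈ Icc 0 T, eR t ^ (1 / 2 : ℝ) with hs
    have eRs : ∀ t ∈ Icc 0 T, eR t ^ (1 / 2 : ℝ) ≤ s := fun t ht =>
      le_iSup₂ (f := fun t (_ : t ∈ Icc 0 T) => eR t ^ (1 / 2 : ℝ)) t ht
    -- The truncated energy is trivially finite: a continuous function on a compact rectangle. This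
    -- licenses the absorption.
    have hst : s ≠ ⊤ := by
      obtain ⟨C, hC⟩ := (isCompact_rect T R).exists_bound_of_continuousOn
        ((continuous_coneCut R).mul (S.continuous_e hm)).continuousOn
      have : ∀ t ∈ Icc 0 T, eR t ≤ ENNReal.ofReal C * volume (Icc (-R) R) := by
        intro t ht
        rw [heR, ← setLIntegral_const, ← lintegral_indicator measurableSet_Icc]
        refine lintegral_mono fun x => ?_
        by_cases hx : x ∈ Icc (-R) R
        · rw [indicator_of_mem hx]
          exact ENNReal.ofReal_le_ofReal ((le_abs_self _).trans (hC (t, x) ⟨ht, hx⟩))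
        · have : R ≤ |x| := by
            by_contra h
            exact hx (abs_le.1 (not_le.1 h).le)
          simp [coneCut_eq_zero hR ht.1 this]
      refine ne_top_of_le_ne_top (b := (ENNReal.ofReal C * volume (Icc (-R) R)) ^ (1 / 2 : ℝ))
        (ENNReal.rpow_ne_top_of_nonneg (by norm_num)
          (ENNReal.mul_ne_top ENNReal.ofReal_ne_top (by simp))) ?_
      exact iSup₂_le fun t ht => ENNReal.rpow_le_rpow (this t ht) (by norm_num)
    have bound : ∀ τ ∈ Icc 0 T, eR τ ≤ S.en 0 + c * L1L2 m T Φ * s := by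
      intro τ hτ
      refine (S.energy_cone_le hm hR hτ.1).trans (add_le_add ?_ ?_)
      · refine lintegral_mono fun x => ENNReal.ofReal_le_ofReal ?_
        exact mul_le_of_le_one_left (S.e_nonneg _ _) (coneCut_le_one hR le_rfl x)
      · have h1 : ∫⁻ t in Icc 0 τ, ∫⁻ x, ENNReal.ofReal (coneCut R t x * (area m x * |S.Ft t x|))
            ≤ ∫⁻ t in Icc 0 T, ∫⁻ x, ENNReal.ofReal (coneCut R t x * (area m x * |S.Ft t x|)) :=
          lintegral_mono_set (Icc_subset_Icc le_rfl hτ.2)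
        refine h1.trans ?_
        rw [L1L2, mul_right_comm, ← lintegral_const_mul']
        swap
        · exact ENNReal.mul_ne_top (ENNReal.rpow_ne_top_of_nonneg (by norm_num) (by simp)) hst
        refine setLIntegral_mono' measurableSet_Icc fun t ht => ?_
        have mA := (continuous_area hm).measurable
        have mΦ : Measurable (Φ t) := hΦ.comp measurable_prodMk_left
        have mω : Measurable (coneCut R t) :=
          ((continuous_coneCut R).comp (Continuous.prodMk_right t)).measurable
        have mp : Measurable (S.p t) := (S.cp.comp (Continuous.prodMk_right t)).measurable
        have h2 : ∀ x, ENNReal.ofReal (coneCut R t x * (area m x * |S.Ft t x|))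
            ≤ (Φ t x * ENNReal.ofReal (aFun m x ^ 2)) ^ (1 / 2 : ℝ)
              * ENNReal.ofReal (coneCut R t x * (area m x * S.p t x)) ^ (1 / 2 : ℝ) := by
          intro x
          have w0 := coneCut_nonneg R t x
          have w1 := coneCut_le_one hR ht.1 x
          have A0 := (area_pos m x).le
          rw [ENNReal.ofReal_mul w0, ENNReal.ofReal_mul A0, ENNReal.ofReal_mul w0,
            ENNReal.ofReal_mul A0]
          change _ ≤ (Φ t x * ENNReal.ofReal (area m x)) ^ (1 / 2 : ℝ) * _
          set w := ENNReal.ofReal (coneCut R t x)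
          set A := ENNReal.ofReal (area m x)
          set P := ENNReal.ofReal (S.p t x)
          -- As the cutoff is at most 1, its square root can replace it and accompany √p,
          -- reproducing the truncated energy; the forcing needs no cutoff.
          have hw : w ≤ w ^ (1 / 2 : ℝ) := by
            have : w ≤ 1 := ENNReal.ofReal_le_one.2 w1
            calc w = w ^ (1 : ℝ) := (ENNReal.rpow_one w).symm
              _ ≤ _ := ENNReal.rpow_le_rpow_of_exponent_ge this (by norm_num)
          rw [ENNReal.mul_rpow_of_nonneg _ _ (by norm_num : (0 : ℝ) ≤ 1 / 2),
            ENNReal.mul_rpow_of_nonneg _ _ (by norm_num : (0 : ℝ) ≤ 1 / 2),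
            ENNReal.mul_rpow_of_nonneg _ _ (by norm_num : (0 : ℝ) ≤ 1 / 2)]
          calc w * (A * ENNReal.ofReal |S.Ft t x|)
              ≤ w ^ (1 / 2 : ℝ) * (A * (Φ t x ^ (1 / 2 : ℝ) * P ^ (1 / 2 : ℝ))) := by
                gcongr; exact hF t x
            _ = w ^ (1 / 2 : ℝ) * (A ^ (1 / 2 : ℝ) * A ^ (1 / 2 : ℝ)
                * (Φ t x ^ (1 / 2 : ℝ) * P ^ (1 / 2 : ℝ))) := by rw [ENNReal.sqrt_mul_self]
            _ = _ := by ring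
        refine (lintegral_mono h2).trans ((lintegral_sqrt_mul_sqrt_le
          (by unfold area at mA; fun_prop) (by fun_prop)).trans ?_)
        rw [mul_comm]
        gcongr
        refine le_trans ?_ (mul_le_mul_right (eRs t ht) c)
        rw [hc, ← ENNReal.mul_rpow_of_nonneg _ _ (by norm_num : (0 : ℝ) ≤ 1 / 2)]
        refine ENNReal.rpow_le_rpow ?_ (by norm_num)
        rw [heR, ← lintegral_const_mul' _ _ (by simp)]
        refine lintegral_mono fun x => ?_
        rw [← ENNReal.ofReal_ofNat, ← ENNReal.ofReal_mul (by norm_num)]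
        refine ENNReal.ofReal_le_ofReal ?_
        have w0 := coneCut_nonneg R t x
        have A0 := (area_pos m x).le
        have h3 : area m x * S.p t x ≤ 2 * S.e t x := by
          have := mul_nonneg A0 (S.q_nonneg t x)
          have := S.r_nonneg t x
          unfold e; linarith
        have := mul_le_mul_of_nonneg_left h3 w0
        linarith
    have hs2 : s ^ 2 ≤ (S.en 0 ^ (1 / 2 : ℝ)) ^ 2 + c * L1L2 m T Φ * s := by
      have e2 : (S.en 0 ^ (1 / 2 : ℝ)) ^ 2 = S.en 0 := by
        rw [sq, ENNReal.sqrt_mul_self]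
      rw [e2]
      have : s ≤ (S.en 0 + c * L1L2 m T Φ * s) ^ (1 / 2 : ℝ) :=
        iSup₂_le fun t ht => ENNReal.rpow_le_rpow (bound t ht) (by norm_num)
      calc s ^ 2 ≤ ((S.en 0 + c * L1L2 m T Φ * s) ^ (1 / 2 : ℝ)) ^ 2 := by gcongr
        _ = _ := by rw [sq, ENNReal.sqrt_mul_self]
    have hsB : s ≤ B := ENNReal.le_add_of_sq_le hst hs2
    intro t ht
    calc eR t = (eR t ^ (1 / 2 : ℝ)) ^ 2 := by rw [sq, ENNReal.sqrt_mul_self]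
      _ ≤ B ^ 2 := by gcongr; exact (eRs t ht).trans hsB
  refine ⟨B ^ 2, ENNReal.pow_ne_top hBt, fun t ht => ?_⟩
  exact lintegral_le_of_tendsto (F := fun (N : ℕ) x => ENNReal.ofReal
    (coneCut (N + 1) t x * S.e t x)) (fun N => S.measurable_cut_mul hm _ _)
    (fun x => tendsto_cut_mul t x _) (fun N => key _ (by positivity) t ht) tendsto_const_nhds

/-- Hardy's inequality. -/
theorem hardy (hm : 1 ≤ m) {t : ℝ} (ht : t ∈ Icc 0 T) :
    ∫⁻ x, ENNReal.ofReal (area m x * S.n t x / (1 + x ^ 2))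
      ≤ ENNReal.ofReal 48 * ∫⁻ x, ENNReal.ofReal (area m x * S.q t x) := by
  obtain ⟨R₀, hR₀⟩ := S.support t ht
  set R := max R₀ 0 + 1 with hR
  have hRpos : 0 < R := by positivity
  have hsupp : ∀ x, R ≤ |x| → S.n t x = 0 := fun x hx =>
    hR₀ x (lt_of_lt_of_le (lt_of_le_of_lt (le_max_left _ _) (lt_add_one _)) hx)
  have cA := continuous_area hm
  have cL := continuous_logDer m
  have cn : Continuous (S.n t) := S.cn.comp (Continuous.prodMk_right t)
  have cq : Continuous (S.q t) := S.cq.comp (Continuous.prodMk_right t)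
  have cl : Continuous (S.l t) := S.cl.comp (Continuous.prodMk_right t)
  -- The total derivative of A x/(3+x²) n integrates to zero by compact support in x. The derivative
  -- of A x/(3+x²) is at least A/(2(3+x²)); half of this absorbs the cross term 2A x/(3+x²) l at the
  -- cost of 4 A q. The 3 keeps it positive on |x| ≤ 1, where a'/a may be arbitrarily small for
  -- large m.
  have hd : ∀ x, HasDerivAt (fun x => area m x * (x / (3 + x ^ 2)) * S.n t x)
      (area m x * ((3 - x ^ 2) + 2 * (x * logDer m x) * (3 + x ^ 2)) / (3 + x ^ 2) ^ 2 * S.n t x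
        + 2 * (area m x * (x / (3 + x ^ 2))) * S.l t x) x := by
    intro x
    have h1 : HasDerivAt (fun x : ℝ => 3 + x ^ 2) (2 * x) x := by
      simpa using (hasDerivAt_pow 2 x).const_add 3
    refine (((hasDerivAt_area hm x).mul ((hasDerivAt_id x).div h1 (by positivity))).mul
      (S.hasDeriv_n t x)).congr_deriv ?_
    simp only [id, Pi.mul_apply, Pi.div_apply]
    field_simp
    ring
  set N : ℝ → ℝ := fun x => area m x * S.n t x / (12 * (1 + x ^ 2)) with hN
  set Q : ℝ → ℝ := fun x => 4 * (area m x * S.q t x) with hQ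
  have cN : Continuous N := Continuous.div (by fun_prop) (by fun_prop) fun x => by positivity
  have cQ : Continuous Q := by fun_prop
  set D : ℝ → ℝ := fun x =>
    area m x * ((3 - x ^ 2) + 2 * (x * logDer m x) * (3 + x ^ 2)) / (3 + x ^ 2) ^ 2 * S.n t x
        + 2 * (area m x * (x / (3 + x ^ 2))) * S.l t x with hD
  have cD : Continuous D := by
    refine Continuous.add (Continuous.mul (Continuous.div (by fun_prop) (by fun_prop)
      fun x => by positivity) cn) (Continuous.mul (continuous_const.mul (cA.mul
        (continuous_id.div (by fun_prop) fun x => by positivity))) cl)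
  have pw : ∀ x, N x ≤ Q x + D x := by
    intro x
    have A0 := area_pos m x
    have n0 := S.n_nonneg t x
    have q0 := S.q_nonneg t x
    have hl := S.l_sq t x
    have h1 : 1 / (2 * (3 + x ^ 2))
        ≤ ((3 - x ^ 2) + 2 * (x * logDer m x) * (3 + x ^ 2)) / (3 + x ^ 2) ^ 2 := by
      rw [div_le_div_iff₀ (by positivity) (by positivity)]
      have : 3 + x ^ 2 ≤ 2 * ((3 - x ^ 2) + 2 * (x * logDer m x) * (3 + x ^ 2)) := by
        rcases le_total |x| 1 with h | h
        · have := mul_logDer_nonneg hm x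
          have := (sq_le_one_iff_abs_le_one x).2 h
          have : 0 ≤ 2 * (x * logDer m x) * (3 + x ^ 2) := by positivity
          linarith
        · have h2 := le_mul_logDer hm h
          have h3 := mul_logDer_nonneg hm x
          have h4 : 1 ≤ x ^ 2 := (one_le_sq_iff_one_le_abs x).2 h
          nlinarith
      nlinarith [sq_nonneg x]
    have h2 := mul_le_mul_of_nonneg_left h1 (mul_nonneg A0.le n0)
    have h3 := quadForm_nonneg (a := 4) (b := 2 * (x / (3 + x ^ 2))) (c := 1 / (4 * (3 + x ^ 2)))
      (by norm_num) (by positivity) (by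
        rw [mul_pow, div_pow, mul_one_div, ← mul_div_assoc, div_le_div_iff₀ (by positivity)
          (by positivity)]
        nlinarith [sq_nonneg x, sq_nonneg (x ^ 2)]) q0 n0 hl
    have h4 := mul_nonneg A0.le h3
    have h5 : N x ≤ area m x * S.n t x * (1 / (4 * (3 + x ^ 2))) := by
      rw [hN]; simp only []
      rw [div_eq_mul_one_div]
      exact mul_le_mul_of_nonneg_left (one_div_le_one_div_of_le (by positivity)
        (by nlinarith [sq_nonneg x])) (mul_nonneg A0.le n0)
    have h6 : area m x * S.n t x * (1 / (2 * (3 + x ^ 2)))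
        = area m x * S.n t x * (1 / (4 * (3 + x ^ 2))) * 2 := by
      field_simp; norm_num
    have h7 : area m x * ((3 - x ^ 2) + 2 * (x * logDer m x) * (3 + x ^ 2)) / (3 + x ^ 2) ^ 2
        * S.n t x = area m x * S.n t x *
        (((3 - x ^ 2) + 2 * (x * logDer m x) * (3 + x ^ 2)) / (3 + x ^ 2) ^ 2) := by ring
    simp only [hQ, hD]
    rw [h7]
    linarith
  have iD : ∫ x in Icc (-R) R, D x = 0 := by
    rw [integral_Icc_eq_integral_Ioc, ← intervalIntegral.integral_of_le (by linarith),
      intervalIntegral.integral_eq_sub_of_hasDerivAt (fun x _ => hd x)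
        (cD.intervalIntegrable _ _), hsupp R (le_abs_self R),
      hsupp (-R) (by rw [abs_neg]; exact le_abs_self R)]
    simp
  have ii : ∀ {f : ℝ → ℝ}, Continuous f → IntegrableOn f (Icc (-R) R) := fun h =>
    h.continuousOn.integrableOn_compact isCompact_Icc
  have le1 : ∫ x in Icc (-R) R, N x ≤ ∫ x in Icc (-R) R, Q x := by
    calc ∫ x in Icc (-R) R, N x ≤ ∫ x in Icc (-R) R, (Q x + D x) :=
          integral_mono (ii cN) (ii (cQ.add cD)) pw
      _ = _ := by rw [integral_add (ii cQ) (ii cD), iD, add_zero]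
  have N0 : ∀ x, 0 ≤ N x := fun x => by
    have := area_pos m x
    have := S.n_nonneg t x
    simp only [hN]; positivity
  have Q0 : ∀ x, 0 ≤ Q x := fun x => by
    have := area_pos m x
    have := S.q_nonneg t x
    simp only [hQ]; positivity
  have le2 : ∫⁻ x, ENNReal.ofReal (N x) ≤ ∫⁻ x, ENNReal.ofReal (Q x) := by
    calc ∫⁻ x, ENNReal.ofReal (N x) = ∫⁻ x in Icc (-R) R, ENNReal.ofReal (N x) := by
          rw [setLIntegral_eq_of_support_subset]
          intro x hx
          by_contra hx'
          apply hx
          have : R ≤ |x| := by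
            by_contra h
            exact hx' (abs_le.1 (not_le.1 h).le)
          simp [hN, hsupp x this]
      _ = ENNReal.ofReal (∫ x in Icc (-R) R, N x) :=
          (ofReal_integral_eq_lintegral_ofReal (ii cN) (Filter.Eventually.of_forall N0)).symm
      _ ≤ ENNReal.ofReal (∫ x in Icc (-R) R, Q x) := ENNReal.ofReal_le_ofReal le1
      _ = ∫⁻ x in Icc (-R) R, ENNReal.ofReal (Q x) :=
          ofReal_integral_eq_lintegral_ofReal (ii cQ) (Filter.Eventually.of_forall Q0)
      _ ≤ _ := setLIntegral_le_lintegral _ _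
  have eN : ∀ x, ENNReal.ofReal (area m x * S.n t x / (1 + x ^ 2))
      = ENNReal.ofReal 12 * ENNReal.ofReal (N x) := fun x => by
    rw [← ENNReal.ofReal_mul (by norm_num)]
    congr 1; simp only [hN]; field_simp
  have eQ : ∀ x, ENNReal.ofReal (Q x) = ENNReal.ofReal 4 * ENNReal.ofReal (area m x * S.q t x) :=
    fun x => ENNReal.ofReal_mul (by norm_num)
  simp_rw [eN]
  rw [lintegral_const_mul' _ _ ENNReal.ofReal_ne_top]
  refine (mul_le_mul_right le2 _).trans (le_of_eq ?_)
  simp_rw [eQ]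
  rw [lintegral_const_mul' _ _ ENNReal.ofReal_ne_top, ← mul_assoc,
    ← ENNReal.ofReal_mul (by norm_num)]
  norm_num

end Moments

/-! ### The multiplier identity -/

/-- The derivatives f', g', z' of a multiplier may jump at ±1, so integrability comes from
boundedness and measurability. -/
theorem integrableOn_mul_of_bounded {α : Type*} [TopologicalSpace α] [MeasurableSpace α]
    [OpensMeasurableSpace α] {μ : Measure α} [IsFiniteMeasureOnCompacts μ] {s : Set α}
    (hs : IsCompact s) (ms : MeasurableSet s) {h a : α → ℝ} {C : ℝ} (mh : Measurable h)
    (hC : ∀ z ∈ s, |h z| ≤ C) (ca : Continuous a) : IntegrableOn (fun z => h z * a z) s μ := by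
  obtain ⟨D, hD⟩ := hs.exists_bound_of_continuousOn ca.continuousOn
  refine Measure.integrableOn_of_bounded (M := C * D) hs.measure_lt_top.ne
    (mh.mul ca.measurable).aestronglyMeasurable ?_
  filter_upwards [ae_restrict_mem ms] with z hz
  rw [norm_mul]
  exact mul_le_mul (hC z hz) (hD z hz) (norm_nonneg _) ((abs_nonneg _).trans (hC z hz))

theorem continuous_slice (f : ℝ → ℝ → ℝ) (h : Continuous fun z : ℝ × ℝ => f z.1 z.2) (t : ℝ) :
    Continuous fun x => f t x :=
  h.comp (Continuous.prodMk_right t)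

theorem continuous_slice_left (f : ℝ → ℝ → ℝ) (h : Continuous fun z : ℝ × ℝ => f z.1 z.2) (x : ℝ) :
    Continuous fun t => f t x :=
  h.comp (Continuous.prodMk_left x)

namespace Moments

variable {m : ℕ} {T : ℝ} (S : Moments m T)

/-- The quadratic form in the bulk term of the multiplier identity. -/
def bulk (M : Multiplier) (t x : ℝ) : ℝ :=
  M.bulk m x (S.p t x) (S.q t x) (S.r t x) (S.l t x) (S.n t x)

theorem measurable_bulk (hm : 1 ≤ m) (M : Multiplier) :
    Measurable fun z : ℝ × ℝ => S.bulk M z.1 z.2 := by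
  have cA := (continuous_area hm).measurable
  have cL := (continuous_logDer m).measurable
  have := M.mf
  have := M.mg
  have := M.mz
  have := M.cf.measurable
  have := M.cg.measurable
  have := M.cz.measurable
  have := S.cp.measurable
  have := S.cq.measurable
  have := S.cr.measurable
  have := S.cl.measurable
  have := S.cn.measurable
  unfold bulk Multiplier.bulk
  fun_prop

/-- The energy density together with a lower-order term. -/
def dens (t x : ℝ) : ℝ := 2 * S.e t x + area m x * S.n t x / (1 + x ^ 2)

theorem dens_nonneg (t x : ℝ) : 0 ≤ S.dens t x := by
  have := area_pos m x
  have := S.n_nonneg t x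
  have := S.e_nonneg t x
  unfold dens; positivity

theorem continuous_dens (hm : 1 ≤ m) : Continuous fun z : ℝ × ℝ => S.dens z.1 z.2 := by
  have := continuous_area hm
  have := S.continuous_e hm
  have := S.cn
  unfold dens
  exact Continuous.add (by fun_prop) (Continuous.div (by fun_prop) (by fun_prop)
    fun z => by positivity)

/-- Hardy's inequality bounds the zeroth-order part by 48·2 half-energies, in addition to the 2 from
the first part. -/
theorem lintegral_dens_le (hm : 1 ≤ m) {t : ℝ} (ht : t ∈ Icc 0 T) :
    ∫⁻ x, ENNReal.ofReal (S.dens t x) ≤ ENNReal.ofReal 98 * S.en t := by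
  have me : Measurable fun x => ENNReal.ofReal (2 * S.e t x) :=
    (((S.continuous_e hm).comp (Continuous.prodMk_right t)).const_mul 2).measurable.ennreal_ofReal
  have h1 : ∀ x, ENNReal.ofReal (S.dens t x) = ENNReal.ofReal (2 * S.e t x)
      + ENNReal.ofReal (area m x * S.n t x / (1 + x ^ 2)) := fun x => by
    have := area_pos m x
    have := S.n_nonneg t x
    have := S.e_nonneg t x
    exact ENNReal.ofReal_add (by positivity) (by positivity)
  have h2 : ∀ x, ENNReal.ofReal (2 * S.e t x) = ENNReal.ofReal 2 * ENNReal.ofReal (S.e t x) :=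
    fun x => ENNReal.ofReal_mul (by norm_num)
  have h3 : ∫⁻ x, ENNReal.ofReal (area m x * S.q t x) ≤ ENNReal.ofReal 2 * S.en t := by
    rw [en, ← lintegral_const_mul' _ _ ENNReal.ofReal_ne_top]
    refine lintegral_mono fun x => ?_
    rw [← h2]
    refine ENNReal.ofReal_le_ofReal ?_
    have := mul_nonneg (area_pos m x).le (S.p_nonneg t x)
    have := S.r_nonneg t x
    unfold e; linarith
  simp_rw [h1]
  rw [lintegral_add_left me]
  simp_rw [h2]
  rw [lintegral_const_mul' _ _ ENNReal.ofReal_ne_top]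
  calc _ ≤ ENNReal.ofReal 2 * S.en t + ENNReal.ofReal 48 * (ENNReal.ofReal 2 * S.en t) :=
        add_le_add le_rfl ((S.hardy hm ht).trans (mul_le_mul_right h3 _))
    _ = _ := by
      rw [← mul_assoc, ← ENNReal.ofReal_mul (by norm_num), ← add_mul,
        ← ENNReal.ofReal_add (by norm_num) (by norm_num)]
      norm_num

-- The term with k is bounded by the energy directly. The term with j = ∫ u ∂_t u requires |g| ⟨x⟩ ≤
-- C, which explains the normalization of g in `Multiplier.BddBy`.
variable {S} in
theorem abs_boundary_le {M : Multiplier} {C : ℝ} (hM : M.BddBy C) (t x : ℝ) :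
    |area m x * (M.f x * S.k t x + M.g x * S.j t x)| ≤ C * S.dens t x := by
  obtain ⟨h1, h2, -⟩ := hM x
  have A0 := area_pos m x
  have p0 := S.p_nonneg t x
  have q0 := S.q_nonneg t x
  have n0 := S.n_nonneg t x
  have r0 := S.r_nonneg t x
  have J := jb_pos x
  have C0 : 0 ≤ C := (abs_nonneg _).trans h1
  have k1 := S.k_le t x
  have j1 := abs_div_jb_le x (S.j_sq t x) p0 n0
  have e1 : |M.f x * S.k t x| ≤ C * ((S.p t x + S.q t x) / 2) := by
    rw [abs_mul]; exact mul_le_mul h1 k1 (abs_nonneg _) C0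
  have e2 : |M.g x * S.j t x| ≤ C * ((S.p t x + S.n t x / (1 + x ^ 2)) / 2) := by
    have : |M.g x * S.j t x| = |M.g x| * jb x * (|S.j t x| / jb x) := by
      rw [abs_mul]; field_simp
    rw [this]
    exact mul_le_mul h2 j1 (by positivity) C0
  rw [abs_mul, abs_of_pos A0]
  have e3 := mul_le_mul_of_nonneg_left ((abs_add_le _ _).trans (add_le_add e1 e2)) A0.le
  refine e3.trans ?_
  have e4 : C * S.dens t x - area m x * (C * ((S.p t x + S.q t x) / 2)
      + C * ((S.p t x + S.n t x / (1 + x ^ 2)) / 2))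
      = C * (area m x * S.q t x / 2 + S.r t x + area m x * (S.n t x / (1 + x ^ 2)) / 2) := by
    unfold dens e; ring
  have : 0 ≤ C * (area m x * S.q t x / 2 + S.r t x + area m x * (S.n t x / (1 + x ^ 2)) / 2) := by
    positivity
  linarith

variable {S} in
theorem abs_flux_le (hm : 1 ≤ m) {M : Multiplier} {C : ℝ} (hM : M.BddBy C) (t x : ℝ) :
    |M.f x * ((area m x * S.p t x + area m x * S.q t x - S.r t x) / 2)
      + M.g x * (area m x * S.l t x) + M.z x * S.n t x| ≤ 3 * C * S.dens t x := by
  obtain ⟨h1, h2, h3⟩ := hM x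
  have A0 := area_pos m x
  have p0 := S.p_nonneg t x
  have q0 := S.q_nonneg t x
  have n0 := S.n_nonneg t x
  have r0 := S.r_nonneg t x
  have J := jb_pos x
  have C0 : 0 ≤ C := (abs_nonneg _).trans h1
  have j1 := abs_div_jb_le x (S.l_sq t x) q0 n0
  have Ap := mul_nonneg A0.le p0
  have Aq := mul_nonneg A0.le q0
  have e1 : |M.f x * ((area m x * S.p t x + area m x * S.q t x - S.r t x) / 2)|
      ≤ C * ((area m x * S.p t x + area m x * S.q t x + S.r t x) / 2) := by
    rw [abs_mul]
    refine mul_le_mul h1 (abs_le.2 ⟨by linarith, by linarith⟩) (abs_nonneg _) C0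
  have e2 : |M.g x * (area m x * S.l t x)|
      ≤ C * (area m x * ((S.q t x + S.n t x / (1 + x ^ 2)) / 2)) := by
    have : |M.g x * (area m x * S.l t x)| = |M.g x| * jb x * (area m x * (|S.l t x| / jb x)) := by
      rw [abs_mul, abs_mul, abs_of_pos A0]; field_simp
    rw [this]
    exact mul_le_mul h2 (mul_le_mul_of_nonneg_left j1 A0.le) (by positivity) C0
  have e3 : |M.z x * S.n t x| ≤ C * (2 * (area m x * (S.n t x / (1 + x ^ 2)))) := by
    rw [abs_mul, abs_of_nonneg n0]
    refine mul_le_mul h3 ?_ n0 C0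
    rw [← mul_div_assoc, ← mul_div_assoc, le_div_iff₀ (by positivity)]
    have := mul_le_mul_of_nonneg_left (jb_sq_le_area hm x) n0
    linarith
  have N0 : 0 ≤ area m x * (S.n t x / (1 + x ^ 2)) := by positivity
  refine (abs_add_le _ _).trans ((add_le_add ((abs_add_le _ _).trans (add_le_add e1 e2)) e3).trans ?_)
  have e4 : 3 * C * S.dens t x - (C * ((area m x * S.p t x + area m x * S.q t x + S.r t x) / 2)
      + C * (area m x * ((S.q t x + S.n t x / (1 + x ^ 2)) / 2))
      + C * (2 * (area m x * (S.n t x / (1 + x ^ 2)))))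
      = C * (5 / 2 * (area m x * S.p t x) + 2 * (area m x * S.q t x) + 5 / 2 * S.r t x
        + 1 / 2 * (area m x * (S.n t x / (1 + x ^ 2)))) := by
    unfold dens e; ring
  have : 0 ≤ C * (5 / 2 * (area m x * S.p t x) + 2 * (area m x * S.q t x) + 5 / 2 * S.r t x
        + 1 / 2 * (area m x * (S.n t x / (1 + x ^ 2)))) := by
    positivity
  linarith

/-- The derivative is grouped into a continuous part and a part with the merely measurable f', g',
z', as their integrability has different reasons. -/
theorem hasDerivAt_cut_flux {M : Multiplier} (R t : ℝ) {x : ℝ} (hx : |x| ≠ 1) :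
    HasDerivAt (fun x => coneCut R 0 x *
      (M.f x * ((area m x * S.p t x + area m x * S.q t x - S.r t x) / 2)
        + M.g x * (area m x * S.l t x) + M.z x * S.n t x))
      ((-(x / jb x * coneCutDer R 0 x) *
        (M.f x * ((area m x * S.p t x + area m x * S.q t x - S.r t x) / 2)
          + M.g x * (area m x * S.l t x) + M.z x * S.n t x)
        + coneCut R 0 x * (M.f x * S.sx t x + M.g x * S.lx t x + M.z x * (2 * S.l t x)))
      + (M.f' x * (coneCut R 0 x * ((area m x * S.p t x + area m x * S.q t x - S.r t x) / 2))
        + M.g' x * (coneCut R 0 x * (area m x * S.l t x))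
        + M.z' x * (coneCut R 0 x * S.n t x))) x := by
  have h1 := (M.df x hx).fun_mul (S.hasDeriv_s t x)
  have h2 := (M.dg x hx).fun_mul (S.hasDeriv_lx t x)
  have h3 := (M.dz x hx).fun_mul (S.hasDeriv_n t x)
  have h4 := (hasDerivAt_coneCut_x R 0 x).fun_mul ((h1.fun_add h2).fun_add h3)
  refine h4.congr_deriv ?_
  ring

/-- This is f times the radial identity plus g times the Lagrangian identity. The correction z
enters only through the exact derivative (z n)' = z' n + 2 z l, and so shifts weight between l and n
for free. -/
theorem cut_flux_identity {M : Multiplier} (R t x : ℝ) :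
    (-(coneCut R 0 x * area m x * M.f x) * S.kt t x
      + -(coneCut R 0 x * area m x * M.g x) * S.jt t x)
    + ((-(x / jb x * coneCutDer R 0 x) *
        (M.f x * ((area m x * S.p t x + area m x * S.q t x - S.r t x) / 2)
          + M.g x * (area m x * S.l t x) + M.z x * S.n t x)
        + coneCut R 0 x * (M.f x * S.sx t x + M.g x * S.lx t x + M.z x * (2 * S.l t x)))
      + (M.f' x * (coneCut R 0 x * ((area m x * S.p t x + area m x * S.q t x - S.r t x) / 2))
        + M.g' x * (coneCut R 0 x * (area m x * S.l t x))
        + M.z' x * (coneCut R 0 x * S.n t x)))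
    = -(x / jb x * coneCutDer R 0 x) *
        (M.f x * ((area m x * S.p t x + area m x * S.q t x - S.r t x) / 2)
          + M.g x * (area m x * S.l t x) + M.z x * S.n t x)
        + coneCut R 0 x * (area m x * (M.f x * S.Fx t x + M.g x * S.Fu t x))
        + coneCut R 0 x * S.bulk M t x := by
  have e1 := S.radial_identity t x
  have e2 := S.lagrangian_identity t x
  rw [sub_eq_iff_eq_add] at e1 e2
  simp only [bulk, Multiplier.bulk, e1, e2]
  ring

set_option maxHeartbeats 400000 in
/-- The multiplier inequality with a spatial cutoff. -/
theorem multiplier_cut_le (hm : 1 ≤ m) (hT : 0 ≤ T) {M : Multiplier} {C : ℝ} (hM : M.BddBy C)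
    (hb : ∀ t x, 0 ≤ S.bulk M t x) {R : ℝ} (hR : 0 < R) :
    ∫⁻ z in Icc 0 T ×ˢ univ, ENNReal.ofReal (coneCut R 0 z.2 * S.bulk M z.1 z.2) ≤
      ENNReal.ofReal C * ((∫⁻ x, ENNReal.ofReal (S.dens T x)) + ∫⁻ x, ENNReal.ofReal (S.dens 0 x))
      + ENNReal.ofReal (6 * C / R) * (∫⁻ t in Icc 0 T, ∫⁻ x, ENNReal.ofReal (S.dens t x))
      + ENNReal.ofReal C * ∫⁻ t in Icc 0 T, ∫⁻ x, ENNReal.ofReal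
        (area m x * (|S.Fx t x| + |S.Fu t x| / jb x)) := by
  have C0 : 0 ≤ C := (abs_nonneg _).trans (hM 0).1
  have cA := continuous_area hm
  have cL := continuous_logDer m
  have cω : Continuous fun x => coneCut R 0 x := (continuous_coneCut R).comp (Continuous.prodMk_right 0)
  have cω' : Continuous fun x => coneCutDer R 0 x :=
    (continuous_coneCutDer R).comp (Continuous.prodMk_right 0)
  have cj := continuous_jb
  have cxj : Continuous fun x : ℝ => x / jb x := continuous_id.div cj fun x => (jb_pos x).ne'
  have ck := S.ck
  have cjj := S.cj
  have cl := S.cl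
  have cn := S.cn
  have cp := S.cp
  have cq := S.cq
  have cr := S.cr
  have ckt := S.ckt
  have cjt := S.cjt
  have csx := S.csx
  have clx := S.clx
  have cf := M.cf
  have cg := M.cg
  have cz := M.cz
  have cFx := S.cFx
  have cFu := S.cFu
  have cd := S.continuous_dens hm
  set s : ℝ → ℝ → ℝ := fun t x => (area m x * S.p t x + area m x * S.q t x - S.r t x) / 2 with hs
  have cs : Continuous fun z : ℝ × ℝ => s z.1 z.2 := by simp only [hs]; fun_prop
  set B : ℝ → ℝ → ℝ := fun t x => area m x * (M.f x * S.k t x + M.g x * S.j t x) with hB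
  set P : ℝ → ℝ → ℝ := fun t x =>
    M.f x * s t x + M.g x * (area m x * S.l t x) + M.z x * S.n t x with hP
  set X : ℝ → ℝ → ℝ := fun t x => -(coneCut R 0 x * area m x * M.f x) * S.k t x
    + -(coneCut R 0 x * area m x * M.g x) * S.j t x with hX
  set Xt : ℝ → ℝ → ℝ := fun t x => -(coneCut R 0 x * area m x * M.f x) * S.kt t x
    + -(coneCut R 0 x * area m x * M.g x) * S.jt t x with hXt
  set Y : ℝ → ℝ → ℝ := fun t x => coneCut R 0 x * P t x with hY
  set Yx : ℝ → ℝ → ℝ := fun t x => (-(x / jb x * coneCutDer R 0 x) * P t x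
    + coneCut R 0 x * (M.f x * S.sx t x + M.g x * S.lx t x + M.z x * (2 * S.l t x)))
    + (M.f' x * (coneCut R 0 x * s t x) + M.g' x * (coneCut R 0 x * (area m x * S.l t x))
      + M.z' x * (coneCut R 0 x * S.n t x)) with hYx
  have cP : Continuous fun z : ℝ × ℝ => P z.1 z.2 := by simp only [hP]; fun_prop
  have cXt : Continuous fun z : ℝ × ℝ => Xt z.1 z.2 := by simp only [hXt]; fun_prop
  have cX : Continuous fun z : ℝ × ℝ => X z.1 z.2 := by simp only [hX]; fun_prop
  have cY : Continuous fun z : ℝ × ℝ => Y z.1 z.2 := by simp only [hY]; fun_prop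
  obtain ⟨D, hD⟩ := M.bdd R
  have cY0 : Continuous fun z : ℝ × ℝ => -(z.2 / jb z.2 * coneCutDer R 0 z.2) * P z.1 z.2
    + coneCut R 0 z.2 * (M.f z.2 * S.sx z.1 z.2 + M.g z.2 * S.lx z.1 z.2
      + M.z z.2 * (2 * S.l z.1 z.2)) := by
    have : Continuous fun z : ℝ × ℝ => z.2 / jb z.2 := cxj.comp continuous_snd
    fun_prop
  have iYx : IntegrableOn (fun z : ℝ × ℝ => Yx z.1 z.2) (Icc 0 T ×ˢ Icc (-R) R) := by
    have ms : MeasurableSet (Icc 0 T ×ˢ Icc (-R) R : Set (ℝ × ℝ)) :=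
      measurableSet_Icc.prod measurableSet_Icc
    exact (cY0.continuousOn.integrableOn_compact (isCompact_rect T R)).add
      (((integrableOn_mul_of_bounded (isCompact_rect T R) ms (M.mf.comp measurable_snd)
        (fun z hz => (hD z.2 (abs_le.2 hz.2)).1) (by fun_prop)).add
      (integrableOn_mul_of_bounded (isCompact_rect T R) ms (M.mg.comp measurable_snd)
        (fun z hz => (hD z.2 (abs_le.2 hz.2)).2.1) (by fun_prop))).add
      (integrableOn_mul_of_bounded (isCompact_rect T R) ms (M.mz.comp measurable_snd)
        (fun z hz => (hD z.2 (abs_le.2 hz.2)).2.2) (by fun_prop)))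
  have iYx' : ∀ t, IntegrableOn (fun x => Yx t x) (Icc (-R) R) := by
    intro t
    have c1 : Continuous fun x => s t x := continuous_slice s cs t
    have c2 : Continuous fun x => S.l t x := continuous_slice S.l cl t
    have c3 : Continuous fun x => S.n t x := continuous_slice S.n cn t
    exact ((cY0.comp (Continuous.prodMk_right t)).continuousOn.integrableOn_compact isCompact_Icc).add
      (((integrableOn_mul_of_bounded isCompact_Icc measurableSet_Icc M.mf
        (fun x hx => (hD x (abs_le.2 hx)).1) (by fun_prop)).add
      (integrableOn_mul_of_bounded isCompact_Icc measurableSet_Icc M.mg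
        (fun x hx => (hD x (abs_le.2 hx)).2.1) (by fun_prop))).add
      (integrableOn_mul_of_bounded isCompact_Icc measurableSet_Icc M.mz
        (fun x hx => (hD x (abs_le.2 hx)).2.2) (by fun_prop)))
  have hz : ∀ x, R ≤ |x| → coneCut R 0 x = 0 := fun x hx => coneCut_eq_zero hR le_rfl hx
  have main := setIntegral_divergence (X := X) (Xt := Xt) (Y := Y) (Yx := Yx) hT hR.le
    (fun t x => ((S.hasDeriv_k t x).const_mul _).fun_add ((S.hasDeriv_j t x).const_mul _))
    (fun t x hx => S.hasDerivAt_cut_flux R t hx)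
    (fun t => continuous_slice Y cY t) (fun t ht => by
      simp only [hY]
      rw [hz R (le_abs_self R), hz (-R) (by rw [abs_neg]; exact le_abs_self R)]
      simp)
    (cXt.continuousOn.integrableOn_compact (isCompact_rect T R))
    (fun x => (continuous_slice_left Xt cXt x).continuousOn.integrableOn_compact isCompact_Icc)
    iYx iYx'
  have iXY : IntegrableOn (fun z : ℝ × ℝ => Xt z.1 z.2 + Yx z.1 z.2) (Icc 0 T ×ˢ Icc (-R) R) :=
    (cXt.continuousOn.integrableOn_compact (isCompact_rect T R)).add iYx
  set G : ℝ × ℝ → ℝ := fun z => area m z.2 * (|S.Fx z.1 z.2| + |S.Fu z.1 z.2| / jb z.2) with hG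
  have cG : Continuous G := by
    simp only [hG]
    exact (cA.comp continuous_snd).mul (cFx.abs.add (cFu.abs.div (cj.comp continuous_snd)
      fun z => (jb_pos z.2).ne'))
  have G0 : ∀ z, 0 ≤ G z := fun z => by
    have := area_pos m z.2
    have := jb_pos z.2
    simp only [hG]; positivity
  -- Unlike the energy flux, this flux has no sign. The cutoff is therefore purely spatial and its
  -- derivative is merely estimated: 2/R for the cutoff times 3C for the flux gives 6C/R.
  have pw : ∀ z : ℝ × ℝ, coneCut R 0 z.2 * S.bulk M z.1 z.2 ≤ (Xt z.1 z.2 + Yx z.1 z.2)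
      + (6 * C / R * S.dens z.1 z.2 + C * G z) := by
    rintro ⟨t, x⟩
    have hJ := jb_pos x
    have A0 := area_pos m x
    have w0 := coneCut_nonneg R 0 x
    have w1 := coneCut_le_one hR le_rfl x
    have i1 : Xt t x + Yx t x = -(x / jb x * coneCutDer R 0 x) * P t x
        + coneCut R 0 x * (area m x * (M.f x * S.Fx t x + M.g x * S.Fu t x))
        + coneCut R 0 x * S.bulk M t x := S.cut_flux_identity R t x
    have f1 : x / jb x * coneCutDer R 0 x * P t x ≤ 6 * C / R * S.dens t x := by
      refine (le_abs_self _).trans ?_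
      rw [abs_mul, abs_mul, abs_of_nonneg (coneCutDer_nonneg hR 0 x)]
      calc _ ≤ 1 * (2 / R) * (3 * C * S.dens t x) :=
            mul_le_mul (mul_le_mul (abs_div_jb_le_one x) (coneCutDer_le hR le_rfl x)
              (coneCutDer_nonneg hR 0 x) zero_le_one) (abs_flux_le hm hM t x) (abs_nonneg _)
              (by positivity)
        _ = _ := by ring
    have f2 : -(coneCut R 0 x * (area m x * (M.f x * S.Fx t x + M.g x * S.Fu t x))) ≤ C * G (t, x) := by
      refine (neg_le_abs _).trans ?_
      rw [abs_mul, abs_of_nonneg w0]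
      refine (mul_le_of_le_one_left (abs_nonneg _) w1).trans ?_
      obtain ⟨h1, h2, -⟩ := hM x
      have g1 : |M.f x * S.Fx t x| ≤ C * |S.Fx t x| := by
        rw [abs_mul]; exact mul_le_mul_of_nonneg_right h1 (abs_nonneg _)
      have g2 : |M.g x * S.Fu t x| ≤ C * (|S.Fu t x| / jb x) := by
        have : |M.g x * S.Fu t x| = |M.g x| * jb x * (|S.Fu t x| / jb x) := by
          rw [abs_mul]; field_simp
        rw [this]; exact mul_le_mul_of_nonneg_right h2 (by positivity)
      rw [abs_mul, abs_of_pos A0]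
      have := mul_le_mul_of_nonneg_left ((abs_add_le _ _).trans (add_le_add g1 g2)) A0.le
      refine this.trans (le_of_eq ?_)
      simp only [hG]; ring
    simp only []
    linarith
  have ii : ∀ {f : ℝ × ℝ → ℝ}, Continuous f → IntegrableOn f (Icc 0 T ×ˢ Icc (-R) R) := fun h =>
    h.continuousOn.integrableOn_compact (isCompact_rect T R)
  have iRHS : IntegrableOn (fun z : ℝ × ℝ => (Xt z.1 z.2 + Yx z.1 z.2)
      + (6 * C / R * S.dens z.1 z.2 + C * G z)) (Icc 0 T ×ˢ Icc (-R) R) :=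
    iXY.add (ii ((cd.const_mul _).add (cG.const_mul _)))
  have lb : ∀ z : ℝ × ℝ, 0 ≤ coneCut R 0 z.2 * S.bulk M z.1 z.2 := fun z =>
    mul_nonneg (coneCut_nonneg _ _ _) (hb _ _)
  have X1 : ∀ t x, |X t x| ≤ C * S.dens t x := by
    intro t x
    have : X t x = -(coneCut R 0 x * B t x) := by simp only [hX, hB]; ring
    rw [this, abs_neg, abs_mul, abs_of_nonneg (coneCut_nonneg R 0 x)]
    exact (mul_le_of_le_one_left (abs_nonneg _) (coneCut_le_one hR le_rfl x)).trans
      (abs_boundary_le hM t x)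
  have il : ∀ t, IntegrableOn (fun x => S.dens t x) (Icc (-R) R) := fun t =>
    (continuous_slice S.dens cd t).continuousOn.integrableOn_compact isCompact_Icc
  have iX : ∀ t, IntegrableOn (fun x => X t x) (Icc (-R) R) := fun t =>
    (continuous_slice X cX t).continuousOn.integrableOn_compact isCompact_Icc
  have main2 : ∫ z in Icc 0 T ×ˢ Icc (-R) R, (Xt z.1 z.2 + Yx z.1 z.2)
      ≤ C * ((∫ x in Icc (-R) R, S.dens T x) + ∫ x in Icc (-R) R, S.dens 0 x) := by
    rw [main, ← integral_add (il T) (il 0), ← integral_const_mul]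
    refine integral_mono ((iX T).sub (iX 0)) (((il T).add (il 0)).const_mul C) fun x => ?_
    have a1 := (abs_le.1 (X1 T x)).2
    have a2 := (abs_le.1 (X1 0 x)).1
    simp only []
    linarith
  have eD : ∀ t, ENNReal.ofReal (∫ x in Icc (-R) R, S.dens t x)
      ≤ ∫⁻ x, ENNReal.ofReal (S.dens t x) := fun t => by
    rw [ofReal_integral_eq_lintegral_ofReal (il t) (Filter.Eventually.of_forall (S.dens_nonneg t))]
    exact setLIntegral_le_lintegral _ _
  have eG : ∀ {f : ℝ × ℝ → ℝ}, Continuous f → (∀ z, 0 ≤ f z) →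
      ENNReal.ofReal (∫ z in Icc 0 T ×ˢ Icc (-R) R, f z)
        ≤ ∫⁻ t in Icc 0 T, ∫⁻ x, ENNReal.ofReal (f (t, x)) := fun {f} cf f0 => by
    rw [ofReal_integral_eq_lintegral_ofReal (ii cf) (Filter.Eventually.of_forall f0),
      Measure.volume_eq_prod, ← Measure.prod_restrict,
      lintegral_prod _ cf.measurable.ennreal_ofReal.aemeasurable]
    exact lintegral_mono fun t => setLIntegral_le_lintegral _ _
  have hset : (Icc 0 T ×ˢ univ : Set (ℝ × ℝ)) ∩ (univ ×ˢ Icc (-R) R) = Icc 0 T ×ˢ Icc (-R) R := by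
    rw [prod_inter_prod, inter_univ, univ_inter]
  calc ∫⁻ z in Icc 0 T ×ˢ univ, ENNReal.ofReal (coneCut R 0 z.2 * S.bulk M z.1 z.2)
      ≤ ∫⁻ z in Icc 0 T ×ˢ univ, (univ ×ˢ Icc (-R) R).indicator
          (fun z => ENNReal.ofReal (coneCut R 0 z.2 * S.bulk M z.1 z.2)) z := by
        refine lintegral_mono fun z => ?_
        by_cases h : z ∈ (univ ×ˢ Icc (-R) R : Set (ℝ × ℝ))
        · rw [indicator_of_mem h]
        · have : R ≤ |z.2| := by
            by_contra h'
            exact h ⟨mem_univ _, abs_le.1 (not_le.1 h').le⟩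
          simp [hz z.2 this]
    _ = ∫⁻ z in Icc 0 T ×ˢ Icc (-R) R, ENNReal.ofReal (coneCut R 0 z.2 * S.bulk M z.1 z.2) := by
        have mI : MeasurableSet (univ ×ˢ Icc (-R) R : Set (ℝ × ℝ)) :=
          MeasurableSet.univ.prod measurableSet_Icc
        rw [lintegral_indicator mI, Measure.restrict_restrict mI, inter_comm, hset]
    _ ≤ ∫⁻ z in Icc 0 T ×ˢ Icc (-R) R, ENNReal.ofReal ((Xt z.1 z.2 + Yx z.1 z.2)
          + (6 * C / R * S.dens z.1 z.2 + C * G z)) :=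
        lintegral_mono fun z => ENNReal.ofReal_le_ofReal (pw z)
    _ = ENNReal.ofReal (∫ z in Icc 0 T ×ˢ Icc (-R) R, ((Xt z.1 z.2 + Yx z.1 z.2)
          + (6 * C / R * S.dens z.1 z.2 + C * G z))) :=
        (ofReal_integral_eq_lintegral_ofReal iRHS
          (Filter.Eventually.of_forall fun z => (lb z).trans (pw z))).symm
    _ ≤ ENNReal.ofReal (C * ((∫ x in Icc (-R) R, S.dens T x) + ∫ x in Icc (-R) R, S.dens 0 x)
          + (6 * C / R * (∫ z in Icc 0 T ×ˢ Icc (-R) R, S.dens z.1 z.2)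
          + C * ∫ z in Icc 0 T ×ˢ Icc (-R) R, G z)) := by
        refine ENNReal.ofReal_le_ofReal ?_
        have iDG : IntegrableOn (fun z : ℝ × ℝ => 6 * C / R * S.dens z.1 z.2 + C * G z)
          (Icc 0 T ×ˢ Icc (-R) R) := ii ((cd.const_mul _).add (cG.const_mul _))
        rw [integral_add iXY iDG,
          integral_add (ii (cd.const_mul _)) (ii (cG.const_mul _)), integral_const_mul,
          integral_const_mul]
        exact add_le_add main2 le_rfl
    _ ≤ ENNReal.ofReal C * (ENNReal.ofReal (∫ x in Icc (-R) R, S.dens T x)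
          + ENNReal.ofReal (∫ x in Icc (-R) R, S.dens 0 x))
        + (ENNReal.ofReal (6 * C / R) * ENNReal.ofReal (∫ z in Icc 0 T ×ˢ Icc (-R) R, S.dens z.1 z.2)
          + ENNReal.ofReal C * ENNReal.ofReal (∫ z in Icc 0 T ×ˢ Icc (-R) R, G z)) := by
        rw [← ENNReal.ofReal_mul C0, ← ENNReal.ofReal_mul (by positivity)]
        refine ENNReal.ofReal_add_le.trans (add_le_add ?_ ENNReal.ofReal_add_le)
        rw [ENNReal.ofReal_mul C0]
        exact mul_le_mul_right ENNReal.ofReal_add_le _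
    _ ≤ _ := by
        rw [← add_assoc]
        gcongr
        · exact eD T
        · exact eD 0
        · exact eG cd fun z => S.dens_nonneg _ _
        · exact eG cG G0

/-- The local energy inequality of a multiplier with nonnegative bulk term. -/
theorem lintegral_bulk_le (hm : 1 ≤ m) (hT : 0 ≤ T) {M : Multiplier} {C : ℝ} (hM : M.BddBy C)
    (hb : ∀ t x, 0 ≤ S.bulk M t x) {K : ℝ≥0∞} (hK : K ≠ ⊤) (hE : ∀ t ∈ Icc 0 T, S.en t ≤ K) :
    ∫⁻ t in Icc 0 T, ∫⁻ x, ENNReal.ofReal (S.bulk M t x) ≤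
      ENNReal.ofReal (98 * C) * (S.en T + S.en 0)
      + ENNReal.ofReal C * ∫⁻ t in Icc 0 T, ∫⁻ x, ENNReal.ofReal
        (area m x * (|S.Fx t x| + |S.Fu t x| / jb x)) := by
  have C0 : 0 ≤ C := (abs_nonneg _).trans (hM 0).1
  have mb := S.measurable_bulk hm M
  have e1 : ∫⁻ t in Icc 0 T, ∫⁻ x, ENNReal.ofReal (S.bulk M t x)
      = ∫⁻ z in Icc 0 T ×ˢ univ, ENNReal.ofReal (S.bulk M z.1 z.2) := by
    rw [Measure.volume_eq_prod, ← Measure.prod_restrict, Measure.restrict_univ,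
      lintegral_prod _ mb.ennreal_ofReal.aemeasurable]
  rw [e1]
  set c := ENNReal.ofReal C * ∫⁻ t in Icc 0 T, ∫⁻ x, ENNReal.ofReal
        (area m x * (|S.Fx t x| + |S.Fu t x| / jb x)) with hc
  set H := ∫⁻ t in Icc 0 T, ∫⁻ x, ENNReal.ofReal (S.dens t x) with hH
  -- The uniform energy bound is needed here: it makes the coefficient H of the cutoff error 6C/R
  -- finite, so that the error disappears in the limit.
  have Ht : H ≠ ⊤ := by
    have : H ≤ ∫⁻ t in Icc 0 T, ENNReal.ofReal 98 * K :=
      setLIntegral_mono' measurableSet_Icc fun t ht =>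
        (S.lintegral_dens_le hm ht).trans (mul_le_mul_right (hE t ht) _)
    refine ne_top_of_le_ne_top ?_ this
    rw [setLIntegral_const]
    exact ENNReal.mul_ne_top (ENNReal.mul_ne_top ENNReal.ofReal_ne_top hK) (by simp)
  have lim : Filter.Tendsto (fun N : ℕ => ENNReal.ofReal (98 * C) * (S.en T + S.en 0)
      + ENNReal.ofReal (6 * C / (N + 1)) * H + c) Filter.atTop
      (nhds (ENNReal.ofReal (98 * C) * (S.en T + S.en 0) + ENNReal.ofReal 0 * H + c)) := by
    refine (tendsto_const_nhds.add (ENNReal.Tendsto.mul_const (ENNReal.tendsto_ofReal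
      (tendsto_const_nhds.div_atTop (Filter.tendsto_atTop_add_const_right _ _
      tendsto_natCast_atTop_atTop))) (Or.inr Ht))).add tendsto_const_nhds
  rw [ENNReal.ofReal_zero, zero_mul, add_zero] at lim
  have m1 : ∀ N : ℕ, Measurable fun z : ℝ × ℝ => ENNReal.ofReal
      (coneCut (N + 1) 0 z.2 * S.bulk M z.1 z.2) := fun N =>
    (((continuous_slice (coneCut (N + 1)) (continuous_coneCut _) 0).measurable.comp
      measurable_snd).mul mb).ennreal_ofReal
  have l1 : ∀ z : ℝ × ℝ, Filter.Tendsto (fun N : ℕ => ENNReal.ofReal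
      (coneCut (N + 1) 0 z.2 * S.bulk M z.1 z.2)) Filter.atTop
      (nhds (ENNReal.ofReal (S.bulk M z.1 z.2))) := fun z => tendsto_cut_mul 0 z.2 _
  refine lintegral_le_of_tendsto m1 l1 (fun N => ?_) lim
  have := S.multiplier_cut_le hm hT hM hb (by positivity : (0 : ℝ) < N + 1)
  refine this.trans ?_
  refine add_le_add (add_le_add ?_ le_rfl) le_rfl
  refine (mul_le_mul_right (add_le_add (S.lintegral_dens_le hm ⟨hT, le_rfl⟩)
    (S.lintegral_dens_le hm ⟨le_rfl, hT⟩)) _).trans (le_of_eq ?_)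
  rw [ENNReal.ofReal_mul (by norm_num : (0 : ℝ) ≤ 98)]
  ring

end Moments

section

/-! ### Local energy norms -/

theorem measurableSet_annulus (j : ℕ) : MeasurableSet (annulus j) := by
  have := continuous_jb
  exact (measurableSet_le measurable_const this.measurable).inter
    (measurableSet_lt this.measurable measurable_const)

theorem iUnion_annulus : ⋃ j, annulus j = univ := by
  refine eq_univ_of_forall fun x => mem_iUnion.2 ?_
  obtain ⟨n, h1, h2⟩ := exists_nat_pow_near (one_le_jb x) one_lt_two
  exact ⟨n, h1, h2⟩

theorem pairwise_disjoint_annulus : Pairwise (Function.onFun Disjoint annulus) := by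
  intro i j hij
  rw [Function.onFun, Set.disjoint_left]
  rintro x ⟨h1, h2⟩ ⟨h3, h4⟩
  have a : i < j + 1 := (pow_lt_pow_iff_right₀ one_lt_two).1 (h1.trans_lt h4)
  have b : j < i + 1 := (pow_lt_pow_iff_right₀ one_lt_two).1 (h3.trans_lt h2)
  omega

theorem lintegral_eq_tsum_annulus (f : ℝ → ℝ≥0∞) :
    ∫⁻ x, f x = ∑' j, ∫⁻ x in annulus j, f x := by
  rw [← lintegral_iUnion measurableSet_annulus pairwise_disjoint_annulus, iUnion_annulus,
    Measure.restrict_univ]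

theorem two_rpow_half_mul (j : ℕ) :
    (2 : ℝ≥0∞) ^ ((j : ℝ) / 2) * (2 : ℝ≥0∞) ^ (-(j : ℝ) / 2) = 1 := by
  rw [← ENNReal.rpow_add _ _ (by norm_num) (by norm_num)]
  ring_nf
  simp

theorem one_le_two_rpow_half (j : ℕ) : (1 : ℝ≥0∞) ≤ (2 : ℝ≥0∞) ^ ((j : ℝ) / 2) := by
  rw [← ENNReal.rpow_zero (x := 2)]
  exact ENNReal.rpow_le_rpow_of_exponent_le (by norm_num) (by positivity)

theorem two_rpow_neg_le_one (j : ℕ) : (2 : ℝ≥0∞) ^ (-(j : ℝ)) ≤ 1 := by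
  rw [← ENNReal.rpow_zero (x := 2)]
  exact ENNReal.rpow_le_rpow_of_exponent_le (by norm_num) (by simp)

variable {m : ℕ} {T : ℝ}

theorem measurable_area_ofReal (hm : 1 ≤ m) : Measurable fun x => ENNReal.ofReal (aFun m x ^ 2) :=
  (continuous_area hm).measurable.ennreal_ofReal

theorem lintegral_ann_le (hm : 1 ≤ m) {Φ G : ℝ → ℝ → ℝ≥0∞}
    (hΦ : Measurable fun z : ℝ × ℝ => Φ z.1 z.2) (hG : Measurable fun z : ℝ × ℝ => G z.1 z.2)
    (j : ℕ) :
    ∫⁻ t in Icc 0 T, ∫⁻ x in annulus j, Φ t x ^ (1 / 2 : ℝ) * G t x ^ (1 / 2 : ℝ)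
      * ENNReal.ofReal (aFun m x ^ 2) ≤ annL2 m T j Φ * annL2 m T j G := by
  have mA : Measurable fun z : ℝ × ℝ => ENNReal.ofReal (aFun m z.2 ^ 2) :=
    (measurable_area_ofReal hm).comp measurable_snd
  have key : ∀ H : ℝ × ℝ → ℝ≥0∞, Measurable H →
      ∫⁻ t in Icc 0 T, ∫⁻ x in annulus j, H (t, x)
        = ∫⁻ z, H z ∂((volume.restrict (Icc 0 T)).prod (volume.restrict (annulus j))) := fun H hH =>
    (lintegral_prod _ hH.aemeasurable).symm
  rw [annL2, annL2, key (fun z => Φ z.1 z.2 ^ (1 / 2 : ℝ) * G z.1 z.2 ^ (1 / 2 : ℝ)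
      * ENNReal.ofReal (aFun m z.2 ^ 2)) (by fun_prop),
    key (fun z => Φ z.1 z.2 * ENNReal.ofReal (aFun m z.2 ^ 2)) (by fun_prop),
    key (fun z => G z.1 z.2 * ENNReal.ofReal (aFun m z.2 ^ 2)) (by fun_prop)]
  refine le_trans (le_of_eq (lintegral_congr fun z => ?_)) (lintegral_sqrt_mul_sqrt_le
    (by fun_prop) (by fun_prop))
  rw [ENNReal.mul_rpow_of_nonneg _ _ (by norm_num : (0 : ℝ) ≤ 1 / 2),
    ENNReal.mul_rpow_of_nonneg _ _ (by norm_num : (0 : ℝ) ≤ 1 / 2)]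
  nth_rewrite 1 [← ENNReal.sqrt_mul_self (ENNReal.ofReal (aFun m z.2 ^ 2))]
  ring

theorem lintegral_strip_eq_tsum {H : ℝ → ℝ → ℝ≥0∞}
    (hH : Measurable fun z : ℝ × ℝ => H z.1 z.2) :
    ∫⁻ t in Icc 0 T, ∫⁻ x, H t x = ∑' j, ∫⁻ t in Icc 0 T, ∫⁻ x in annulus j, H t x := by
  rw [← lintegral_tsum]
  · exact lintegral_congr fun t => lintegral_eq_tsum_annulus _
  · exact fun j => (Measurable.lintegral_prod_right' hH).aemeasurable

/-- Duality between the local energy norm and its dual norm. -/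
theorem lintegral_le_LEStar_mul_LE (hm : 1 ≤ m) {Φ G : ℝ → ℝ → ℝ≥0∞}
    (hΦ : Measurable fun z : ℝ × ℝ => Φ z.1 z.2) (hG : Measurable fun z : ℝ × ℝ => G z.1 z.2) :
    ∫⁻ t in Icc 0 T, ∫⁻ x, Φ t x ^ (1 / 2 : ℝ) * G t x ^ (1 / 2 : ℝ)
      * ENNReal.ofReal (aFun m x ^ 2) ≤ LEStar m T Φ * LE m T G := by
  have mA : Measurable fun z : ℝ × ℝ => ENNReal.ofReal (aFun m z.2 ^ 2) :=
    (measurable_area_ofReal hm).comp measurable_snd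
  rw [lintegral_strip_eq_tsum (by fun_prop), LEStar, ← ENNReal.tsum_mul_right]
  refine ENNReal.tsum_le_tsum fun j => (lintegral_ann_le hm hΦ hG j).trans ?_
  calc annL2 m T j Φ * annL2 m T j G
      = ((2 : ℝ≥0∞) ^ ((j : ℝ) / 2) * (2 : ℝ≥0∞) ^ (-(j : ℝ) / 2))
        * (annL2 m T j Φ * annL2 m T j G) := by rw [two_rpow_half_mul, one_mul]
    _ = (2 : ℝ≥0∞) ^ ((j : ℝ) / 2) * annL2 m T j Φ
        * ((2 : ℝ≥0∞) ^ (-(j : ℝ) / 2) * annL2 m T j G) := by ring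
    _ ≤ _ := by
      gcongr
      exact le_iSup (fun j : ℕ => (2 : ℝ≥0∞) ^ (-(j : ℝ) / 2) * annL2 m T j G) j

theorem lintegral_strip_le_LEStar (hm : 1 ≤ m) {Φ : ℝ → ℝ → ℝ≥0∞}
    (hΦ : Measurable fun z : ℝ × ℝ => Φ z.1 z.2) :
    ∫⁻ t in Icc 0 T, ∫⁻ x, Φ t x * ENNReal.ofReal (aFun m x ^ 2) ≤ LEStar m T Φ ^ 2 := by
  have mA : Measurable fun z : ℝ × ℝ => ENNReal.ofReal (aFun m z.2 ^ 2) :=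
    (measurable_area_ofReal hm).comp measurable_snd
  have h1 : ∀ j, annL2 m T j Φ ≤ LEStar m T Φ := by
    intro j
    refine le_trans ?_ (ENNReal.le_tsum j)
    have : (1 : ℝ≥0∞) ≤ (2 : ℝ≥0∞) ^ ((j : ℝ) / 2) :=
      one_le_two_rpow_half j
    exact le_mul_of_one_le_left' this
  have h2 : ∀ j, ∫⁻ t in Icc 0 T, ∫⁻ x in annulus j, Φ t x * ENNReal.ofReal (aFun m x ^ 2)
      = annL2 m T j Φ * annL2 m T j Φ := fun j => by rw [annL2, ENNReal.sqrt_mul_self]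
  rw [lintegral_strip_eq_tsum (by fun_prop)]
  simp_rw [h2]
  rw [sq]
  nth_rewrite 1 [LEStar]
  rw [← ENNReal.tsum_mul_right]
  refine ENNReal.tsum_le_tsum fun j => ?_
  have : (1 : ℝ≥0∞) ≤ (2 : ℝ≥0∞) ^ ((j : ℝ) / 2) :=
    one_le_two_rpow_half j
  exact mul_le_mul' (le_mul_of_one_le_left' this) (h1 j)

/-- Used only to see that the energy stays finite; the factor √T never enters the final constant. -/
theorem L1L2_le_LEStar (hm : 1 ≤ m) {Φ : ℝ → ℝ → ℝ≥0∞}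
    (hΦ : Measurable fun z : ℝ × ℝ => Φ z.1 z.2) :
    L1L2 m T Φ ≤ ENNReal.ofReal T ^ (1 / 2 : ℝ) * LEStar m T Φ := by
  have mA : Measurable fun z : ℝ × ℝ => ENNReal.ofReal (aFun m z.2 ^ 2) :=
    (measurable_area_ofReal hm).comp measurable_snd
  have m1 : Measurable fun t => ∫⁻ x, Φ t x * ENNReal.ofReal (aFun m x ^ 2) :=
    Measurable.lintegral_prod_right' (f := fun z : ℝ × ℝ => Φ z.1 z.2
      * ENNReal.ofReal (aFun m z.2 ^ 2)) (by fun_prop)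
  have h := lintegral_sqrt_mul_sqrt_le (μ := volume.restrict (Icc 0 T)) (f := fun _ => 1)
    (g := fun t => ∫⁻ x, Φ t x * ENNReal.ofReal (aFun m x ^ 2)) (by fun_prop) m1.aemeasurable
  simp only [ENNReal.one_rpow, one_mul, lintegral_const, Measure.restrict_apply_univ,
    Real.volume_Icc, sub_zero] at h
  refine h.trans (mul_le_mul_right ?_ _)
  calc _ ≤ (LEStar m T Φ ^ 2) ^ (1 / 2 : ℝ) :=
        ENNReal.rpow_le_rpow (lintegral_strip_le_LEStar hm hΦ) (by norm_num)
    _ = LEStar m T Φ := by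
      rw [← ENNReal.rpow_natCast, ← ENNReal.rpow_mul]; norm_num

theorem LE_le_of_lintegral_le {G : ℝ → ℝ → ℝ≥0∞} {B : ℝ≥0∞}
    (h : ∀ j : ℕ, (2 : ℝ≥0∞) ^ (-(j : ℝ)) * ∫⁻ t in Icc 0 T, ∫⁻ x in annulus j,
      G t x * ENNReal.ofReal (aFun m x ^ 2) ≤ B) : LE m T G ≤ B ^ (1 / 2 : ℝ) := by
  refine iSup_le fun j => ?_
  rw [annL2, neg_div, div_eq_mul_one_div, ← neg_mul, ENNReal.rpow_mul,
    ← ENNReal.mul_rpow_of_nonneg _ _ (by norm_num : (0 : ℝ) ≤ 1 / 2)]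
  exact ENNReal.rpow_le_rpow (h j) (by norm_num)

theorem annulus_subset_weight (j : ℕ) {x : ℝ} (hx : x ∈ annulus j) :
    (2 : ℝ) ^ j ≤ jb x ∧ jb x ≤ 2 * 2 ^ j :=
  ⟨hx.1, by rw [← pow_succ']; exact hx.2.le⟩

namespace Moments

variable (S : Moments m T)

/-- The quantity to be estimated, in terms of angular integrals. -/
def lossy : ℝ≥0∞ :=
  (⨆ t ∈ Icc 0 T, (ENNReal.ofReal 2 * S.en t) ^ (1 / 2 : ℝ))
    + LE m T (fun t x => ENNReal.ofReal (S.q t x))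
    + LE m T (fun t x => ENNReal.ofReal (wtSq m x * S.p t x))
    + LE m T (fun t x => ENNReal.ofReal (wtSq m x * (S.r t x / area m x)))
    + LE m T (fun t x => ENNReal.ofReal (S.n t x / (1 + x ^ 2)))

/-- The space-time integral of the work done by the forcing. -/
def work : ℝ≥0∞ := ∫⁻ t in Icc 0 T, ∫⁻ x, ENNReal.ofReal
  (area m x * (|S.Ft t x| + (|S.Fx t x| + |S.Fu t x| / jb x)))

/-- The dominating density f may depend on j. This is how a different multiplier can be used on each
dyadic region. -/
theorem lossy_le_of {B : ℝ≥0∞}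
    (h0 : ∀ t ∈ Icc 0 T, ENNReal.ofReal 2 * S.en t ≤ B)
    (h : ∀ j : ℕ, ∃ f : ℝ → ℝ → ℝ,
      (∀ t x, x ∈ annulus j → area m x * S.q t x + area m x * wtSq m x * S.p t x
        + wtSq m x * S.r t x + area m x * S.n t x / (1 + x ^ 2) ≤ f t x) ∧
      (2 : ℝ≥0∞) ^ (-(j : ℝ)) * ∫⁻ t in Icc 0 T, ∫⁻ x in annulus j, ENNReal.ofReal (f t x) ≤ B) :
    S.lossy ≤ 5 * B ^ (1 / 2 : ℝ) := by
  have key : ∀ g : ℝ → ℝ → ℝ, (∀ t x, area m x * g t x ≤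
      area m x * S.q t x + area m x * wtSq m x * S.p t x
        + wtSq m x * S.r t x + area m x * S.n t x / (1 + x ^ 2)) →
      LE m T (fun t x => ENNReal.ofReal (g t x)) ≤ B ^ (1 / 2 : ℝ) := by
    intro g hg
    refine LE_le_of_lintegral_le fun j => ?_
    obtain ⟨f, hf, hB⟩ := h j
    refine le_trans (mul_le_mul_right (lintegral_mono fun t =>
      setLIntegral_mono' (measurableSet_annulus j) fun x hx => ?_) _) hB
    rw [mul_comm, ← ENNReal.ofReal_mul (sq_nonneg _)]
    exact ENNReal.ofReal_le_ofReal ((hg t x).trans (hf t x hx))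
  have A0 := area_pos m
  have W0 := wtSq_nonneg m
  have nn : ∀ t x, 0 ≤ area m x * S.q t x ∧ 0 ≤ area m x * wtSq m x * S.p t x ∧
        0 ≤ wtSq m x * S.r t x ∧ 0 ≤ area m x * S.n t x / (1 + x ^ 2) := fun t x => by
    have := A0 x
    have := W0 x
    have := S.p_nonneg t x
    have := S.q_nonneg t x
    have := S.r_nonneg t x
    have := S.n_nonneg t x
    refine ⟨?_, ?_, ?_, ?_⟩ <;> positivity
  have e5 : 5 * B ^ (1 / 2 : ℝ) = B ^ (1 / 2 : ℝ) + B ^ (1 / 2 : ℝ) + B ^ (1 / 2 : ℝ)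
      + B ^ (1 / 2 : ℝ) + B ^ (1 / 2 : ℝ) := by ring
  rw [e5]
  refine add_le_add (add_le_add (add_le_add (add_le_add ?_ ?_) ?_) ?_) ?_
  · exact iSup₂_le fun t ht => ENNReal.rpow_le_rpow (h0 t ht) (by norm_num)
  · refine key _ fun t x => ?_
    obtain ⟨h1, h2, h3, h4⟩ := nn t x
    linarith
  · refine key _ fun t x => ?_
    obtain ⟨h1, h2, h3, h4⟩ := nn t x
    linarith
  · refine key _ fun t x => ?_
    obtain ⟨h1, h2, h3, h4⟩ := nn t x
    have : area m x * (wtSq m x * (S.r t x / area m x)) = wtSq m x * S.r t x := by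
      have := (A0 x).ne'
      field_simp
    linarith
  · refine key _ fun t x => ?_
    obtain ⟨h1, h2, h3, h4⟩ := nn t x
    have : area m x * (S.n t x / (1 + x ^ 2)) = area m x * S.n t x / (1 + x ^ 2) := by ring
    linarith

/-- A crude bound growing with T, whose only purpose is to make the final absorption legitimate. -/
theorem lossy_ne_top (hm : 1 ≤ m) {K : ℝ≥0∞} (hK : K ≠ ⊤) (hE : ∀ t ∈ Icc 0 T, S.en t ≤ K) :
    S.lossy ≠ ⊤ := by
  set B : ℝ≥0∞ := ENNReal.ofReal 2 * K + ENNReal.ofReal 98 * K * volume (Icc 0 T) with hB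
  have hBt : B ≠ ⊤ := ENNReal.add_ne_top.2 ⟨ENNReal.mul_ne_top ENNReal.ofReal_ne_top hK,
    ENNReal.mul_ne_top (ENNReal.mul_ne_top ENNReal.ofReal_ne_top hK) (by simp)⟩
  refine ne_top_of_le_ne_top (ENNReal.mul_ne_top (by norm_num)
    (ENNReal.rpow_ne_top_of_nonneg (by norm_num) hBt)) (S.lossy_le_of (B := B) ?_ ?_)
  · exact fun t ht => (mul_le_mul_right (hE t ht) _).trans le_self_add
  · refine fun j => ⟨S.dens, fun t x _ => ?_, ?_⟩
    · have A0 := area_pos m x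
      have h1 := mul_le_mul_of_nonneg_left (wtSq_le_one m x)
        (mul_nonneg A0.le (S.p_nonneg t x))
      have h2 := mul_le_mul_of_nonneg_left (wtSq_le_one m x) (S.r_nonneg t x)
      unfold dens e
      linarith
    · have h2 : (2 : ℝ≥0∞) ^ (-(j : ℝ)) ≤ 1 :=
        two_rpow_neg_le_one j
      refine (mul_le_of_le_one_left' h2).trans (le_trans ?_ le_add_self)
      rw [← setLIntegral_const]
      exact setLIntegral_mono' measurableSet_Icc fun t ht => (setLIntegral_le_lintegral _ _).trans
        ((S.lintegral_dens_le hm ht).trans (mul_le_mul_right (hE t ht) _))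

theorem en_le_work (hm : 1 ≤ m) {t : ℝ} (ht : t ∈ Icc 0 T) : S.en t ≤ S.en 0 + S.work := by
  refine (S.en_le hm ht.1).trans (add_le_add le_rfl ?_)
  refine (lintegral_mono_set (Icc_subset_Icc le_rfl ht.2)).trans (lintegral_mono fun t =>
    lintegral_mono fun x => ENNReal.ofReal_le_ofReal ?_)
  have := area_pos m x
  have := jb_pos x
  refine mul_le_mul_of_nonneg_left (le_add_of_nonneg_right ?_) (area_pos m x).le
  positivity

end Moments

/-- On the j-th annulus the multiplier of scale b = 2^j is used: the factor 2^{-j} of the squared LE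
norm matches the 1/b of its coercivity. The constant does not depend on K, which only served to
remove the spatial cutoff. -/
theorem exists_lossy_le (hm : 1 ≤ m) : ∃ C : ℝ≥0, ∀ (T : ℝ) (S : Moments m T), 0 ≤ T →
    ∀ K : ℝ≥0∞, K ≠ ⊤ → (∀ t ∈ Icc 0 T, S.en t ≤ K) →
      S.lossy ≤ C * (S.en 0 + S.work) ^ (1 / 2 : ℝ) := by
  obtain ⟨C, c, hc, H⟩ := exists_multiplier hm
  have C0 : 0 ≤ C := by
    obtain ⟨M, hM, -⟩ := H 1 le_rfl
    exact (abs_nonneg _).trans (hM 0).1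
  -- The 2 covers the energy term. The bulk is at most 98C(E+E) + CE = 197CE, so 295 is more than
  -- enough.
  set D : ℝ≥0∞ := ENNReal.ofReal (2 + 295 * C / c) with hD
  have hDt : 5 * D ^ (1 / 2 : ℝ) ≠ ⊤ := ENNReal.mul_ne_top (by norm_num)
    (ENNReal.rpow_ne_top_of_nonneg (by norm_num) ENNReal.ofReal_ne_top)
  refine ⟨(5 * D ^ (1 / 2 : ℝ)).toNNReal, fun T S hT K hK hE => ?_⟩
  rw [ENNReal.coe_toNNReal hDt, mul_assoc,
    ← ENNReal.mul_rpow_of_nonneg _ _ (by norm_num : (0 : ℝ) ≤ 1 / 2)]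
  have hEt := fun {t : ℝ} (ht : t ∈ Icc 0 T) => S.en_le_work hm ht
  set E := S.en 0 + S.work with hEdef
  refine S.lossy_le_of (fun t ht => ?_) fun j => ?_
  · refine mul_le_mul' (ENNReal.ofReal_le_ofReal ?_) (hEt ht)
    have : 0 ≤ 295 * C / c := by positivity
    linarith
  · have b1 : (1 : ℝ) ≤ 2 ^ j := one_le_pow₀ one_le_two
    have b0 : (0 : ℝ) < 2 ^ j := by positivity
    obtain ⟨M, hM, hB⟩ := H (2 ^ j) b1
    have hB' := fun t x => hB x (S.p t x) (S.q t x) (S.r t x) (S.l t x) (S.n t x)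
      (S.p_nonneg t x) (S.q_nonneg t x) (S.r_nonneg t x) (S.n_nonneg t x) (S.l_sq t x)
    refine ⟨fun t x => 2 ^ j / c * S.bulk M t x, fun t x hx => ?_, ?_⟩
    · have h1 := (hB' t x).2 (annulus_subset_weight j hx).1 (annulus_subset_weight j hx).2
      have h2 := mul_le_mul_of_nonneg_left h1 (by positivity : 0 ≤ 2 ^ j / c)
      refine le_trans (le_of_eq ?_) h2
      field_simp
    · have h1 := S.lintegral_bulk_le hm hT hM (fun t x => (hB' t x).1) hK hE
      have hcb : 0 ≤ 2 ^ j / c := by positivity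
      simp_rw [ENNReal.ofReal_mul hcb]
      simp_rw [lintegral_const_mul' _ _ ENNReal.ofReal_ne_top]
      have e1 : (2 : ℝ≥0∞) ^ (-(j : ℝ)) * ENNReal.ofReal (2 ^ j / c) = ENNReal.ofReal (1 / c) := by
        rw [div_eq_mul_one_div, ENNReal.ofReal_mul b0.le, ← mul_assoc,
          ENNReal.ofReal_pow zero_le_two, ENNReal.ofReal_ofNat, ENNReal.rpow_neg,
          ENNReal.rpow_natCast, ENNReal.inv_mul_cancel (by simp) (by simp), one_mul]
      rw [← mul_assoc, e1]
      have h2 : ∫⁻ t in Icc 0 T, ∫⁻ x in annulus j, ENNReal.ofReal (S.bulk M t x)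
          ≤ ENNReal.ofReal (295 * C) * E := by
        refine (lintegral_mono fun t => setLIntegral_le_lintegral _ _).trans (h1.trans ?_)
        have w1 : ∫⁻ t in Icc 0 T, ∫⁻ x, ENNReal.ofReal
            (area m x * (|S.Fx t x| + |S.Fu t x| / jb x)) ≤ E := by
          refine le_trans (lintegral_mono fun t => lintegral_mono fun x =>
            ENNReal.ofReal_le_ofReal ?_) le_add_self
          exact mul_le_mul_of_nonneg_left (le_add_of_nonneg_left (abs_nonneg _)) (area_pos m x).le
        calc _ ≤ ENNReal.ofReal (98 * C) * (E + E) + ENNReal.ofReal C * E :=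
              add_le_add (mul_le_mul_right (add_le_add (hEt ⟨hT, le_rfl⟩)
                (hEt ⟨le_rfl, hT⟩)) _) (mul_le_mul_right w1 _)
          _ ≤ _ := by
              rw [← two_mul, ← mul_assoc, ← add_mul]
              refine mul_le_mul_left (le_of_eq ?_) _ |>.trans (mul_le_mul_left
                (ENNReal.ofReal_le_ofReal (by linarith : 197 * C ≤ 295 * C)) _)
              rw [← ENNReal.ofReal_ofNat, ← ENNReal.ofReal_mul (by positivity),
                ← ENNReal.ofReal_add (by positivity) C0]
              congr 1; ring
      refine (mul_le_mul_right h2 _).trans ?_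
      rw [← mul_assoc, ← ENNReal.ofReal_mul (by positivity)]
      refine mul_le_mul_left (ENNReal.ofReal_le_ofReal ?_) _
      have : 1 / c * (295 * C) = 295 * C / c := by ring
      linarith

end

/-! ### The work of the forcing, and its absorption -/

section

variable {m : ℕ} {T : ℝ}

theorem lintegral_le_L1L2_mul (hm : 1 ≤ m) {Φ G : ℝ → ℝ → ℝ≥0∞}
    (hΦ : Measurable fun z : ℝ × ℝ => Φ z.1 z.2) (hG : Measurable fun z : ℝ × ℝ => G z.1 z.2)
    {B : ℝ≥0∞} (hBt : B ≠ ⊤)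
    (hB : ∀ t ∈ Icc 0 T, ∫⁻ x, G t x * ENNReal.ofReal (aFun m x ^ 2) ≤ B ^ 2) :
    ∫⁻ t in Icc 0 T, ∫⁻ x, Φ t x ^ (1 / 2 : ℝ) * G t x ^ (1 / 2 : ℝ)
      * ENNReal.ofReal (aFun m x ^ 2) ≤ L1L2 m T Φ * B := by
  have mA := measurable_area_ofReal hm
  rw [L1L2, ← lintegral_mul_const' _ _ hBt]
  refine setLIntegral_mono' measurableSet_Icc fun t ht => ?_
  have m1 : Measurable (Φ t) := hΦ.comp measurable_prodMk_left
  have m2 : Measurable (G t) := hG.comp measurable_prodMk_left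
  have h := lintegral_sqrt_mul_sqrt_le (μ := volume)
    (f := fun x => Φ t x * ENNReal.ofReal (aFun m x ^ 2))
    (g := fun x => G t x * ENNReal.ofReal (aFun m x ^ 2)) (by fun_prop) (by fun_prop)
  refine le_trans (le_of_eq (lintegral_congr fun x => ?_)) (h.trans (mul_le_mul_right ?_ _))
  · rw [ENNReal.mul_rpow_of_nonneg _ _ (by norm_num : (0 : ℝ) ≤ 1 / 2),
      ENNReal.mul_rpow_of_nonneg _ _ (by norm_num : (0 : ℝ) ≤ 1 / 2)]
    nth_rewrite 1 [← ENNReal.sqrt_mul_self (ENNReal.ofReal (aFun m x ^ 2))]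
    ring
  · calc _ ≤ (B ^ 2) ^ (1 / 2 : ℝ) := ENNReal.rpow_le_rpow (hB t ht) (by norm_num)
      _ = B := by rw [← ENNReal.rpow_natCast, ← ENNReal.rpow_mul]; norm_num

/-- Only x ≠ 0 is required: at x = 0 the weight vanishes, its inverse is 0 by convention, and the
bound on the forcing may fail on this null set. -/
theorem lintegral_le_of_split (hm : 1 ≤ m) {h Φ₁ G₁ Φ₂ G₂ : ℝ → ℝ → ℝ≥0∞}
    (m1 : Measurable fun z : ℝ × ℝ => Φ₁ z.1 z.2) (n1 : Measurable fun z : ℝ × ℝ => G₁ z.1 z.2)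
    (m2 : Measurable fun z : ℝ × ℝ => Φ₂ z.1 z.2) (n2 : Measurable fun z : ℝ × ℝ => G₂ z.1 z.2)
    (hh : ∀ t x, x ≠ 0 → h t x ≤ Φ₁ t x ^ (1 / 2 : ℝ) * G₁ t x ^ (1 / 2 : ℝ)
      + Φ₂ t x ^ (1 / 2 : ℝ) * G₂ t x ^ (1 / 2 : ℝ))
    {B D : ℝ≥0∞} (hBt : B ≠ ⊤)
    (hB : ∀ t ∈ Icc 0 T, ∫⁻ x, G₁ t x * ENNReal.ofReal (aFun m x ^ 2) ≤ B ^ 2)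
    (hD : LE m T G₂ ≤ D) :
    ∫⁻ t in Icc 0 T, ∫⁻ x, h t x * ENNReal.ofReal (aFun m x ^ 2)
      ≤ L1L2 m T Φ₁ * B + LEStar m T Φ₂ * D := by
  have mA : Measurable fun z : ℝ × ℝ => ENNReal.ofReal (aFun m z.2 ^ 2) :=
    (measurable_area_ofReal hm).comp measurable_snd
  have k1 : Measurable fun z : ℝ × ℝ => Φ₁ z.1 z.2 ^ (1 / 2 : ℝ) * G₁ z.1 z.2 ^ (1 / 2 : ℝ)
    * ENNReal.ofReal (aFun m z.2 ^ 2) := by fun_prop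
  refine le_trans ?_ (add_le_add (lintegral_le_L1L2_mul hm m1 n1 hBt hB)
    ((lintegral_le_LEStar_mul_LE hm m2 n2).trans (mul_le_mul_right hD _)))
  rw [← lintegral_add_left (Measurable.lintegral_prod_right' k1)]
  refine lintegral_mono fun t => ?_
  have k2 : Measurable fun x => Φ₁ t x ^ (1 / 2 : ℝ) * G₁ t x ^ (1 / 2 : ℝ)
    * ENNReal.ofReal (aFun m x ^ 2) := k1.comp measurable_prodMk_left
  simp only []
  rw [← lintegral_add_left k2]
  have : ∀ᵐ x : ℝ, x ≠ 0 := by simp [ae_iff]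
  refine lintegral_mono_ae ?_
  filter_upwards [this] with x hx
  rw [← add_mul]
  exact mul_le_mul_left (hh t x hx) _

namespace Moments

variable (S : Moments m T)

theorem work_le_add (hm : 1 ≤ m) : S.work ≤
    (∫⁻ t in Icc 0 T, ∫⁻ x, ENNReal.ofReal |S.Ft t x| * ENNReal.ofReal (aFun m x ^ 2))
    + ((∫⁻ t in Icc 0 T, ∫⁻ x, ENNReal.ofReal |S.Fx t x| * ENNReal.ofReal (aFun m x ^ 2))
    + ∫⁻ t in Icc 0 T, ∫⁻ x, ENNReal.ofReal (|S.Fu t x| / jb x)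
      * ENNReal.ofReal (aFun m x ^ 2)) := by
  have mA : Measurable fun z : ℝ × ℝ => ENNReal.ofReal (aFun m z.2 ^ 2) :=
    (measurable_area_ofReal hm).comp measurable_snd
  have mj := continuous_jb.measurable
  have k1 := S.cFt.measurable
  have k2 := S.cFx.measurable
  have n1 : Measurable fun z : ℝ × ℝ => ENNReal.ofReal |S.Ft z.1 z.2|
    * ENNReal.ofReal (aFun m z.2 ^ 2) := by fun_prop
  have n2 : Measurable fun z : ℝ × ℝ => ENNReal.ofReal |S.Fx z.1 z.2|
    * ENNReal.ofReal (aFun m z.2 ^ 2) := by fun_prop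
  rw [← lintegral_add_left (Measurable.lintegral_prod_right' n2),
    ← lintegral_add_left (Measurable.lintegral_prod_right' n1)]
  refine lintegral_mono fun t => ?_
  have l1 : Measurable fun x => ENNReal.ofReal |S.Ft t x| * ENNReal.ofReal (aFun m x ^ 2) :=
    n1.comp measurable_prodMk_left
  have l2 : Measurable fun x => ENNReal.ofReal |S.Fx t x| * ENNReal.ofReal (aFun m x ^ 2) :=
    n2.comp measurable_prodMk_left
  simp only []
  rw [← lintegral_add_left l2, ← lintegral_add_left l1]
  refine lintegral_mono fun x => ?_
  rw [mul_comm, ENNReal.ofReal_mul' (area_pos m x).le, ← add_mul, ← add_mul]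
  exact mul_le_mul_left (ENNReal.ofReal_add_le.trans (add_le_add le_rfl ENNReal.ofReal_add_le)) _

theorem en_le_lossy {t : ℝ} (ht : t ∈ Icc 0 T) : ENNReal.ofReal 2 * S.en t ≤ S.lossy ^ 2 := by
  have h : (ENNReal.ofReal 2 * S.en t) ^ (1 / 2 : ℝ) ≤ S.lossy := by
    unfold lossy
    simp only [add_assoc]
    exact le_trans (le_iSup₂ (f := fun t (_ : t ∈ Icc 0 T) =>
      (ENNReal.ofReal 2 * S.en t) ^ (1 / 2 : ℝ)) t ht) le_self_add
  calc _ = ((ENNReal.ofReal 2 * S.en t) ^ (1 / 2 : ℝ)) ^ 2 := by rw [sq, ENNReal.sqrt_mul_self]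
    _ ≤ _ := by gcongr

theorem lintegral_le_lossy {t : ℝ} (ht : t ∈ Icc 0 T) {g : ℝ → ℝ}
    (hg : ∀ x, area m x * g x ≤ 2 * S.e t x) :
    ∫⁻ x, ENNReal.ofReal (g x) * ENNReal.ofReal (aFun m x ^ 2) ≤ S.lossy ^ 2 := by
  refine le_trans ?_ (S.en_le_lossy ht)
  rw [en, ← lintegral_const_mul' _ _ ENNReal.ofReal_ne_top]
  refine lintegral_mono fun x => ?_
  rw [mul_comm, ← ENNReal.ofReal_mul (sq_nonneg _), ← ENNReal.ofReal_mul zero_le_two]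
  exact ENNReal.ofReal_le_ofReal (hg x)

theorem lintegral_n_le_lossy (hm : 1 ≤ m) {t : ℝ} (ht : t ∈ Icc 0 T) :
    ∫⁻ x, ENNReal.ofReal (S.n t x / (1 + x ^ 2)) * ENNReal.ofReal (aFun m x ^ 2)
      ≤ (7 * S.lossy) ^ 2 := by
  have h := S.hardy hm ht
  have e1 : ∀ x, ENNReal.ofReal (S.n t x / (1 + x ^ 2)) * ENNReal.ofReal (aFun m x ^ 2)
      = ENNReal.ofReal (area m x * S.n t x / (1 + x ^ 2)) := fun x => by
    rw [mul_comm, ← ENNReal.ofReal_mul (sq_nonneg _), mul_div_assoc]; rfl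
  have e2 : ∀ x, ENNReal.ofReal (area m x * S.q t x)
      = ENNReal.ofReal (S.q t x) * ENNReal.ofReal (aFun m x ^ 2) := fun x => by
    rw [mul_comm, ← ENNReal.ofReal_mul' (sq_nonneg _)]; rfl
  simp_rw [e2] at h
  simp_rw [e1]
  refine h.trans ((mul_le_mul_right (S.lintegral_le_lossy (g := S.q t) ht fun x => ?_) _).trans ?_)
  · have := mul_nonneg (area_pos m x).le (S.p_nonneg t x)
    have := S.r_nonneg t x
    unfold e; linarith
  · rw [mul_pow]
    refine mul_le_mul_left ?_ _
    rw [← ENNReal.ofReal_ofNat, ← ENNReal.ofReal_pow (by norm_num)]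
    exact ENNReal.ofReal_le_ofReal (by norm_num)

theorem LE_q_le_lossy : LE m T (fun t x => ENNReal.ofReal (S.q t x)) ≤ S.lossy := by
  unfold lossy
  exact le_add_right (le_add_right (le_add_right le_add_self))

theorem LE_p_le_lossy : LE m T (fun t x => ENNReal.ofReal (wtSq m x * S.p t x)) ≤ S.lossy := by
  unfold lossy
  exact le_add_right (le_add_right le_add_self)

theorem LE_n_le_lossy : LE m T (fun t x => ENNReal.ofReal (S.n t x / (1 + x ^ 2))) ≤ S.lossy := by
  unfold lossy
  exact le_add_self

theorem measurable_p : Measurable fun z : ℝ × ℝ => ENNReal.ofReal (S.p z.1 z.2) :=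
  S.cp.measurable.ennreal_ofReal

theorem measurable_q : Measurable fun z : ℝ × ℝ => ENNReal.ofReal (S.q z.1 z.2) :=
  S.cq.measurable.ennreal_ofReal

theorem measurable_wtSq_p :
    Measurable fun z : ℝ × ℝ => ENNReal.ofReal (wtSq m z.2 * S.p z.1 z.2) :=
  ((continuous_wtSq m).measurable.comp measurable_snd).mul S.cp.measurable |>.ennreal_ofReal

theorem measurable_n :
    Measurable fun z : ℝ × ℝ => ENNReal.ofReal (S.n z.1 z.2 / (1 + z.2 ^ 2)) := by
  have := S.cn.measurable
  fun_prop

theorem sqrt_mul_div_jb_le {a : ℝ} {Φ : ℝ≥0∞} {n x : ℝ} (h : ENNReal.ofReal |a|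
    ≤ Φ ^ (1 / 2 : ℝ) * ENNReal.ofReal n ^ (1 / 2 : ℝ)) : ENNReal.ofReal (|a| / jb x)
      ≤ Φ ^ (1 / 2 : ℝ) * ENNReal.ofReal (n / (1 + x ^ 2)) ^ (1 / 2 : ℝ) := by
  have J := jb_pos x
  rw [ENNReal.ofReal_div_of_pos J, ENNReal.ofReal_div_of_pos (by positivity), ← jb_sq,
    ENNReal.div_rpow_of_nonneg _ _ (by norm_num), ENNReal.ofReal_pow J.le,
    ← ENNReal.rpow_natCast (ENNReal.ofReal (jb x)), ← ENNReal.rpow_mul]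
  norm_num
  rw [← mul_div_assoc]
  exact ENNReal.div_le_div_right (by simpa using h) _

/-- The work of a forcing in the sum space. -/
theorem work_le_of_split (hm : 1 ≤ m) {Φ₁ Φ₂ : ℝ → ℝ → ℝ≥0∞}
    (m1 : Measurable fun z : ℝ × ℝ => Φ₁ z.1 z.2) (m2 : Measurable fun z : ℝ × ℝ => Φ₂ z.1 z.2)
    (hs : S.lossy ≠ ⊤)
    (ht : ∀ t x, x ≠ 0 → ENNReal.ofReal |S.Ft t x|
      ≤ Φ₁ t x ^ (1 / 2 : ℝ) * ENNReal.ofReal (S.p t x) ^ (1 / 2 : ℝ)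
        + Φ₂ t x ^ (1 / 2 : ℝ) * ENNReal.ofReal (wtSq m x * S.p t x) ^ (1 / 2 : ℝ))
    (hx : ∀ t x, x ≠ 0 → ENNReal.ofReal |S.Fx t x|
      ≤ (Φ₁ t x ^ (1 / 2 : ℝ) + Φ₂ t x ^ (1 / 2 : ℝ)) * ENNReal.ofReal (S.q t x) ^ (1 / 2 : ℝ))
    (hu : ∀ t x, x ≠ 0 → ENNReal.ofReal |S.Fu t x|
      ≤ (Φ₁ t x ^ (1 / 2 : ℝ) + Φ₂ t x ^ (1 / 2 : ℝ)) * ENNReal.ofReal (S.n t x) ^ (1 / 2 : ℝ)) :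
    S.work ≤ 9 * (L1L2 m T Φ₁ + LEStar m T Φ₂) * S.lossy := by
  have w1 := lintegral_le_of_split (T := T) hm m1 S.measurable_p m2 S.measurable_wtSq_p ht hs
    (fun t h => S.lintegral_le_lossy (g := S.p t) h fun x => by
      have := mul_nonneg (area_pos m x).le (S.q_nonneg t x)
      have := S.r_nonneg t x
      unfold e; linarith) S.LE_p_le_lossy
  have w2 := lintegral_le_of_split (T := T) hm (h := fun t x => ENNReal.ofReal |S.Fx t x|)
    m1 S.measurable_q m2 S.measurable_q
    (fun t x h => by rw [← add_mul]; exact hx t x h) hs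
    (fun t h => S.lintegral_le_lossy (g := S.q t) h fun x => by
      have := mul_nonneg (area_pos m x).le (S.p_nonneg t x)
      have := S.r_nonneg t x
      unfold e; linarith) S.LE_q_le_lossy
  have w3 := lintegral_le_of_split (T := T) hm (h := fun t x => ENNReal.ofReal (|S.Fu t x| / jb x))
    m1 S.measurable_n m2 S.measurable_n
    (fun t x h => by
      have e : ∀ y : ℝ≥0∞, y = (y ^ 2) ^ (1 / 2 : ℝ) := fun y => by
        rw [← ENNReal.rpow_natCast, ← ENNReal.rpow_mul]; norm_num
      rw [← add_mul]
      have := hu t x h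
      rw [e (Φ₁ t x ^ (1 / 2 : ℝ) + Φ₂ t x ^ (1 / 2 : ℝ))] at this ⊢
      exact sqrt_mul_div_jb_le this)
    (ENNReal.mul_ne_top (by norm_num) hs) (fun t h => S.lintegral_n_le_lossy hm h) S.LE_n_le_lossy
  refine (S.work_le_add hm).trans ((add_le_add w1 (add_le_add w2 w3)).trans ?_)
  -- 9 = 1 + 1 + 7 for the pairings with ∂_t u, ∂_x u and u, the 7 because Hardy's constant
  -- satisfies 48 ≤ 7². The LE* parts need only 3.
  calc _ = 9 * L1L2 m T Φ₁ * S.lossy + 3 * LEStar m T Φ₂ * S.lossy := by ring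
    _ ≤ 9 * L1L2 m T Φ₁ * S.lossy + 9 * LEStar m T Φ₂ * S.lossy := by gcongr; norm_num
    _ = _ := by ring

/-- The work of a forcing, with a loss of angular regularity. -/
theorem work_le_of_loss (hm : 1 ≤ m) {Φ Ψ Θ : ℝ → ℝ → ℝ≥0∞}
    (m1 : Measurable fun z : ℝ × ℝ => Φ z.1 z.2) (m2 : Measurable fun z : ℝ × ℝ => Ψ z.1 z.2)
    (m3 : Measurable fun z : ℝ × ℝ => Θ z.1 z.2)
    (ht : ∀ t x, ENNReal.ofReal |S.Ft t x| ≤ Ψ t x ^ (1 / 2 : ℝ) * Θ t x ^ (1 / 2 : ℝ))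
    (hx : ∀ t x, ENNReal.ofReal |S.Fx t x|
      ≤ Φ t x ^ (1 / 2 : ℝ) * ENNReal.ofReal (S.q t x) ^ (1 / 2 : ℝ))
    (hu : ∀ t x, ENNReal.ofReal |S.Fu t x|
      ≤ Φ t x ^ (1 / 2 : ℝ) * ENNReal.ofReal (S.n t x) ^ (1 / 2 : ℝ)) :
    S.work ≤ LEStar m T Ψ * LE m T Θ + 2 * LEStar m T Φ * S.lossy := by
  -- Only the pairing with ∂_t u uses Ψ and Θ; ∂_x u and ⟨x⟩⁻¹u are controlled by `lossy` without
  -- the degenerate weight.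
  have w1 := (lintegral_mono fun t => lintegral_mono fun x => mul_le_mul_left (ht t x)
    (ENNReal.ofReal (aFun m x ^ 2))).trans (lintegral_le_LEStar_mul_LE (T := T) hm m2 m3)
  have w2 := ((lintegral_mono fun t => lintegral_mono fun x => mul_le_mul_left (hx t x)
    (ENNReal.ofReal (aFun m x ^ 2))).trans (lintegral_le_LEStar_mul_LE (T := T) hm m1
      S.measurable_q)).trans (mul_le_mul_right S.LE_q_le_lossy _)
  have w3 := ((lintegral_mono fun t => lintegral_mono fun x =>
    mul_le_mul_left (sqrt_mul_div_jb_le (x := x) (hu t x))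
    (ENNReal.ofReal (aFun m x ^ 2))).trans (lintegral_le_LEStar_mul_LE (T := T) hm m1
      S.measurable_n)).trans (mul_le_mul_right S.LE_n_le_lossy _)
  refine (S.work_le_add hm).trans ((add_le_add w1 (add_le_add w2 w3)).trans (le_of_eq ?_))
  ring

end Moments

/-- Square, absorb b s, and split the root of a + d. The term d keeps its square root: in the second
estimate it is the product of the two angular norms. -/
theorem ENNReal.le_of_le_sqrt {C : ℝ≥0} {s a b d : ℝ≥0∞} (hs : s ≠ ⊤)
    (h : s ≤ C * (a + (d + b * s)) ^ (1 / 2 : ℝ)) :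
    s ≤ (C + C ^ 2 : ℝ≥0) * (a ^ (1 / 2 : ℝ) + d ^ (1 / 2 : ℝ) + b) := by
  have h2 : s ^ 2 ≤ (C * (a + d) ^ (1 / 2 : ℝ)) ^ 2 + C ^ 2 * b * s := by
    calc s ^ 2 ≤ (C * (a + (d + b * s)) ^ (1 / 2 : ℝ)) ^ 2 := by gcongr
      _ = C ^ 2 * (a + (d + b * s)) := by
        rw [mul_pow, sq ((a + (d + b * s)) ^ (1 / 2 : ℝ)), ENNReal.sqrt_mul_self]
      _ = C ^ 2 * (a + d) + C ^ 2 * b * s := by ring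
      _ = _ := by rw [mul_pow, sq ((a + d) ^ (1 / 2 : ℝ)), ENNReal.sqrt_mul_self]
  refine (ENNReal.le_add_of_sq_le hs h2).trans ?_
  have h3 : (a + d) ^ (1 / 2 : ℝ) ≤ a ^ (1 / 2 : ℝ) + d ^ (1 / 2 : ℝ) :=
    ENNReal.rpow_add_le_add_rpow _ _ (by norm_num) (by norm_num)
  calc C * (a + d) ^ (1 / 2 : ℝ) + C ^ 2 * b
      ≤ C * (a ^ (1 / 2 : ℝ) + d ^ (1 / 2 : ℝ)) + C ^ 2 * b := by gcongr
    _ ≤ C * (a ^ (1 / 2 : ℝ) + d ^ (1 / 2 : ℝ)) + C ^ 2 * b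
        + (C ^ 2 * (a ^ (1 / 2 : ℝ) + d ^ (1 / 2 : ℝ)) + C * b) := le_self_add
    _ = _ := by push_cast; ring

end

/-! ### Calculus of homogeneous functions on `ℝ³ ∖ {0}` -/

/-- The partial derivatives of a function on `ℝ³`. -/
def pd (i : Fin 3) (f : E3 → ℝ) (y : E3) : ℝ := fderiv ℝ f y (EuclideanSpace.single i 1)

theorem isOpen_punctured : IsOpen ({0}ᶜ : Set E3) := isOpen_compl_singleton

theorem sum_coord_smul (y : E3) : ∑ i, y i • (EuclideanSpace.single i 1 : E3) = y := by
  simpa using (EuclideanSpace.basisFun (Fin 3) ℝ).sum_repr y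

theorem sum_coord_mul_pd (f : E3 → ℝ) (y : E3) : ∑ i, y i * pd i f y = fderiv ℝ f y y := by
  calc _ = fderiv ℝ f y (∑ i, y i • (EuclideanSpace.single i 1 : E3)) := by
        simp only [map_sum, map_smul, smul_eq_mul, pd]
    _ = _ := by rw [sum_coord_smul]

theorem fderiv_smul_of_homogeneous {f : E3 → ℝ} {a c : ℝ} (h : ∀ y, f (c • y) = a * f y) (y : E3) :
    c • fderiv ℝ f (c • y) = a • fderiv ℝ f y := by
  have e : (fun y => f (c • y)) = fun y => a • f y := funext h
  rw [← fderiv_comp_smul, e]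
  exact congrFun (fderiv_const_smul_field (𝕜 := ℝ) (f := f) a) y

theorem pd_smul_of_homogeneous {f : E3 → ℝ} {a c : ℝ} (hc : c ≠ 0) (h : ∀ y, f (c • y) = a * f y)
    (i : Fin 3) (y : E3) : pd i f (c • y) = a / c * pd i f y := by
  have := congrArg (fun L => L (EuclideanSpace.single i 1))
    (fderiv_smul_of_homogeneous h y)
  simp only [smul_apply, smul_eq_mul] at this
  unfold pd
  field_simp
  linarith

/-- Euler's identity. -/
theorem fderiv_self_of_homogeneous {f : E3 → ℝ} {y : E3} (hf : DifferentiableAt ℝ f y) {k : ℕ}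
    (h : ∀ c : ℝ, 0 < c → f (c • y) = c ^ k * f y) : fderiv ℝ f y y = k * f y := by
  have h1 : HasDerivAt (fun c : ℝ => f (c • y)) (fderiv ℝ f y y) 1 := by
    have e : HasDerivAt (fun c : ℝ => c • y) y 1 := by
      simpa using (hasDerivAt_id (1 : ℝ)).smul_const y
    have hf' : HasFDerivAt f (fderiv ℝ f y) ((1 : ℝ) • y) := by
      rw [one_smul]; exact hf.hasFDerivAt
    exact hf'.comp_hasDerivAt (1 : ℝ) e
  have h2 : HasDerivAt (fun c : ℝ => f (c • y)) (k * f y) 1 := by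
    have := (hasDerivAt_pow k (1 : ℝ)).mul_const (f y)
    simp only [one_pow, mul_one] at this
    refine this.congr_of_eventuallyEq ?_
    filter_upwards [Ioi_mem_nhds (zero_lt_one (α := ℝ))] with c hc
    exact h c hc
  exact h1.unique h2

theorem integral_divergence {G : Fin 3 → E3 → ℝ} (hG : ∀ i, ContDiff ℝ 1 (G i))
    (hs : ∀ i, HasCompactSupport (G i)) : ∫ y, ∑ i, pd i (G i) y = 0 := by
  have c1 : ∀ i, Continuous fun y => pd i (G i) y := fun i =>
    ((hG i).continuous_fderiv (by norm_num)).clm_apply continuous_const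
  have s1 : ∀ i, HasCompactSupport fun y => pd i (G i) y := fun i =>
    (hs i).fderiv_apply (𝕜 := ℝ) _
  have i1 : ∀ i, Integrable fun y => pd i (G i) y := fun i =>
    (c1 i).integrable_of_hasCompactSupport (s1 i)
  rw [integral_finsetSum _ fun i _ => i1 i]
  refine Finset.sum_eq_zero fun i _ => ?_
  have := integral_mul_fderiv_eq_neg_fderiv_mul_of_integrable (μ := (volume : Measure E3))
    (f := fun _ => (1 : ℝ)) (g := G i) (v := EuclideanSpace.single i 1)
    (by simp) (by simp only [one_mul]; exact i1 i)
    (by simpa using (hG i).continuous.integrable_of_hasCompactSupport (hs i))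
    (fun _ _ => by fun_prop) (fun x _ => (hG i).differentiable (by norm_num) x)
  simpa [pd] using this

instance : IsFiniteMeasure sphMeas := by unfold sphMeas; infer_instance

/-- Integration in polar coordinates of a function that is homogeneous of degree `-2`. -/
theorem integral_radial_mul {h : E3 → ℝ} (hh : ∀ c : ℝ, 0 < c → ∀ y, h (c • y) = (c ^ 2)⁻¹ * h y)
    (χ : ℝ → ℝ) :
    ∫ y, χ ‖y‖ * h y = (∫ θ : S2, h θ ∂sphMeas)
      * ∫ r : Ioi (0 : ℝ), χ r * ((r : ℝ) ^ 2)⁻¹ ∂(Measure.volumeIoiPow 2) := by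
  have mp := (volume : Measure E3).measurePreserving_homeomorphUnitSphereProd
  have hd : Module.finrank ℝ E3 - 1 = 2 := by simp
  rw [hd] at mp
  calc ∫ y, χ ‖y‖ * h y = ∫ y in ({0}ᶜ : Set E3), χ ‖y‖ * h y := by rw [restrict_compl_singleton]
    _ = ∫ y : ({0}ᶜ : Set E3), χ ‖(y : E3)‖ * h y ∂(volume.comap Subtype.val) :=
        (integral_subtype_comap (measurableSet_singleton (0 : E3)).compl
          fun y => χ ‖y‖ * h y).symm
    _ = ∫ y : ({0}ᶜ : Set E3), (fun z : S2 × Ioi (0 : ℝ) => h z.1 * (χ z.2 * ((z.2 : ℝ) ^ 2)⁻¹))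
          (homeomorphUnitSphereProd E3 y) ∂(volume.comap Subtype.val) := by
        refine integral_congr_ae (Filter.Eventually.of_forall fun y => ?_)
        have hy : (0 : ℝ) < ‖(y : E3)‖ := norm_pos_iff.2 y.2
        have e1 : h (‖(y : E3)‖⁻¹ • (y : E3)) = ‖(y : E3)‖ ^ 2 * h y := by
          rw [hh _ (inv_pos.2 hy)]; simp
        simp only [homeomorphUnitSphereProd_apply_fst_coe,
          homeomorphUnitSphereProd_apply_snd_coe, e1]
        field_simp
    _ = ∫ z, h (z.1 : S2) * (χ z.2 * ((z.2 : ℝ) ^ 2)⁻¹)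
          ∂(sphMeas.prod (Measure.volumeIoiPow 2)) :=
        mp.integral_comp (Homeomorph.measurableEmbedding _)
          fun z : S2 × Ioi (0 : ℝ) => h z.1 * (χ z.2 * ((z.2 : ℝ) ^ 2)⁻¹)
    _ = _ := integral_prod_mul (fun θ : S2 => h θ) fun r : Ioi (0 : ℝ) => χ r * ((r : ℝ) ^ 2)⁻¹

/-- Applying the polar formula to |y|⁻² shows that this radial factor times the area of the sphere
is ∫ b(|y|²) dy > 0. -/
theorem integral_radial_bump_ne_zero (b : ContDiffBump (1 : ℝ)) :
    ∫ r : Ioi (0 : ℝ), (r : ℝ) ^ 2 * b ((r : ℝ) ^ 2) * ((r : ℝ) ^ 2)⁻¹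
      ∂(Measure.volumeIoiPow 2) ≠ 0 := by
  intro h0
  have h1 := integral_radial_mul (h := fun y => (‖y‖ ^ 2)⁻¹) (fun c hc y => by
    rw [norm_smul, mul_pow, mul_inv, Real.norm_eq_abs, sq_abs]) (fun r => r ^ 2 * b (r ^ 2))
  rw [h0, mul_zero] at h1
  have cb : Continuous fun y : E3 => b (‖y‖ ^ 2) := b.continuous.comp (by fun_prop)
  have h2 : ∫ y : E3, ‖y‖ ^ 2 * b (‖y‖ ^ 2) * (‖y‖ ^ 2)⁻¹ = ∫ y : E3, b (‖y‖ ^ 2) := by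
    refine integral_congr_ae ?_
    have : ∀ᵐ y : E3, y ≠ 0 := by simp [ae_iff]
    filter_upwards [this] with y hy
    have := norm_ne_zero_iff.2 hy
    field_simp
  have h3 : 0 < ∫ y : E3, b (‖y‖ ^ 2) := by
    refine cb.integral_pos_of_hasCompactSupport_nonneg_nonzero
      (HasCompactSupport.intro (isCompact_closedBall (0 : E3) (1 + b.rOut + 1)) fun y hy => ?_)
      (fun y => b.nonneg) (x := EuclideanSpace.single 0 1) ?_
    · rw [mem_closedBall_zero_iff, not_le] at hy
      have := b.rOut_pos
      refine b.zero_of_le_dist ?_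
      rw [Real.dist_eq, abs_of_nonneg] <;> nlinarith
    · have := b.one_of_mem_closedBall (Metric.mem_closedBall_self b.rIn_pos.le)
      simp [this]
  rw [← h2, h1] at h3
  exact lt_irrefl _ h3

/-- Green's identity on the sphere, for functions extended to be homogeneous of degree `0`. -/
theorem integral_sphere_green {v w : E3 → ℝ} (hv : ContDiffOn ℝ 1 v {0}ᶜ)
    (hw : ContDiffOn ℝ 2 w {0}ᶜ) (v0 : ∀ c : ℝ, 0 < c → ∀ y, v (c • y) = v y)
    (w0 : ∀ c : ℝ, 0 < c → ∀ y, w (c • y) = w y) :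
    ∫ θ : S2, (v θ * ∑ i, pd i (pd i w) θ + ∑ i, pd i v θ * pd i w θ) ∂sphMeas = 0 := by
  have hvA : ∀ y, y ≠ 0 → ContDiffAt ℝ 1 v y := fun y hy =>
    hv.contDiffAt (isOpen_punctured.mem_nhds hy)
  have hwA : ∀ y, y ≠ 0 → ContDiffAt ℝ 2 w y := fun y hy =>
    hw.contDiffAt (isOpen_punctured.mem_nhds hy)
  have hpA : ∀ i y, y ≠ 0 → ContDiffAt ℝ 1 (pd i w) y := fun i y hy =>
    ((hwA y hy).fderiv_right (m := 1) (by norm_num)).clm_apply contDiffAt_const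
  -- The cutoff ψ = β(|y|²) vanishes near the origin, where v and w may be singular, and for large
  -- |y|. The extra factor s in β cancels the homogeneity -2 of `h` in the radial integral.
  let b : ContDiffBump (1 : ℝ) := ⟨1 / 4, 1 / 2, by norm_num, by norm_num⟩
  set β : ℝ → ℝ := fun s => s * b s with hβ
  have βs : ContDiff ℝ 1 β := contDiff_id.mul b.contDiff
  set ψ : E3 → ℝ := fun y => β (‖y‖ ^ 2) with hψ
  have ψs : ContDiff ℝ 1 ψ := βs.comp (contDiff_norm_sq ℝ)
  have ψz : ∀ y : E3, y ∉ Metric.closedBall 0 2 ∨ ‖y‖ ^ 2 < 1 / 2 → ψ y = 0 := by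
    intro y hy
    refine mul_eq_zero_of_right _ (b.zero_of_le_dist ?_)
    change 1 / 2 ≤ dist _ _
    rw [Real.dist_eq]
    rcases hy with hy | hy
    · rw [mem_closedBall_zero_iff, not_le] at hy
      rw [abs_of_nonneg] <;> nlinarith
    · rw [abs_of_nonpos] <;> linarith
  have near0 : ∀ᶠ y : E3 in nhds 0, ψ y = 0 := by
    have : IsOpen {y : E3 | ‖y‖ ^ 2 < 1 / 2} := isOpen_lt (by fun_prop) continuous_const
    filter_upwards [this.mem_nhds (by simp)] with y hy
    exact ψz y (Or.inr hy)
  set G : Fin 3 → E3 → ℝ := fun i y => ψ y * v y * pd i w y with hG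
  have cG : ∀ i, ContDiff ℝ 1 (G i) := by
    intro i
    rw [contDiff_iff_contDiffAt]
    intro y
    rcases eq_or_ne y 0 with rfl | hy
    · refine (contDiffAt_const (c := (0 : ℝ))).congr_of_eventuallyEq ?_
      filter_upwards [near0] with y hy
      simp [hG, hy]
    · exact (ψs.contDiffAt.mul (hvA y hy)).mul (hpA i y hy)
  have sG : ∀ i, HasCompactSupport (G i) := fun i => by
    refine HasCompactSupport.intro (isCompact_closedBall (0 : E3) 2) fun y hy => ?_
    simp [hG, ψz y (Or.inl hy)]
  have hdiv := integral_divergence cG sG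
  set h : E3 → ℝ := fun y => v y * ∑ i, pd i (pd i w) y + ∑ i, pd i v y * pd i w y with hh
  have e1 : ∀ y, ∑ i, pd i (G i) y = β (‖y‖ ^ 2) * h y := by
    intro y
    rcases eq_or_ne y 0 with rfl | hy
    · have z1 : ∀ i, pd i (G i) 0 = 0 := fun i => by
        have : G i =ᶠ[nhds 0] fun _ => 0 := by
          filter_upwards [near0] with y hy
          simp [hG, hy]
        rw [pd, this.fderiv_eq]
        simp
      have z2 : β (‖(0 : E3)‖ ^ 2) = 0 := near0.self_of_nhds
      rw [z2, zero_mul]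
      exact Finset.sum_eq_zero fun i _ => z1 i
    · have dv := (hvA y hy).differentiableAt (by norm_num)
      have dψ := ψs.contDiffAt.differentiableAt (x := y) (by norm_num)
      have dp := fun i => (hpA i y hy).differentiableAt (by norm_num)
      have d1 : ∀ i, pd i (G i) y = ψ y * (v y * pd i (pd i w) y + pd i v y * pd i w y)
          + v y * (pd i ψ y * pd i w y) := by
        intro i
        have : fderiv ℝ (G i) y = _ := (((dψ.hasFDerivAt.fun_mul dv.hasFDerivAt).fun_mul
          (dp i).hasFDerivAt)).fderiv
        simp only [pd, this]
        simp
        ring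
      have d2 : ∀ i, pd i ψ y = 2 * deriv β (‖y‖ ^ 2) * y i := by
        intro i
        have hb : HasDerivAt β (deriv β (‖y‖ ^ 2)) (‖y‖ ^ 2) :=
          (βs.differentiable (by norm_num) _).hasDerivAt
        have := (hb.comp_hasFDerivAt y (hasStrictFDerivAt_norm_sq y).hasFDerivAt).fderiv
        have e : ψ = β ∘ fun y => ‖y‖ ^ 2 := rfl
        rw [pd, e, this]
        simp [EuclideanSpace.inner_single_right]
        ring
      -- By Euler's identity ∇w is tangential, whereas ∇ψ is radial, so the cutoff contributes no
      -- term.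
      have eu : ∑ i, y i * pd i w y = 0 := by
        rw [sum_coord_mul_pd, fderiv_self_of_homogeneous (k := 0)
          ((hwA y hy).differentiableAt (by norm_num)) fun c hc => by simp [w0 c hc]]
        simp
      simp_rw [d1, d2]
      rw [Finset.sum_add_distrib, ← Finset.mul_sum, ← Finset.mul_sum, Finset.sum_add_distrib,
        ← Finset.mul_sum]
      have : ∑ i, 2 * deriv β (‖y‖ ^ 2) * y i * pd i w y = 0 := by
        simp_rw [mul_assoc]
        rw [← Finset.mul_sum, ← Finset.mul_sum, eu]
        simp
      rw [this, mul_zero, add_zero]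
  simp_rw [e1] at hdiv
  have hom : ∀ c : ℝ, 0 < c → ∀ y, h (c • y) = (c ^ 2)⁻¹ * h y := by
    intro c hc y
    have q1 : ∀ i y, pd i w (c • y) = 1 / c * pd i w y := fun i y =>
      pd_smul_of_homogeneous hc.ne' (fun y => by rw [w0 c hc, one_mul]) i y
    have q2 : ∀ i y, pd i v (c • y) = 1 / c * pd i v y := fun i y =>
      pd_smul_of_homogeneous hc.ne' (fun y => by rw [v0 c hc, one_mul]) i y
    have q3 : ∀ i y, pd i (pd i w) (c • y) = 1 / c / c * pd i (pd i w) y := fun i y =>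
      pd_smul_of_homogeneous hc.ne' (q1 i) i y
    simp only [hh, q1, q2, q3, v0 c hc]
    rw [← Finset.mul_sum, mul_add, Finset.mul_sum (a := (c ^ 2)⁻¹)]
    congr 1
    · ring
    · exact Finset.sum_congr rfl fun i _ => by ring
  -- In polar coordinates the vanishing integral is the spherical integral times a radial factor,
  -- which is not zero.
  rw [integral_radial_mul hom (fun r => β (r ^ 2))] at hdiv
  refine (mul_eq_zero.1 hdiv).resolve_right (integral_radial_bump_ne_zero b)

/-! ### Smoothness of radial extensions -/

theorem radialExt_coe (f : S2 → ℝ) (θ : S2) : radialExt f θ = f θ := by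
  have h1 : ‖(θ : E3)‖ = 1 := by simp
  have h0 : (θ : E3) ≠ 0 := by
    rw [← norm_ne_zero_iff, h1]; exact one_ne_zero
  rw [radialExt, dif_pos h0]
  congr 1
  ext1
  simp [h1]

theorem radialExt_smul (f : S2 → ℝ) {c : ℝ} (hc : 0 < c) (y : E3) :
    radialExt f (c • y) = radialExt f y := by
  rcases eq_or_ne y 0 with rfl | hy
  · rw [smul_zero]
  · have hcy : c • y ≠ 0 := smul_ne_zero hc.ne' hy
    rw [radialExt, radialExt, dif_pos hy, dif_pos hcy]
    congr 1
    ext1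
    have : ‖y‖ ≠ 0 := norm_ne_zero_iff.2 hy
    simp only [norm_smul, Real.norm_of_nonneg hc.le, smul_smul]
    congr 1
    field_simp

/-- The map y/|y| is singular at the origin. Near y₀ it agrees with the normalization of y₀ + b(y)(y
- y₀), which is smooth everywhere and stays within |y₀|/2 of y₀. One such map serves all f at once.
-/
theorem exists_contMDiff_normalize {y₀ : E3} (hy₀ : y₀ ≠ 0) :
    ∃ g : E3 → S2, ContMDiff 𝓘(ℝ, E3) (𝓡 2) ∞ g ∧
      ∀ᶠ y in nhds y₀, ∀ f : S2 → ℝ, radialExt f y = f (g y) := by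
  have hn : 0 < ‖y₀‖ := norm_pos_iff.2 hy₀
  let b : ContDiffBump y₀ := ⟨‖y₀‖ / 4, ‖y₀‖ / 2, by positivity, by linarith⟩
  set w : E3 → E3 := fun y => y₀ + b y • (y - y₀) with hw
  have w0 : ∀ y, w y ≠ 0 := by
    intro y h
    have h1 : ‖b y • (y - y₀)‖ ≤ ‖y₀‖ / 2 := by
      rw [norm_smul, Real.norm_of_nonneg b.nonneg]
      by_cases hy : ‖y₀‖ / 2 ≤ dist y y₀
      · rw [b.zero_of_le_dist hy, zero_mul]; positivity
      · rw [not_le, dist_eq_norm] at hy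
        calc b y * ‖y - y₀‖ ≤ 1 * ‖y - y₀‖ := by gcongr; exact b.le_one
          _ ≤ _ := by linarith
    have h2 : y₀ = -(b y • (y - y₀)) := eq_neg_of_add_eq_zero_left h
    have h3 : ‖y₀‖ = ‖b y • (y - y₀)‖ := by
      conv_lhs => rw [h2]
      rw [norm_neg]
    linarith
  have ws : ContDiff ℝ ∞ w := contDiff_const.add (b.contDiff.smul (contDiff_id.sub contDiff_const))
  have ns : ContDiff ℝ ∞ fun y => ‖w y‖⁻¹ • w y :=
    ((ws.norm ℝ w0).inv fun y => norm_ne_zero_iff.2 (w0 y)).smul ws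
  have hmem : ∀ y, ‖w y‖⁻¹ • w y ∈ Metric.sphere (0 : E3) 1 := fun y => normalize_mem (w0 y)
  refine ⟨_, ns.contMDiff.codRestrict_sphere hmem, ?_⟩
  filter_upwards [b.eventuallyEq_one, isOpen_punctured.mem_nhds hy₀] with y hy hy0 f
  have hy0' : y ≠ 0 := hy0
  have e : w y = y := by
    simp only [Pi.one_apply] at hy
    simp [hw, hy]
  rw [radialExt, dif_pos hy0']
  congr 1
  ext1
  simp [e]

theorem contDiffOn_radialExt {n : WithTop ℕ∞} (hn : n ≤ ((⊤ : ℕ∞) : WithTop ℕ∞)) {f : S2 → ℝ}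
    (hf : ContMDiff (𝓡 2) 𝓘(ℝ, ℝ) n f) : ContDiffOn ℝ n (radialExt f) {0}ᶜ := by
  intro y₀ hy₀
  obtain ⟨g, hg, he⟩ := exists_contMDiff_normalize hy₀
  have h1 : ContDiff ℝ n fun y => f (g y) := (hf.comp (hg.of_le hn)).contDiff
  refine (h1.contDiffAt.congr_of_eventuallyEq ?_).contDiffWithinAt
  filter_upwards [he] with y hy
  exact hy f

/-- Space-time functions, extended to `ℝ × ℝ × (ℝ³ ∖ {0})`. -/
def stExt (u : ℝ → ℝ → S2 → ℝ) (w : ℝ × ℝ × E3) : ℝ := radialExt (u w.1 w.2.1) w.2.2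

theorem contDiffAt_stExt {n : WithTop ℕ∞} (hn : n ≤ ((⊤ : ℕ∞) : WithTop ℕ∞)) {u : ℝ → ℝ → S2 → ℝ}
    (hu : ContMDiff (𝓘(ℝ, ℝ).prod (𝓘(ℝ, ℝ).prod (𝓡 2))) 𝓘(ℝ, ℝ) n
      (fun p : ℝ × ℝ × S2 => u p.1 p.2.1 p.2.2)) {w : ℝ × ℝ × E3} (hw : w.2.2 ≠ 0) :
    ContDiffAt ℝ n (stExt u) w := by
  obtain ⟨g, hg, he⟩ := exists_contMDiff_normalize hw
  have h1 : ContMDiff 𝓘(ℝ, ℝ × ℝ × E3) (𝓘(ℝ, ℝ).prod (𝓘(ℝ, ℝ).prod (𝓡 2))) n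
      fun w : ℝ × ℝ × E3 => (w.1, w.2.1, g w.2.2) := by
    have a1 : ContDiff ℝ n fun w : ℝ × ℝ × E3 => w.1 := contDiff_fst
    have a2 : ContDiff ℝ n fun w : ℝ × ℝ × E3 => w.2.1 := contDiff_fst.comp contDiff_snd
    have a3 : ContDiff ℝ n fun w : ℝ × ℝ × E3 => w.2.2 := contDiff_snd.comp contDiff_snd
    exact a1.contMDiff.prodMk (a2.contMDiff.prodMk ((hg.of_le hn).comp a3.contMDiff))
  have h2 : ContDiff ℝ n fun w : ℝ × ℝ × E3 => u w.1 w.2.1 (g w.2.2) :=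
    (hu.comp h1).contDiff
  refine h2.contDiffAt.congr_of_eventuallyEq ?_
  have : Filter.Tendsto (fun w : ℝ × ℝ × E3 => w.2.2) (nhds w) (nhds w.2.2) :=
    (continuous_snd.comp continuous_snd).tendsto w
  filter_upwards [this.eventually he] with w hw
  exact hw _

/-! ### Derivatives on space-time -/

/-- The derivative of a function in a fixed direction. -/
def dd (e : ℝ × ℝ × E3) (g : ℝ × ℝ × E3 → ℝ) (w : ℝ × ℝ × E3) : ℝ := fderiv ℝ g w e

/-- The time direction. -/
def dirT : ℝ × ℝ × E3 := (1, 0, 0)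

/-- The radial direction. -/
def dirX : ℝ × ℝ × E3 := (0, 1, 0)

/-- The angular directions. -/
def dirY (i : Fin 3) : ℝ × ℝ × E3 := (0, 0, EuclideanSpace.single i 1)

/-- The domain `y ≠ 0`. -/
def awayAxis : Set (ℝ × ℝ × E3) := {w | w.2.2 ≠ 0}

theorem isOpen_awayAxis : IsOpen awayAxis :=
  isOpen_ne.preimage (continuous_snd.comp continuous_snd)

variable {g : ℝ × ℝ × E3 → ℝ}

theorem contDiffOn_dd {n k : ℕ} (hg : ContDiffOn ℝ n g awayAxis) (hk : k + 1 = n)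
    (e : ℝ × ℝ × E3) : ContDiffOn ℝ k (dd e g) awayAxis := by
  have := hg.fderiv_of_isOpen (m := (k : WithTop ℕ∞)) isOpen_awayAxis (by
    rw [← hk]; push_cast; exact le_rfl)
  exact this.clm_apply contDiffOn_const

theorem differentiableAt_of_contDiffOn {n : ℕ} (hg : ContDiffOn ℝ n g awayAxis) (hn : n ≠ 0)
    {w : ℝ × ℝ × E3} (hw : w ∈ awayAxis) : DifferentiableAt ℝ g w :=
  (hg.contDiffAt (isOpen_awayAxis.mem_nhds hw)).differentiableAt (by exact_mod_cast hn)

theorem dd_comm (hg : ContDiffOn ℝ 2 g awayAxis) (e e' : ℝ × ℝ × E3) {w : ℝ × ℝ × E3}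
    (hw : w ∈ awayAxis) : dd e (dd e' g) w = dd e' (dd e g) w := by
  have hA := hg.contDiffAt (isOpen_awayAxis.mem_nhds hw)
  have hd : DifferentiableAt ℝ (fderiv ℝ g) w :=
    (hA.fderiv_right (m := 1) (by norm_num)).differentiableAt (by norm_num)
  have hs := hA.isSymmSndFDerivAt (by simp)
  have key : ∀ e e' : ℝ × ℝ × E3, dd e (dd e' g) w = fderiv ℝ (fderiv ℝ g) w e e' := by
    intro e e'
    have : fderiv ℝ (fun w => fderiv ℝ g w e') w = _ :=
      (hd.hasFDerivAt.clm_apply (hasFDerivAt_const e' w)).fderiv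
    unfold dd
    rw [this]
    simp
  rw [key, key]
  exact hs e e'

theorem hasDerivAt_slice_t {t x : ℝ} {y : E3} (hg : DifferentiableAt ℝ g (t, x, y)) :
    HasDerivAt (fun t => g (t, x, y)) (dd dirT g (t, x, y)) t :=
  hg.hasFDerivAt.comp_hasDerivAt t ((hasDerivAt_id t).prodMk (hasDerivAt_const t (x, y)))

theorem hasDerivAt_slice_x {t x : ℝ} {y : E3} (hg : DifferentiableAt ℝ g (t, x, y)) :
    HasDerivAt (fun x => g (t, x, y)) (dd dirX g (t, x, y)) x :=
  hg.hasFDerivAt.comp_hasDerivAt x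
    ((hasDerivAt_const x t).prodMk ((hasDerivAt_id x).prodMk (hasDerivAt_const x y)))

theorem pd_slice {t x : ℝ} {y : E3} (hg : DifferentiableAt ℝ g (t, x, y)) (i : Fin 3) :
    pd i (fun y => g (t, x, y)) y = dd (dirY i) g (t, x, y) := by
  have h : HasFDerivAt (fun y : E3 => (t, x, y))
      ((0 : E3 →L[ℝ] ℝ).prod ((0 : E3 →L[ℝ] ℝ).prod (ContinuousLinearMap.id ℝ E3))) y :=
    (hasFDerivAt_const t y).prodMk ((hasFDerivAt_const x y).prodMk (hasFDerivAt_id y))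
  have : fderiv ℝ (fun y => g (t, x, y)) y = _ := (hg.hasFDerivAt.comp y h).fderiv
  rw [pd, this]
  rfl

theorem mem_awayAxis (t x : ℝ) (θ : S2) : (t, x, (θ : E3)) ∈ awayAxis := by
  intro h
  have h1 : ‖(θ : E3)‖ = 1 := by simp
  have h' : (θ : E3) = 0 := h
  rw [h', norm_zero] at h1
  exact zero_ne_one h1

/-- Continuity of a function on space-time. -/
def StContinuous (f : ℝ → ℝ → S2 → ℝ) : Prop :=
  Continuous fun z : ℝ × ℝ × S2 => f z.1 z.2.1 z.2.2

theorem stContinuous_of_continuousOn (hg : ContinuousOn g awayAxis) :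
    StContinuous fun t x θ => g (t, x, θ) :=
  hg.comp_continuous (f := fun z : ℝ × ℝ × S2 => (z.1, z.2.1, (z.2.2 : E3))) (by fun_prop)
    fun z => mem_awayAxis _ _ _

/-- A `C²` function on space-time, together with its derivatives of order at most two
and Green's identities on the spheres. -/
structure SphereWave where
  v : ℝ → ℝ → S2 → ℝ
  vt : ℝ → ℝ → S2 → ℝ
  vx : ℝ → ℝ → S2 → ℝ
  vtt : ℝ → ℝ → S2 → ℝ
  vtx : ℝ → ℝ → S2 → ℝ
  vxx : ℝ → ℝ → S2 → ℝ
  lap : ℝ → ℝ → S2 → ℝ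
  vy : Fin 3 → ℝ → ℝ → S2 → ℝ
  vty : Fin 3 → ℝ → ℝ → S2 → ℝ
  vxy : Fin 3 → ℝ → ℝ → S2 → ℝ
  cv : StContinuous v
  cvt : StContinuous vt
  cvx : StContinuous vx
  cvtt : StContinuous vtt
  cvtx : StContinuous vtx
  cvxx : StContinuous vxx
  clap : StContinuous lap
  cvy : ∀ i, StContinuous (vy i)
  cvty : ∀ i, StContinuous (vty i)
  cvxy : ∀ i, StContinuous (vxy i)
  v_t : ∀ t x θ, HasDerivAt (fun t => v t x θ) (vt t x θ) t
  v_x : ∀ t x θ, HasDerivAt (fun x => v t x θ) (vx t x θ) x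
  vt_t : ∀ t x θ, HasDerivAt (fun t => vt t x θ) (vtt t x θ) t
  vt_x : ∀ t x θ, HasDerivAt (fun x => vt t x θ) (vtx t x θ) x
  vx_t : ∀ t x θ, HasDerivAt (fun t => vx t x θ) (vtx t x θ) t
  vx_x : ∀ t x θ, HasDerivAt (fun x => vx t x θ) (vxx t x θ) x
  vy_t : ∀ i t x θ, HasDerivAt (fun t => vy i t x θ) (vty i t x θ) t
  vy_x : ∀ i t x θ, HasDerivAt (fun x => vy i t x θ) (vxy i t x θ) x
  green : ∀ t x, ∫ θ, (v t x θ * lap t x θ + ∑ i, vy i t x θ * vy i t x θ) ∂sphMeas = 0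
  green_t : ∀ t x, ∫ θ, (vt t x θ * lap t x θ + ∑ i, vty i t x θ * vy i t x θ) ∂sphMeas = 0
  green_x : ∀ t x, ∫ θ, (vx t x θ * lap t x θ + ∑ i, vxy i t x θ * vy i t x θ) ∂sphMeas = 0

theorem slice_contDiffOn {n : ℕ} (hg : ContDiffOn ℝ n g awayAxis) (t x : ℝ) :
    ContDiffOn ℝ n (fun y => g (t, x, y)) {0}ᶜ := by
  have : ContDiff ℝ n fun y : E3 => (t, x, y) :=
    contDiff_const.prodMk (contDiff_const.prodMk contDiff_id)
  exact hg.comp this.contDiffOn fun y hy => hy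

theorem pd_pd_slice (hg : ContDiffOn ℝ 2 g awayAxis) (t x : ℝ) {y : E3} (hy : y ≠ 0) (i : Fin 3) :
    pd i (pd i fun y => g (t, x, y)) y = dd (dirY i) (dd (dirY i) g) (t, x, y) := by
  have h1 : pd i (fun y => g (t, x, y)) =ᶠ[nhds y] fun y => dd (dirY i) g (t, x, y) := by
    filter_upwards [isOpen_punctured.mem_nhds hy] with y hy
    exact pd_slice (differentiableAt_of_contDiffOn (n := 2) hg (by norm_num) hy) i
  have h2 := pd_slice (t := t) (x := x) (y := y) (differentiableAt_of_contDiffOn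
    (contDiffOn_dd (n := 2) (k := 1) hg rfl (dirY i)) one_ne_zero hy) i
  rw [← h2, pd, h1.fderiv_eq]
  rfl

theorem integral_slice_green {h : ℝ × ℝ × E3 → ℝ} (hg : ContDiffOn ℝ 2 g awayAxis)
    (hh : ContDiffOn ℝ 1 h awayAxis) (t x : ℝ)
    (g0 : ∀ c : ℝ, 0 < c → ∀ y, g (t, x, c • y) = g (t, x, y))
    (h0 : ∀ c : ℝ, 0 < c → ∀ y, h (t, x, c • y) = h (t, x, y)) :
    ∫ θ : S2, (h (t, x, θ) * ∑ i, dd (dirY i) (dd (dirY i) g) (t, x, θ)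
      + ∑ i, dd (dirY i) h (t, x, θ) * dd (dirY i) g (t, x, θ)) ∂sphMeas = 0 := by
  have := integral_sphere_green (slice_contDiffOn (n := 1) hh t x)
    (slice_contDiffOn (n := 2) hg t x) h0 g0
  rw [← this]
  refine integral_congr_ae (Filter.Eventually.of_forall fun θ => ?_)
  have hθ := mem_awayAxis t x θ
  simp only [pd_pd_slice hg t x hθ,
    pd_slice (differentiableAt_of_contDiffOn (n := 2) hg (by norm_num) hθ),
    pd_slice (differentiableAt_of_contDiffOn (n := 1) hh (by norm_num) hθ)]

/-- The derivatives of a `C²` function on space-time. -/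
def SphereWave.mk' (u : ℝ → ℝ → S2 → ℝ) (hu : ContDiffOn ℝ 2 (stExt u) awayAxis) : SphereWave :=
  have c1 : ∀ e, ContDiffOn ℝ 1 (dd e (stExt u)) awayAxis := fun e =>
    contDiffOn_dd (n := 2) (k := 1) hu rfl e
  have c0 : ∀ e e', ContinuousOn (dd e (dd e' (stExt u))) awayAxis := fun e e' =>
    (contDiffOn_dd (n := 1) (k := 0) (c1 e') rfl e).continuousOn
  have d2 : ∀ t x (θ : S2), DifferentiableAt ℝ (stExt u) (t, x, θ) := fun t x θ =>
    differentiableAt_of_contDiffOn (n := 2) hu (by norm_num) (mem_awayAxis t x θ)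
  have d1 : ∀ e t x (θ : S2), DifferentiableAt ℝ (dd e (stExt u)) (t, x, θ) := fun e t x θ =>
    differentiableAt_of_contDiffOn (n := 1) (c1 e) (by norm_num) (mem_awayAxis t x θ)
  have e0 : ∀ t x (c : ℝ), 0 < c → ∀ y, stExt u (t, x, c • y) = stExt u (t, x, y) :=
    fun t x c hc y => radialExt_smul _ hc y
  { v := fun t x θ => stExt u (t, x, θ)
    vt := fun t x θ => dd dirT (stExt u) (t, x, θ)
    vx := fun t x θ => dd dirX (stExt u) (t, x, θ)
    vtt := fun t x θ => dd dirT (dd dirT (stExt u)) (t, x, θ)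
    vtx := fun t x θ => dd dirX (dd dirT (stExt u)) (t, x, θ)
    vxx := fun t x θ => dd dirX (dd dirX (stExt u)) (t, x, θ)
    lap := fun t x θ => ∑ i, dd (dirY i) (dd (dirY i) (stExt u)) (t, x, θ)
    vy := fun i t x θ => dd (dirY i) (stExt u) (t, x, θ)
    vty := fun i t x θ => dd (dirY i) (dd dirT (stExt u)) (t, x, θ)
    vxy := fun i t x θ => dd (dirY i) (dd dirX (stExt u)) (t, x, θ)
    cv := stContinuous_of_continuousOn hu.continuousOn
    cvt := stContinuous_of_continuousOn (c1 _).continuousOn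
    cvx := stContinuous_of_continuousOn (c1 _).continuousOn
    cvtt := stContinuous_of_continuousOn (c0 _ _)
    cvtx := stContinuous_of_continuousOn (c0 _ _)
    cvxx := stContinuous_of_continuousOn (c0 _ _)
    clap := stContinuous_of_continuousOn
      (g := fun w => ∑ i, dd (dirY i) (dd (dirY i) (stExt u)) w)
      (continuousOn_finsetSum _ fun i _ => c0 _ _)
    cvy := fun i => stContinuous_of_continuousOn (c1 _).continuousOn
    cvty := fun i => stContinuous_of_continuousOn (c0 _ _)
    cvxy := fun i => stContinuous_of_continuousOn (c0 _ _)
    v_t := fun t x θ => hasDerivAt_slice_t (d2 t x θ)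
    v_x := fun t x θ => hasDerivAt_slice_x (d2 t x θ)
    vt_t := fun t x θ => hasDerivAt_slice_t (d1 _ t x θ)
    vt_x := fun t x θ => hasDerivAt_slice_x (d1 _ t x θ)
    vx_t := fun t x θ => by
      rw [dd_comm hu _ _ (mem_awayAxis t x θ)]
      exact hasDerivAt_slice_t (d1 _ t x θ)
    vx_x := fun t x θ => hasDerivAt_slice_x (d1 _ t x θ)
    vy_t := fun i t x θ => by
      rw [dd_comm hu _ _ (mem_awayAxis t x θ)]
      exact hasDerivAt_slice_t (d1 _ t x θ)
    vy_x := fun i t x θ => by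
      rw [dd_comm hu _ _ (mem_awayAxis t x θ)]
      exact hasDerivAt_slice_x (d1 _ t x θ)
    green := fun t x => integral_slice_green hu (hu.of_le (by norm_num)) t x (e0 t x) (e0 t x)
    -- The time derivative of an extension that is homogeneous of degree 0 in y is again so, by
    -- uniqueness of derivatives; this makes ∂_t u an admissible test function.
    green_t := fun t x => integral_slice_green hu (c1 dirT) t x (e0 t x) fun c hc y => by
      rcases eq_or_ne y 0 with rfl | hy
      · rw [smul_zero]
      · have h1 := hasDerivAt_slice_t (differentiableAt_of_contDiffOn (n := 2) hu (by norm_num)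
          (w := (t, x, c • y)) (smul_ne_zero hc.ne' hy))
        have h2 := hasDerivAt_slice_t (differentiableAt_of_contDiffOn (n := 2) hu (by norm_num)
          (w := (t, x, y)) hy)
        simp only [e0 _ x c hc y] at h1
        exact h1.unique h2
    green_x := fun t x => integral_slice_green hu (c1 dirX) t x (e0 t x) fun c hc y => by
      rcases eq_or_ne y 0 with rfl | hy
      · rw [smul_zero]
      · have h1 := hasDerivAt_slice_x (differentiableAt_of_contDiffOn (n := 2) hu (by norm_num)
          (w := (t, x, c • y)) (smul_ne_zero hc.ne' hy))
        have h2 := hasDerivAt_slice_x (differentiableAt_of_contDiffOn (n := 2) hu (by norm_num)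
          (w := (t, x, y)) hy)
        simp only [e0 t _ c hc y] at h1
        exact h1.unique h2 }

/-! ### Integrals over spheres -/

/-- The `L²(S²)` inner product. -/
def ip (f g : S2 → ℝ) : ℝ := ∫ θ, f θ * g θ ∂sphMeas

theorem ip_comm (f g : S2 → ℝ) : ip f g = ip g f := by
  simp only [ip, mul_comm]

theorem StContinuous.slice {f : ℝ → ℝ → S2 → ℝ} (hf : StContinuous f) (t x : ℝ) :
    Continuous (f t x) :=
  Continuous.comp (g := fun z : ℝ × ℝ × S2 => f z.1 z.2.1 z.2.2) hf
    (f := fun θ : S2 => (t, x, θ)) (by fun_prop)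

theorem integrable_of_continuous {f : S2 → ℝ} (hf : Continuous f) : Integrable f sphMeas := by
  simpa using hf.continuousOn.integrableOn_compact (μ := sphMeas) isCompact_univ

theorem StContinuous.mul {f g : ℝ → ℝ → S2 → ℝ} (hf : StContinuous f) (hg : StContinuous g) :
    StContinuous fun t x θ => f t x θ * g t x θ :=
  Continuous.mul hf hg

theorem StContinuous.integral {f : ℝ → ℝ → S2 → ℝ} (hf : StContinuous f) :
    Continuous fun z : ℝ × ℝ => ∫ θ, f z.1 z.2 θ ∂sphMeas := by
  have h : Continuous (fun (z : ℝ × ℝ) (θ : S2) => f z.1 z.2 θ).uncurry :=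
    Continuous.comp (g := fun z : ℝ × ℝ × S2 => f z.1 z.2.1 z.2.2) hf
      (f := fun w : (ℝ × ℝ) × S2 => (w.1.1, w.1.2, w.2)) (by fun_prop)
  simpa using continuous_parametric_integral_of_continuous (μ := sphMeas) h isCompact_univ

theorem continuous_ip {f g : ℝ → ℝ → S2 → ℝ} (hf : StContinuous f) (hg : StContinuous g) :
    Continuous fun z : ℝ × ℝ => ip (f z.1 z.2) (g z.1 z.2) :=
  (hf.mul hg).integral

theorem hasDerivAt_integral_sphere {f f' : ℝ → S2 → ℝ} (hf : ∀ s, Continuous (f s))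
    (hf' : Continuous fun z : ℝ × S2 => f' z.1 z.2)
    (h : ∀ s θ, HasDerivAt (fun s => f s θ) (f' s θ) s) (s : ℝ) :
    HasDerivAt (fun s => ∫ θ, f s θ ∂sphMeas) (∫ θ, f' s θ ∂sphMeas) s := by
  obtain ⟨C, hC⟩ := ((isCompact_closedBall s 1).prod (isCompact_univ (X := S2))).exists_bound_of_continuousOn
    hf'.continuousOn
  exact (hasDerivAt_integral_of_dominated_loc_of_deriv_le (μ := sphMeas) (bound := fun _ => C)
    (Metric.ball_mem_nhds s one_pos)
    (Filter.Eventually.of_forall fun s => (hf s).aestronglyMeasurable)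
    (integrable_of_continuous (hf s))
    (hf'.comp (Continuous.prodMk_right s)).aestronglyMeasurable
    (Filter.Eventually.of_forall fun θ s' hs' =>
      hC (s', θ) ⟨Metric.ball_subset_closedBall hs', mem_univ _⟩)
    (integrable_const C) (Filter.Eventually.of_forall fun θ s' _ => h s' θ)).2

theorem hasDerivAt_ip_t {f g f' g' : ℝ → ℝ → S2 → ℝ} (hf : StContinuous f) (hg : StContinuous g)
    (hf' : StContinuous f') (hg' : StContinuous g')
    (df : ∀ t x θ, HasDerivAt (fun t => f t x θ) (f' t x θ) t)
    (dg : ∀ t x θ, HasDerivAt (fun t => g t x θ) (g' t x θ) t) (t x : ℝ) :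
    HasDerivAt (fun t => ip (f t x) (g t x)) (ip (f' t x) (g t x) + ip (f t x) (g' t x)) t := by
  have e : ip (f' t x) (g t x) + ip (f t x) (g' t x)
      = ∫ θ, (f' t x θ * g t x θ + f t x θ * g' t x θ) ∂sphMeas :=
    (integral_add (integrable_of_continuous ((hf'.mul hg).slice t x))
      (integrable_of_continuous ((hf.mul hg').slice t x))).symm
  rw [e]
  refine hasDerivAt_integral_sphere (f := fun t θ => f t x θ * g t x θ)
    (f' := fun t θ => f' t x θ * g t x θ + f t x θ * g' t x θ)
    (fun s => (hf.mul hg).slice s x) ?_ (fun s θ => (df s x θ).fun_mul (dg s x θ)) t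
  exact (Continuous.add (hf'.mul hg) (hf.mul hg')).comp
    (f := fun z : ℝ × S2 => (z.1, x, z.2)) (by fun_prop)

theorem hasDerivAt_ip_x {f g f' g' : ℝ → ℝ → S2 → ℝ} (hf : StContinuous f) (hg : StContinuous g)
    (hf' : StContinuous f') (hg' : StContinuous g')
    (df : ∀ t x θ, HasDerivAt (fun x => f t x θ) (f' t x θ) x)
    (dg : ∀ t x θ, HasDerivAt (fun x => g t x θ) (g' t x θ) x) (t x : ℝ) :
    HasDerivAt (fun x => ip (f t x) (g t x)) (ip (f' t x) (g t x) + ip (f t x) (g' t x)) x := by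
  have e : ip (f' t x) (g t x) + ip (f t x) (g' t x)
      = ∫ θ, (f' t x θ * g t x θ + f t x θ * g' t x θ) ∂sphMeas :=
    (integral_add (integrable_of_continuous ((hf'.mul hg).slice t x))
      (integrable_of_continuous ((hf.mul hg').slice t x))).symm
  rw [e]
  refine hasDerivAt_integral_sphere (f := fun x θ => f t x θ * g t x θ)
    (f' := fun x θ => f' t x θ * g t x θ + f t x θ * g' t x θ)
    (fun s => (hf.mul hg).slice t s) ?_ (fun s θ => (df t s θ).fun_mul (dg t s θ)) x
  exact (Continuous.add (hf'.mul hg) (hf.mul hg')).comp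
    (f := fun z : ℝ × S2 => (t, z.1, z.2)) (by fun_prop)

theorem ip_self_nonneg (f : S2 → ℝ) : 0 ≤ ip f f :=
  integral_nonneg fun _ => mul_self_nonneg _

theorem ip_sq_le {f g : S2 → ℝ} (hf : Continuous f) (hg : Continuous g) :
    ip f g ^ 2 ≤ ip f f * ip g g := by
  have h : ∀ s : ℝ, 0 ≤ ip g g * (s * s) + 2 * ip f g * s + ip f f := by
    intro s
    have e : ∫ θ, (f θ + s * g θ) * (f θ + s * g θ) ∂sphMeas
        = ip g g * (s * s) + 2 * ip f g * s + ip f f := by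
      have : ∀ θ, (f θ + s * g θ) * (f θ + s * g θ)
          = (s * s) * (g θ * g θ) + (2 * s) * (f θ * g θ) + f θ * f θ := fun θ => by ring
      simp_rw [this]
      rw [integral_add (integrable_of_continuous (by fun_prop))
        (integrable_of_continuous (by fun_prop)), integral_add (integrable_of_continuous
        (by fun_prop)) (integrable_of_continuous (by fun_prop)), integral_const_mul,
        integral_const_mul, ip, ip, ip]
      ring
    rw [← e]
    exact integral_nonneg fun θ => mul_self_nonneg _
  have := discrim_le_zero h
  unfold discrim at this
  nlinarith

namespace SphereWave

variable (W : SphereWave) (m : ℕ)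

/-- The d'Alembertian. -/
def F (t x : ℝ) (θ : S2) : ℝ := -W.vtt t x θ + W.vxx t x θ + 2 * logDer m x * W.vx t x θ
  + (area m x)⁻¹ * W.lap t x θ

theorem cF {m : ℕ} (hm : 1 ≤ m) : StContinuous (W.F m) := by
  have cA := continuous_area hm
  have cL := continuous_logDer m
  have h1 := W.cvtt
  have h2 := W.cvxx
  have h3 := W.cvx
  have h4 := W.clap
  have h5 : Continuous fun x => (area m x)⁻¹ := cA.inv₀ fun x => (area_pos m x).ne'
  have h6 : Continuous fun z : ℝ × ℝ × S2 => (area m z.2.1)⁻¹ :=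
    h5.comp (continuous_fst.comp continuous_snd)
  unfold StContinuous at *
  unfold F
  exact Continuous.add (by fun_prop) (h6.mul h4)

theorem ip_F (t x : ℝ) {g : S2 → ℝ} (hg : Continuous g) :
    ip (W.F m t x) g = -ip (W.vtt t x) g + ip (W.vxx t x) g + 2 * logDer m x * ip (W.vx t x) g
      + (area m x)⁻¹ * ip g (W.lap t x) := by
  have h1 := W.cvtt.slice t x
  have h2 := W.cvxx.slice t x
  have h3 := W.cvx.slice t x
  have h4 := W.clap.slice t x
  have : ∀ θ, W.F m t x θ * g θ = -(W.vtt t x θ * g θ) + W.vxx t x θ * g θ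
      + 2 * logDer m x * (W.vx t x θ * g θ) + (area m x)⁻¹ * (g θ * W.lap t x θ) := fun θ => by
    simp only [F]; ring
  simp only [ip, this]
  rw [integral_add (integrable_of_continuous (by fun_prop)) (integrable_of_continuous (by fun_prop)),
    integral_add (integrable_of_continuous (by fun_prop)) (integrable_of_continuous (by fun_prop)),
    integral_add (integrable_of_continuous (by fun_prop)) (integrable_of_continuous (by fun_prop)),
    integral_neg, integral_const_mul, integral_const_mul]

theorem ip_lap {t x : ℝ} {f : S2 → ℝ} {h : Fin 3 → S2 → ℝ} (hf : Continuous f)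
    (hh : ∀ i, Continuous (h i))
    (hg : ∫ θ, (f θ * W.lap t x θ + ∑ i, h i θ * W.vy i t x θ) ∂sphMeas = 0) :
    ip f (W.lap t x) = -∑ i, ip (h i) (W.vy i t x) := by
  have h4 := W.clap.slice t x
  have h5 := fun i => (W.cvy i).slice t x
  have h6 : Continuous fun θ => ∑ i, h i θ * W.vy i t x θ :=
    continuous_finsetSum _ fun i _ => (hh i).mul (h5 i)
  have h7 : ∫ θ, ∑ i, h i θ * W.vy i t x θ ∂sphMeas = ∑ i, ∫ θ, h i θ * W.vy i t x θ ∂sphMeas :=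
    integral_finsetSum _ fun i _ => integrable_of_continuous ((hh i).mul (h5 i))
  rw [integral_add (integrable_of_continuous (by fun_prop)) (integrable_of_continuous h6), h7] at hg
  simp only [ip]
  linarith

/-- The angular moments of a wave. -/
def moments {m : ℕ} (hm : 1 ≤ m) {T : ℝ}
    (hs : ∀ t ∈ Icc 0 T, ∃ R : ℝ, ∀ x : ℝ, R < |x| → ∀ θ, W.v t x θ = 0) : Moments m T :=
  have cA := continuous_area hm
  have cL := continuous_logDer m
  have cp := continuous_ip W.cvt W.cvt
  have cq := continuous_ip W.cvx W.cvx
  have ck := continuous_ip W.cvt W.cvx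
  have cl := continuous_ip W.cv W.cvx
  have cj := continuous_ip W.cv W.cvt
  have cvtt_vt := continuous_ip W.cvtt W.cvt
  have cvtx_vx := continuous_ip W.cvtx W.cvx
  have cvtx_vt := continuous_ip W.cvtx W.cvt
  have cvtt_vx := continuous_ip W.cvtt W.cvx
  have cvt_vtx := continuous_ip W.cvt W.cvtx
  have cvt_vxx := continuous_ip W.cvt W.cvxx
  have cvx_vxx := continuous_ip W.cvxx W.cvx
  have cv_vtt := continuous_ip W.cv W.cvtt
  have cv_vxx := continuous_ip W.cv W.cvxx
  have cyt := fun i => continuous_ip (W.cvty i) (W.cvy i)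
  have cyx := fun i => continuous_ip (W.cvxy i) (W.cvy i)
  have cA' : Continuous fun z : ℝ × ℝ => 2 * logDer m z.2 * area m z.2 := by fun_prop
  have e1 : ∀ t x, HasDerivAt (fun t => ip (W.vt t x) (W.vt t x)) (2 * ip (W.vtt t x) (W.vt t x)) t :=
    fun t x => (hasDerivAt_ip_t W.cvt W.cvt W.cvtt W.cvtt W.vt_t W.vt_t t x).congr_deriv (by
      rw [ip_comm (W.vt t x)]; ring)
  have e2 : ∀ t x, HasDerivAt (fun t => ip (W.vx t x) (W.vx t x)) (2 * ip (W.vtx t x) (W.vx t x)) t :=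
    fun t x => (hasDerivAt_ip_t W.cvx W.cvx W.cvtx W.cvtx W.vx_t W.vx_t t x).congr_deriv (by
      rw [ip_comm (W.vx t x)]; ring)
  have e3 : ∀ i t x, HasDerivAt (fun t => ip (W.vy i t x) (W.vy i t x))
      (2 * ip (W.vty i t x) (W.vy i t x)) t := fun i t x =>
    (hasDerivAt_ip_t (W.cvy i) (W.cvy i) (W.cvty i) (W.cvty i) (W.vy_t i) (W.vy_t i) t x).congr_deriv
      (by rw [ip_comm (W.vy i t x)]; ring)
  have f1 : ∀ t x, HasDerivAt (fun x => ip (W.vt t x) (W.vt t x)) (2 * ip (W.vtx t x) (W.vt t x)) x :=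
    fun t x => (hasDerivAt_ip_x W.cvt W.cvt W.cvtx W.cvtx W.vt_x W.vt_x t x).congr_deriv (by
      rw [ip_comm (W.vt t x)]; ring)
  have f2 : ∀ t x, HasDerivAt (fun x => ip (W.vx t x) (W.vx t x)) (2 * ip (W.vxx t x) (W.vx t x)) x :=
    fun t x => (hasDerivAt_ip_x W.cvx W.cvx W.cvxx W.cvxx W.vx_x W.vx_x t x).congr_deriv (by
      rw [ip_comm (W.vx t x)]; ring)
  have f3 : ∀ i t x, HasDerivAt (fun x => ip (W.vy i t x) (W.vy i t x))
      (2 * ip (W.vxy i t x) (W.vy i t x)) x := fun i t x =>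
    (hasDerivAt_ip_x (W.cvy i) (W.cvy i) (W.cvxy i) (W.cvxy i) (W.vy_x i) (W.vy_x i) t x).congr_deriv
      (by rw [ip_comm (W.vy i t x)]; ring)
  { p := fun t x => ip (W.vt t x) (W.vt t x)
    q := fun t x => ip (W.vx t x) (W.vx t x)
    r := fun t x => ∑ i, ip (W.vy i t x) (W.vy i t x)
    k := fun t x => ip (W.vt t x) (W.vx t x)
    n := fun t x => ip (W.v t x) (W.v t x)
    l := fun t x => ip (W.v t x) (W.vx t x)
    j := fun t x => ip (W.v t x) (W.vt t x)
    Ft := fun t x => ip (W.F m t x) (W.vt t x)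
    Fx := fun t x => ip (W.F m t x) (W.vx t x)
    Fu := fun t x => ip (W.F m t x) (W.v t x)
    et := fun t x => (area m x * (2 * ip (W.vtt t x) (W.vt t x))
      + area m x * (2 * ip (W.vtx t x) (W.vx t x)) + ∑ i, 2 * ip (W.vty i t x) (W.vy i t x)) / 2
    kt := fun t x => ip (W.vtt t x) (W.vx t x) + ip (W.vt t x) (W.vtx t x)
    jt := fun t x => ip (W.vt t x) (W.vt t x) + ip (W.v t x) (W.vtt t x)
    kx := fun t x => 2 * logDer m x * area m x * ip (W.vt t x) (W.vx t x)
      + area m x * (ip (W.vtx t x) (W.vx t x) + ip (W.vt t x) (W.vxx t x))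
    sx := fun t x => ((2 * logDer m x * area m x * ip (W.vt t x) (W.vt t x)
        + area m x * (2 * ip (W.vtx t x) (W.vt t x)))
      + (2 * logDer m x * area m x * ip (W.vx t x) (W.vx t x)
        + area m x * (2 * ip (W.vxx t x) (W.vx t x)))
      - ∑ i, 2 * ip (W.vxy i t x) (W.vy i t x)) / 2
    lx := fun t x => 2 * logDer m x * area m x * ip (W.v t x) (W.vx t x)
      + area m x * (ip (W.vx t x) (W.vx t x) + ip (W.v t x) (W.vxx t x))
    cp := cp
    cq := cq
    cr := continuous_finsetSum _ fun i _ => continuous_ip (W.cvy i) (W.cvy i)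
    ck := ck
    cn := continuous_ip W.cv W.cv
    cl := cl
    cj := cj
    cFt := continuous_ip (W.cF hm) W.cvt
    cFx := continuous_ip (W.cF hm) W.cvx
    cFu := continuous_ip (W.cF hm) W.cv
    cet := by fun_prop
    ckt := by fun_prop
    cjt := by fun_prop
    ckx := by fun_prop
    csx := by fun_prop
    clx := by fun_prop
    p_nonneg := fun t x => ip_self_nonneg _
    q_nonneg := fun t x => ip_self_nonneg _
    r_nonneg := fun t x => Finset.sum_nonneg fun i _ => ip_self_nonneg _
    n_nonneg := fun t x => ip_self_nonneg _
    k_le := fun t x => by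
      have h := ip_sq_le (W.cvt.slice t x) (W.cvx.slice t x)
      have h1 := ip_self_nonneg (W.vt t x)
      have h2 := ip_self_nonneg (W.vx t x)
      refine abs_le_of_sq_le_sq ?_ (by positivity)
      nlinarith [sq_nonneg (ip (W.vt t x) (W.vt t x) - ip (W.vx t x) (W.vx t x))]
    l_sq := fun t x => by
      rw [mul_comm]; exact ip_sq_le (W.cv.slice t x) (W.cvx.slice t x)
    j_sq := fun t x => by
      rw [mul_comm]; exact ip_sq_le (W.cv.slice t x) (W.cvt.slice t x)
    hasDeriv_e := fun t x => ((((e1 t x).const_mul _).fun_add ((e2 t x).const_mul _)).fun_add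
      (HasDerivAt.fun_sum fun i _ => e3 i t x)).div_const 2
    hasDeriv_k := hasDerivAt_ip_t W.cvt W.cvx W.cvtt W.cvtx W.vt_t W.vx_t
    hasDeriv_j := hasDerivAt_ip_t W.cv W.cvt W.cvt W.cvtt W.v_t W.vt_t
    hasDeriv_kx := fun t x => (hasDerivAt_area hm x).fun_mul
      (hasDerivAt_ip_x W.cvt W.cvx W.cvtx W.cvxx W.vt_x W.vx_x t x)
    hasDeriv_s := fun t x => ((((hasDerivAt_area hm x).fun_mul (f1 t x)).fun_add
      ((hasDerivAt_area hm x).fun_mul (f2 t x))).fun_sub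
      (HasDerivAt.fun_sum fun i _ => f3 i t x)).div_const 2
    hasDeriv_lx := fun t x => (hasDerivAt_area hm x).fun_mul
      (hasDerivAt_ip_x W.cv W.cvx W.cvx W.cvxx W.v_x W.vx_x t x)
    hasDeriv_n := fun t x => (hasDerivAt_ip_x W.cv W.cv W.cvx W.cvx W.v_x W.v_x t x).congr_deriv (by
      rw [ip_comm (W.vx t x)]; ring)
    -- Multiplication by A puts the radial part of □u in divergence form, and Green's identity with
    -- ∂_t u turns the Laplacian into half the time derivative of r. The next two identities pair
    -- with ∂_x u and u instead.
    energy_identity := fun t x => by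
      have hA := (area_pos m x).ne'
      rw [W.ip_F m t x (W.cvt.slice t x), W.ip_lap (W.cvt.slice t x)
        (fun i => (W.cvty i).slice t x) (W.green_t t x), ← Finset.mul_sum, ip_comm (W.vxx t x),
        ip_comm (W.vx t x) (W.vt t x)]
      field_simp
      ring
    radial_identity := fun t x => by
      have hA := (area_pos m x).ne'
      rw [W.ip_F m t x (W.cvx.slice t x), W.ip_lap (W.cvx.slice t x)
        (fun i => (W.cvxy i).slice t x) (W.green_x t x), ← Finset.mul_sum,
        ip_comm (W.vt t x) (W.vtx t x)]
      field_simp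
      ring
    lagrangian_identity := fun t x => by
      have hA := (area_pos m x).ne'
      rw [W.ip_F m t x (W.cv.slice t x), W.ip_lap (W.cv.slice t x)
        (fun i => (W.cvy i).slice t x) (W.green t x), ip_comm (W.vxx t x), ip_comm (W.vtt t x),
        ip_comm (W.vx t x) (W.v t x)]
      field_simp
      ring
    support := fun t ht => by
      obtain ⟨R, hR⟩ := hs t ht
      exact ⟨R, fun x hx => by simp [ip, hR x hx]⟩ }

end SphereWave

/-! ### Gradient, Laplacian and L² pairings on the sphere -/

theorem norm_gradient_sq (f : E3 → ℝ) (y : E3) : ‖gradient f y‖ ^ 2 = ∑ i, pd i f y ^ 2 := by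
  rw [EuclideanSpace.norm_sq_eq]
  refine Finset.sum_congr rfl fun i _ => ?_
  have h : inner ℝ (gradient f y) (EuclideanSpace.single i 1) = pd i f y := by
    rw [gradient, InnerProductSpace.toDual_symm_apply, pd]
  rw [← h, EuclideanSpace.inner_single_right]
  simp

theorem laplacian_eq_sum_pd {f : E3 → ℝ} {y : E3} (hf : ContDiffAt ℝ 2 f y) :
    Laplacian.laplacian f y = ∑ i, pd i (pd i f) y := by
  rw [InnerProductSpace.laplacian_eq_iteratedFDeriv_orthonormalBasis f
    (EuclideanSpace.basisFun (Fin 3) ℝ)]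
  refine Finset.sum_congr rfl fun i _ => ?_
  have hd : DifferentiableAt ℝ (fderiv ℝ f) y :=
    (hf.fderiv_right (m := 1) (by norm_num)).differentiableAt (by norm_num)
  have : fderiv ℝ (fun y => fderiv ℝ f y (EuclideanSpace.single i 1)) y = _ :=
    (hd.hasFDerivAt.clm_apply (hasFDerivAt_const (EuclideanSpace.single i (1 : ℝ)) y)).fderiv
  rw [iteratedFDeriv_two_apply]
  unfold pd
  rw [this]
  simp

theorem lintegral_enorm_sq {f : S2 → ℝ} (hf : Continuous f) :
    ∫⁻ θ, ‖f θ‖ₑ ^ 2 ∂sphMeas = ENNReal.ofReal (ip f f) := by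
  rw [ip, ofReal_integral_eq_lintegral_ofReal (integrable_of_continuous (by fun_prop))
    (Filter.Eventually.of_forall fun _ => mul_self_nonneg _)]
  refine lintegral_congr fun θ => ?_
  rw [← ofReal_norm, ← ENNReal.ofReal_pow (norm_nonneg _), Real.norm_eq_abs, sq_abs, sq]

theorem lintegral_enorm_const_mul_sq (c : ℝ) (f : S2 → ℝ) :
    ∫⁻ θ, ‖c * f θ‖ₑ ^ 2 ∂sphMeas = ‖c‖ₑ ^ 2 * ∫⁻ θ, ‖f θ‖ₑ ^ 2 ∂sphMeas := by
  rw [← lintegral_const_mul' _ _ (by simp)]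
  refine lintegral_congr fun θ => ?_
  rw [enorm_mul, mul_pow]

theorem enorm_sq_eq_ofReal (c : ℝ) : ‖c‖ₑ ^ 2 = ENNReal.ofReal (c ^ 2) := by
  rw [← ofReal_norm, ← ENNReal.ofReal_pow (norm_nonneg _), Real.norm_eq_abs, sq_abs]

/-- The Cauchy–Schwarz inequality on the sphere. -/
theorem ofReal_abs_ip_le {f g : S2 → ℝ} (hf : Measurable f) (hg : Measurable g) :
    ENNReal.ofReal |ip f g| ≤ (∫⁻ θ, ‖f θ‖ₑ ^ 2 ∂sphMeas) ^ (1 / 2 : ℝ)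
      * (∫⁻ θ, ‖g θ‖ₑ ^ 2 ∂sphMeas) ^ (1 / 2 : ℝ) := by
  rw [← Real.norm_eq_abs, ofReal_norm]
  refine (enorm_integral_le_lintegral_enorm _).trans ?_
  refine le_trans (le_of_eq (lintegral_congr fun θ => ?_)) (lintegral_sqrt_mul_sqrt_le
    (f := fun θ => ‖f θ‖ₑ ^ 2) (g := fun θ => ‖g θ‖ₑ ^ 2) (by fun_prop) (by fun_prop))
  have e : ∀ y : ℝ≥0∞, (y ^ 2) ^ (1 / 2 : ℝ) = y := fun y => by
    rw [← ENNReal.rpow_natCast, ← ENNReal.rpow_mul]; norm_num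
  rw [e, e, enorm_mul]

/-- The Cauchy–Schwarz inequality for a sum. -/
theorem ofReal_abs_ip_add_le {f f₁ f₂ g : S2 → ℝ} (h : ∀ θ, f θ = f₁ θ + f₂ θ)
    (hf₁ : Measurable f₁) (hf₂ : Measurable f₂) (hg : Measurable g) :
    ENNReal.ofReal |ip f g| ≤ (∫⁻ θ, ‖f₁ θ‖ₑ ^ 2 ∂sphMeas) ^ (1 / 2 : ℝ)
        * (∫⁻ θ, ‖g θ‖ₑ ^ 2 ∂sphMeas) ^ (1 / 2 : ℝ)
      + (∫⁻ θ, ‖f₂ θ‖ₑ ^ 2 ∂sphMeas) ^ (1 / 2 : ℝ)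
        * (∫⁻ θ, ‖g θ‖ₑ ^ 2 ∂sphMeas) ^ (1 / 2 : ℝ) := by
  have e : ∀ y : ℝ≥0∞, (y ^ 2) ^ (1 / 2 : ℝ) = y := fun y => by
    rw [← ENNReal.rpow_natCast, ← ENNReal.rpow_mul]; norm_num
  have key : ∀ {k : S2 → ℝ}, Measurable k → ∫⁻ θ, ‖k θ‖ₑ * ‖g θ‖ₑ ∂sphMeas
      ≤ (∫⁻ θ, ‖k θ‖ₑ ^ 2 ∂sphMeas) ^ (1 / 2 : ℝ)
        * (∫⁻ θ, ‖g θ‖ₑ ^ 2 ∂sphMeas) ^ (1 / 2 : ℝ) := fun {k} hk => by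
    refine le_trans (le_of_eq (lintegral_congr fun θ => ?_)) (lintegral_sqrt_mul_sqrt_le
      (f := fun θ => ‖k θ‖ₑ ^ 2) (g := fun θ => ‖g θ‖ₑ ^ 2) (by fun_prop) (by fun_prop))
    rw [e, e]
  rw [← Real.norm_eq_abs, ofReal_norm]
  refine (enorm_integral_le_lintegral_enorm _).trans (le_trans ?_ (add_le_add (key hf₁) (key hf₂)))
  rw [← lintegral_add_left (by fun_prop)]
  refine lintegral_mono fun θ => ?_
  simp only []
  rw [enorm_mul, h, ← add_mul]
  exact mul_le_mul_left (enorm_add_le _ _) _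

/-! ### The wave of a `C²` function -/

section Wave

variable {u : ℝ → ℝ → S2 → ℝ} (hu : ContDiffOn ℝ 2 (stExt u) awayAxis)

theorem wave_v : (SphereWave.mk' u hu).v = u := by
  funext t x θ
  exact radialExt_coe _ _

theorem dt_eq : dt u = (SphereWave.mk' u hu).vt := by
  funext t x θ
  have h := (SphereWave.mk' u hu).v_t t x θ
  rw [wave_v] at h
  exact h.deriv

theorem dx_eq : dx u = (SphereWave.mk' u hu).vx := by
  funext t x θ
  have h := (SphereWave.mk' u hu).v_x t x θ
  rw [wave_v] at h
  exact h.deriv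

theorem sphLaplacian_eq (t x : ℝ) (θ : S2) : sphLaplacian (u t x) θ = (SphereWave.mk' u hu).lap t x θ := by
  have hθ := mem_awayAxis t x θ
  have h1 : ContDiffAt ℝ 2 (fun y => stExt u (t, x, y)) (θ : E3) :=
    (slice_contDiffOn (n := 2) hu t x).contDiffAt (isOpen_punctured.mem_nhds hθ)
  have h2 := laplacian_eq_sum_pd h1
  simp only [pd_pd_slice hu t x hθ] at h2
  exact h2

theorem norm_sphGrad_sq (t x : ℝ) (θ : S2) :
    ‖sphGrad (u t x) θ‖ ^ 2 = ∑ i, (SphereWave.mk' u hu).vy i t x θ * (SphereWave.mk' u hu).vy i t x θ := by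
  have hθ := mem_awayAxis t x θ
  have h2 := norm_gradient_sq (fun y => stExt u (t, x, y)) (θ : E3)
  simp only [pd_slice (differentiableAt_of_contDiffOn (n := 2) hu (by norm_num) hθ)] at h2
  refine h2.trans (Finset.sum_congr rfl fun i _ => sq _)

theorem box_eq {m : ℕ} (hm : 1 ≤ m) : box m u = (SphereWave.mk' u hu).F m := by
  funext t x θ
  have h1 : dt (dt u) t x θ = (SphereWave.mk' u hu).vtt t x θ := by
    rw [dt_eq hu]; exact ((SphereWave.mk' u hu).vt_t t x θ).deriv
  have h2 : deriv (fun y => aFun m y ^ 2 * dx u t y θ) x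
      = 2 * logDer m x * area m x * (SphereWave.mk' u hu).vx t x θ + area m x * (SphereWave.mk' u hu).vxx t x θ := by
    rw [dx_eq hu]
    exact ((hasDerivAt_area hm x).fun_mul ((SphereWave.mk' u hu).vx_x t x θ)).deriv
  have h3 : (aFun m x)⁻¹ ^ 2 = (area m x)⁻¹ := by rw [area, inv_pow]
  have hA := (area_pos m x).ne'
  rw [box, h1, h2, h3, sphLaplacian_eq hu, SphereWave.F]
  field_simp
  ring

theorem angSq_dt (t x : ℝ) : angSq (dt u) t x
    = ENNReal.ofReal (ip ((SphereWave.mk' u hu).vt t x) ((SphereWave.mk' u hu).vt t x)) := by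
  rw [dt_eq hu, angSq, lintegral_enorm_sq ((SphereWave.mk' u hu).cvt.slice t x)]

theorem angSq_dx (t x : ℝ) : angSq (dx u) t x
    = ENNReal.ofReal (ip ((SphereWave.mk' u hu).vx t x) ((SphereWave.mk' u hu).vx t x)) := by
  rw [dx_eq hu, angSq, lintegral_enorm_sq ((SphereWave.mk' u hu).cvx.slice t x)]

theorem angSq_self (t x : ℝ) : angSq u t x
    = ENNReal.ofReal (ip ((SphereWave.mk' u hu).v t x) ((SphereWave.mk' u hu).v t x)) := by
  rw [angSq, ← lintegral_enorm_sq ((SphereWave.mk' u hu).cv.slice t x), wave_v]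

theorem angSq_angGrad (m : ℕ) (t x : ℝ) : angSq (angGrad m u) t x = ENNReal.ofReal
    ((∑ i, ip ((SphereWave.mk' u hu).vy i t x) ((SphereWave.mk' u hu).vy i t x)) / area m x) := by
  have cy := fun i => ((SphereWave.mk' u hu).cvy i).slice t x
  have h0 : ∫ θ, ∑ i, (SphereWave.mk' u hu).vy i t x θ * (SphereWave.mk' u hu).vy i t x θ ∂sphMeas
      = ∑ i, ip ((SphereWave.mk' u hu).vy i t x) ((SphereWave.mk' u hu).vy i t x) :=
    integral_finsetSum _ fun i _ => integrable_of_continuous ((cy i).mul (cy i))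
  have cs : Continuous fun θ => ∑ i, (SphereWave.mk' u hu).vy i t x θ
    * (SphereWave.mk' u hu).vy i t x θ := continuous_finsetSum _ fun i _ => (cy i).mul (cy i)
  rw [div_eq_inv_mul, ENNReal.ofReal_mul (inv_nonneg.2 (area_pos m x).le), ← h0,
    ofReal_integral_eq_lintegral_ofReal (integrable_of_continuous cs)
      (Filter.Eventually.of_forall fun _ => Finset.sum_nonneg fun _ _ => mul_self_nonneg _),
    ← lintegral_const_mul' _ _ ENNReal.ofReal_ne_top, angSq]
  refine lintegral_congr fun θ => ?_
  rw [enorm_sq_eq_ofReal, angGrad, mul_pow, norm_sphGrad_sq hu, ENNReal.ofReal_mul (sq_nonneg _),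
    inv_pow, area]

theorem angSq_const_mul (c : ℝ → ℝ → ℝ) (f : ℝ → ℝ → S2 → ℝ) (t x : ℝ) :
    angSq (fun t x θ => c t x * f t x θ) t x = ENNReal.ofReal (c t x ^ 2) * angSq f t x := by
  rw [angSq, lintegral_enorm_const_mul_sq, enorm_sq_eq_ofReal, angSq]

variable {m : ℕ} (hm : 1 ≤ m) {T : ℝ}
  (hs : ∀ t ∈ Icc 0 T, ∃ R : ℝ, ∀ x : ℝ, R < |x| → ∀ θ, u t x θ = 0)

/-- The angular moments of a `C²` function. -/
def momentsOf : Moments m T :=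
  (SphereWave.mk' u hu).moments hm (by simpa only [wave_v] using hs)

theorem energy_eq (t : ℝ) : energy m u t = ENNReal.ofReal 2 * (momentsOf hu hm hs).en t := by
  rw [energy, Moments.en, ← lintegral_const_mul' _ _ ENNReal.ofReal_ne_top]
  refine lintegral_congr fun x => ?_
  have hA := area_pos m x
  have hp := (momentsOf hu hm hs).p_nonneg t x
  have hq := (momentsOf hu hm hs).q_nonneg t x
  have hr := (momentsOf hu hm hs).r_nonneg t x
  rw [angSq_dt hu, angSq_dx hu, angSq_angGrad hu]
  change (ENNReal.ofReal ((momentsOf hu hm hs).p t x) + ENNReal.ofReal ((momentsOf hu hm hs).q t x)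
    + ENNReal.ofReal ((momentsOf hu hm hs).r t x / area m x)) * ENNReal.ofReal (area m x) = _
  rw [← ENNReal.ofReal_add hp hq, ← ENNReal.ofReal_add (by positivity) (by positivity),
    ← ENNReal.ofReal_mul (by positivity), ← ENNReal.ofReal_mul (by norm_num), Moments.e]
  congr 1
  field_simp

theorem lossyLHS_eq : lossyLHS m T u = (momentsOf hu hm hs).lossy := by
  unfold lossyLHS Moments.lossy
  congr 1
  · congr 1
    · congr 1
      · congr 1
        · simp only [energy_eq hu hm hs]
        · congr 1
          funext t x
          exact angSq_dx hu t x
      · congr 1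
        funext t x
        rw [angSq_const_mul (fun _ x => wt m x) (dt u), angSq_dt hu, ← ENNReal.ofReal_mul
          (sq_nonneg _), ← wtSq_eq]
        rfl
    · congr 1
      funext t x
      rw [angSq_const_mul (fun _ x => wt m x) (angGrad m u), angSq_angGrad hu, ← ENNReal.ofReal_mul
          (sq_nonneg _), ← wtSq_eq]
      rfl
  · congr 1
    funext t x
    rw [angSq_const_mul (fun _ x => (jb x)⁻¹) u, angSq_self hu, ← ENNReal.ofReal_mul
      (sq_nonneg _), inv_pow, jb_sq, mul_comm, ← div_eq_mul_inv]
    rfl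

end Wave

/-! ### Spherical harmonics -/

/-- The Laplacian on `ℝ³`, as the sum of second partial derivatives. -/
def lapl (f : E3 → ℝ) (y : E3) : ℝ := ∑ i, pd i (pd i f) y

theorem contDiffAt_pd {f : E3 → ℝ} {y : E3} (hf : ContDiffAt ℝ 2 f y) (i : Fin 3) :
    ContDiffAt ℝ 1 (pd i f) y :=
  (hf.fderiv_right (m := 1) (by norm_num)).clm_apply contDiffAt_const

theorem pd_mul {f g : E3 → ℝ} {y : E3} (hf : DifferentiableAt ℝ f y)
    (hg : DifferentiableAt ℝ g y) (i : Fin 3) :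
    pd i (fun y => f y * g y) y = f y * pd i g y + pd i f y * g y := by
  have : fderiv ℝ (fun y => f y * g y) y = _ := (hf.hasFDerivAt.fun_mul hg.hasFDerivAt).fderiv
  simp only [pd, this]
  simp
  ring

theorem pd_congr {f g : E3 → ℝ} {y : E3} (h : f =ᶠ[nhds y] g) (i : Fin 3) :
    pd i f =ᶠ[nhds y] pd i g := by
  filter_upwards [h.eventuallyEq_nhds] with z hz
  rw [pd, pd, hz.fderiv_eq]

theorem lapl_congr {f g : E3 → ℝ} {y : E3} (h : f =ᶠ[nhds y] g) : lapl f y = lapl g y :=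
  Finset.sum_congr rfl fun i _ => (pd_congr (pd_congr h i) i).eq_of_nhds

theorem eventually_contDiffAt_two {f : E3 → ℝ} {y : E3} (hf : ContDiffAt ℝ 2 f y) :
    ∀ᶠ z in nhds y, ContDiffAt ℝ 2 f z :=
  hf.eventually (by norm_num)

theorem lapl_mul {f g : E3 → ℝ} {y : E3} (hf : ContDiffAt ℝ 2 f y) (hg : ContDiffAt ℝ 2 g y) :
    lapl (fun y => f y * g y) y
      = f y * lapl g y + 2 * ∑ i, pd i f y * pd i g y + lapl f y * g y := by
  have d : ∀ {f : E3 → ℝ} {z : E3}, ContDiffAt ℝ 2 f z → DifferentiableAt ℝ f z := fun h =>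
    h.differentiableAt (by norm_num)
  have d1 : ∀ {f : E3 → ℝ} {z : E3}, ContDiffAt ℝ 2 f z → ∀ i, DifferentiableAt ℝ (pd i f) z :=
    fun h i => (contDiffAt_pd h i).differentiableAt (by norm_num)
  have h1 : ∀ i, pd i (pd i fun y => f y * g y) y
      = f y * pd i (pd i g) y + 2 * (pd i f y * pd i g y) + pd i (pd i f) y * g y := by
    intro i
    have e1 : pd i (fun y => f y * g y) =ᶠ[nhds y] fun y => f y * pd i g y + pd i f y * g y := by
      filter_upwards [eventually_contDiffAt_two hf, eventually_contDiffAt_two hg] with z hz hz'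
      exact pd_mul (d hz) (d hz') i
    rw [(pd_congr e1 i).eq_of_nhds]
    have e2 : pd i (fun y => f y * pd i g y + pd i f y * g y) y
        = pd i (fun y => f y * pd i g y) y + pd i (fun y => pd i f y * g y) y := by
      have : fderiv ℝ (fun y => f y * pd i g y + pd i f y * g y) y = _ :=
        ((((d hf).mul (d1 hg i)).hasFDerivAt).fun_add
          (((d1 hf i).mul (d hg)).hasFDerivAt)).fderiv
      simp only [pd] at this ⊢
      rw [this]
      rfl
    rw [e2, pd_mul (d hf) (d1 hg i), pd_mul (d1 hf i) (d hg)]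
    ring
  simp only [lapl, h1, Finset.sum_add_distrib, Finset.mul_sum, Finset.sum_mul]

theorem lapl_add {f g : E3 → ℝ} {y : E3} (hf : ContDiffAt ℝ 2 f y) (hg : ContDiffAt ℝ 2 g y) :
    lapl (fun y => f y + g y) y = lapl f y + lapl g y := by
  have d : ∀ {f : E3 → ℝ} {z : E3}, ContDiffAt ℝ 2 f z → DifferentiableAt ℝ f z := fun h =>
    h.differentiableAt (by norm_num)
  have key : ∀ {f g : E3 → ℝ} {z : E3}, DifferentiableAt ℝ f z → DifferentiableAt ℝ g z → ∀ i,
      pd i (fun y => f y + g y) z = pd i f z + pd i g z := by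
    intro f g z hf hg i
    have : fderiv ℝ (fun y => f y + g y) z = _ := (hf.hasFDerivAt.fun_add hg.hasFDerivAt).fderiv
    simp only [pd, this]
    rfl
  simp only [lapl, ← Finset.sum_add_distrib]
  refine Finset.sum_congr rfl fun i _ => ?_
  have e1 : pd i (fun y => f y + g y) =ᶠ[nhds y] fun y => pd i f y + pd i g y := by
    filter_upwards [eventually_contDiffAt_two hf, eventually_contDiffAt_two hg] with z hz hz'
    exact key (d hz) (d hz') i
  rw [(pd_congr e1 i).eq_of_nhds]
  exact key ((contDiffAt_pd hf i).differentiableAt (by norm_num))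
    ((contDiffAt_pd hg i).differentiableAt (by norm_num)) i

theorem lapl_const_mul {f : E3 → ℝ} (c : ℝ) (y : E3) :
    lapl (fun y => c * f y) y = c * lapl f y := by
  have key : ∀ (f : E3 → ℝ) (i : Fin 3), pd i (fun y => c * f y) = fun y => c * pd i f y := by
    intro f i
    funext y
    have : fderiv ℝ (fun y => c * f y) y = c • fderiv ℝ f y :=
      congrFun (fderiv_const_smul_field (𝕜 := ℝ) (f := f) c) y
    simp only [pd, this]
    rfl
  simp only [lapl, key, Finset.mul_sum]

theorem two_le_infty : (2 : WithTop ℕ∞) ≤ ((⊤ : ℕ∞) : WithTop ℕ∞) :=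
  WithTop.coe_le_coe.2 le_top

theorem sphLaplacian_eq_lapl {Y : S2 → ℝ} (hY : ContMDiff (𝓡 2) 𝓘(ℝ, ℝ) ∞ Y) (θ : S2) :
    sphLaplacian Y θ = lapl (radialExt Y) θ :=
  laplacian_eq_sum_pd (((contDiffOn_radialExt le_rfl hY).contDiffAt
    (isOpen_punctured.mem_nhds (mem_awayAxis 0 0 θ))).of_le two_le_infty)

theorem contDiffAt_radialExt {Y : S2 → ℝ} (hY : ContMDiff (𝓡 2) 𝓘(ℝ, ℝ) ∞ Y) (θ : S2) :
    ContDiffAt ℝ 2 (radialExt Y) θ :=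
  ((contDiffOn_radialExt le_rfl hY).contDiffAt
    (isOpen_punctured.mem_nhds (mem_awayAxis 0 0 θ))).of_le two_le_infty

theorem radialExt_add (f g : S2 → ℝ) : radialExt (fun θ => f θ + g θ)
    = fun y => radialExt f y + radialExt g y := by
  funext y
  unfold radialExt
  split_ifs <;> simp

theorem radialExt_const_mul (c : ℝ) (f : S2 → ℝ) : radialExt (fun θ => c * f θ)
    = fun y => c * radialExt f y := by
  funext y
  unfold radialExt
  split_ifs <;> simp

theorem sphLaplacian_add {f g : S2 → ℝ} (hf : ContMDiff (𝓡 2) 𝓘(ℝ, ℝ) ∞ f)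
    (hg : ContMDiff (𝓡 2) 𝓘(ℝ, ℝ) ∞ g) (θ : S2) :
    sphLaplacian (fun θ => f θ + g θ) θ = sphLaplacian f θ + sphLaplacian g θ := by
  have h : ContMDiff (𝓡 2) 𝓘(ℝ, ℝ) ∞ fun θ => f θ + g θ := hf.add hg
  rw [sphLaplacian_eq_lapl hf, sphLaplacian_eq_lapl hg, sphLaplacian_eq_lapl h,
    radialExt_add, lapl_add (contDiffAt_radialExt hf θ) (contDiffAt_radialExt hg θ)]

theorem sphLaplacian_const_mul {f : S2 → ℝ} (hf : ContMDiff (𝓡 2) 𝓘(ℝ, ℝ) ∞ f) (c : ℝ) (θ : S2) :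
    sphLaplacian (fun θ => c * f θ) θ = c * sphLaplacian f θ := by
  have h : ContMDiff (𝓡 2) 𝓘(ℝ, ℝ) ∞ fun θ => c * f θ := contMDiff_const.mul hf
  rw [sphLaplacian_eq_lapl hf, sphLaplacian_eq_lapl h,
    radialExt_const_mul, lapl_const_mul]

/-- The smooth eigenfunctions of `-Δ_{S²}` for the eigenvalue `l (l + 1)`. -/
def smoothHarmonics (l : ℕ) : Submodule ℝ (S2 → ℝ) where
  carrier := {Y | ContMDiff (𝓡 2) 𝓘(ℝ, ℝ) ∞ Y ∧
    ∀ θ, -sphLaplacian Y θ = (l : ℝ) * ((l : ℝ) + 1) * Y θ}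
  add_mem' := by
    rintro f g ⟨hf, ef⟩ ⟨hg, eg⟩
    refine ⟨hf.add hg, fun θ => ?_⟩
    have := sphLaplacian_add hf hg θ
    change -sphLaplacian (fun θ => f θ + g θ) θ = _ * _ * (f θ + g θ)
    rw [this, mul_add, ← ef, ← eg]
    ring
  zero_mem' := by
    refine ⟨contMDiff_const, fun θ => ?_⟩
    have h : (0 : S2 → ℝ) = fun θ => (0 : ℝ) * (fun _ => (0 : ℝ)) θ := by funext θ; simp
    rw [h, sphLaplacian_const_mul contMDiff_const]
    simp
  smul_mem' := by
    rintro c f ⟨hf, ef⟩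
    refine ⟨contMDiff_const.mul hf, fun θ => ?_⟩
    change -sphLaplacian (fun θ => c * f θ) θ = _ * _ * (c * f θ)
    rw [sphLaplacian_const_mul hf, ← mul_neg, ef]
    ring

theorem contMDiff_of_mem_iSup {ι : Type*} {L : ι → ℕ} {f : S2 → ℝ}
    (hf : f ∈ ⨆ i, smoothHarmonics (L i)) : ContMDiff (𝓡 2) 𝓘(ℝ, ℝ) ∞ f := by
  refine Submodule.iSup_induction _ (motive := fun f => ContMDiff (𝓡 2) 𝓘(ℝ, ℝ) ∞ f) hf
    (fun i f hf => hf.1) contMDiff_const fun f g hf hg => hf.add hg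

/-- On harmonics of degree l < k the operator Δ + k(k+1) is multiplication by k(k+1) - l(l+1) > 0,
hence invertible. -/
theorem exists_resolvent (k : ℕ) {f : S2 → ℝ} (hf : f ∈ ⨆ l : Fin k, smoothHarmonics l) :
    ∃ g ∈ ⨆ l : Fin k, smoothHarmonics l,
      ∀ θ, sphLaplacian g θ + (k : ℝ) * ((k : ℝ) + 1) * g θ = f θ := by
  refine Submodule.iSup_induction _ (motive := fun f => ∃ g ∈ ⨆ l : Fin k, smoothHarmonics l,
      ∀ θ, sphLaplacian g θ + (k : ℝ) * ((k : ℝ) + 1) * g θ = f θ) hf ?_ ?_ ?_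
  · intro l f hf
    set d : ℝ := (k : ℝ) * (k + 1) - l * (l + 1) with hd
    have hd0 : d ≠ 0 := by
      have : (l : ℝ) < k := by exact_mod_cast l.2
      have h0 : (0 : ℝ) ≤ l := Nat.cast_nonneg _
      have : 0 < d := by rw [hd]; nlinarith
      exact this.ne'
    refine ⟨d⁻¹ • f, Submodule.smul_mem _ _ (Submodule.mem_iSup_of_mem l hf), fun θ => ?_⟩
    have e := hf.2 θ
    change sphLaplacian (fun θ => d⁻¹ * f θ) θ + _ * _ * (d⁻¹ * f θ) = _
    rw [sphLaplacian_const_mul hf.1, neg_eq_iff_eq_neg.1 e]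
    field_simp
    rw [hd]; ring
  · refine ⟨0, Submodule.zero_mem _, fun θ => ?_⟩
    have := ((smoothHarmonics 0).zero_mem.2) θ
    simp only [Pi.zero_apply, mul_zero] at this ⊢
    linarith
  · rintro f₁ f₂ ⟨g₁, h₁, e₁⟩ ⟨g₂, h₂, e₂⟩
    refine ⟨g₁ + g₂, Submodule.add_mem _ h₁ h₂, fun θ => ?_⟩
    have := sphLaplacian_add (contMDiff_of_mem_iSup h₁) (contMDiff_of_mem_iSup h₂) θ
    change sphLaplacian (fun θ => g₁ θ + g₂ θ) θ + _ * _ * (g₁ θ + g₂ θ) = f₁ θ + f₂ θ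
    rw [this, ← e₁, ← e₂]
    ring

/-- Smooth functions on `ℝ³` that are homogeneous of degree `k`. -/
def HomSmooth (k : ℕ) (p : E3 → ℝ) : Prop :=
  ContDiff ℝ ∞ p ∧ ∀ c : ℝ, 0 < c → ∀ y, p (c • y) = c ^ k * p y

theorem HomSmooth.contMDiff {k : ℕ} {p : E3 → ℝ} (hp : HomSmooth k p) :
    ContMDiff (𝓡 2) 𝓘(ℝ, ℝ) ∞ fun θ : S2 => p θ :=
  hp.1.contMDiff.comp contMDiff_coe_sphere

theorem contDiff_pd {p : E3 → ℝ} (hp : ContDiff ℝ ∞ p) (i : Fin 3) : ContDiff ℝ ∞ (pd i p) :=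
  (hp.fderiv_right (m := ∞) (by simp)).clm_apply contDiff_const

theorem contDiff_lapl {p : E3 → ℝ} (hp : ContDiff ℝ ∞ p) : ContDiff ℝ ∞ (lapl p) :=
  ContDiff.sum fun i _ => contDiff_pd (contDiff_pd hp i) i

theorem HomSmooth.lapl_smul {k : ℕ} {p : E3 → ℝ} (hp : HomSmooth k p) {c : ℝ} (hc : 0 < c)
    (y : E3) : c ^ 2 * lapl p (c • y) = c ^ k * lapl p y := by
  have q1 : ∀ i y, pd i p (c • y) = c ^ k / c * pd i p y := fun i y =>
    pd_smul_of_homogeneous hc.ne' (hp.2 c hc) i y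
  have q2 : ∀ i y, pd i (pd i p) (c • y) = c ^ k / c / c * pd i (pd i p) y := fun i y =>
    pd_smul_of_homogeneous hc.ne' (q1 i) i y
  simp only [lapl, q2, ← Finset.mul_sum]
  field_simp

theorem HomSmooth.lapl {k : ℕ} {p : E3 → ℝ} (hp : HomSmooth (k + 2) p) :
    HomSmooth k (lapl p) := by
  refine ⟨contDiff_lapl hp.1, fun c hc y => ?_⟩
  have := hp.lapl_smul hc y
  have hc2 : c ^ 2 ≠ 0 := by positivity
  refine mul_left_cancel₀ hc2 ?_
  rw [this]; ring

/-- The Laplacian is continuous at the origin and homogeneous of the negative degree k - 2, so it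
vanishes. -/
theorem HomSmooth.lapl_eq_zero {k : ℕ} (hk : k < 2) {p : E3 → ℝ} (hp : HomSmooth k p) (y : E3) :
    DegTrap.lapl p y = 0 := by
  have h1 : ∀ c : ℝ, 0 < c → DegTrap.lapl p y = c ^ (2 - k) * DegTrap.lapl p (c • y) := by
    intro c hc
    have h := hp.lapl_smul hc y
    have hck : c ^ k ≠ 0 := by positivity
    refine mul_left_cancel₀ hck ?_
    rw [← h, ← mul_assoc, ← pow_add]
    congr 2
    omega
  have h2 : Filter.Tendsto (fun c : ℝ => c ^ (2 - k) * DegTrap.lapl p (c • y))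
      (nhdsWithin 0 (Ioi 0)) (nhds 0) := by
    have hc : Continuous fun c : ℝ => c ^ (2 - k) * DegTrap.lapl p (c • y) :=
      (continuous_pow _).mul ((contDiff_lapl hp.1).continuous.comp (by fun_prop))
    have := (hc.tendsto 0).mono_left (nhdsWithin_le_nhds (s := Ioi (0 : ℝ)))
    simpa [zero_pow (by omega : 2 - k ≠ 0)] using this
  refine tendsto_nhds_unique (tendsto_const_nhds.congr' ?_) h2
  filter_upwards [self_mem_nhdsWithin] with c hc
  exact h1 c hc

theorem pd_comp_norm_sq {β β' : ℝ → ℝ} {y : E3} (h : HasDerivAt β (β' (‖y‖ ^ 2)) (‖y‖ ^ 2))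
    (i : Fin 3) : pd i (fun y => β (‖y‖ ^ 2)) y = 2 * β' (‖y‖ ^ 2) * y i := by
  have : fderiv ℝ (fun y : E3 => β (‖y‖ ^ 2)) y = _ :=
    (h.comp_hasFDerivAt y (hasStrictFDerivAt_norm_sq y).hasFDerivAt).fderiv
  rw [pd, this]
  simp [EuclideanSpace.inner_single_right]
  ring

/-- The restriction to the sphere of a homogeneous function. -/
theorem HomSmooth.sphLaplacian {k : ℕ} {p : E3 → ℝ} (hp : HomSmooth k p) (θ : S2) :
    sphLaplacian (fun θ : S2 => p θ) θ
      = DegTrap.lapl p θ - (k : ℝ) * ((k : ℝ) + 1) * p θ := by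
  have hθ : ‖(θ : E3)‖ = 1 := by simp
  have hθ0 : (θ : E3) ≠ 0 := mem_awayAxis 0 0 θ
  set w := radialExt fun θ : S2 => p θ with hw
  have cw : ContDiffAt ℝ 2 w θ := contDiffAt_radialExt hp.contMDiff θ
  set β : ℝ → ℝ := fun s => s ^ ((k : ℝ) / 2) with hβ
  set β' : ℝ → ℝ := fun s => (k : ℝ) / 2 * s ^ ((k : ℝ) / 2 - 1) with hβ'
  set β'' : ℝ → ℝ := fun s => (k : ℝ) / 2 * (((k : ℝ) / 2 - 1) * s ^ ((k : ℝ) / 2 - 1 - 1)) with hβ''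
  have hb : ∀ s : ℝ, 0 < s → HasDerivAt β (β' s) s := fun s hs =>
    Real.hasDerivAt_rpow_const (Or.inl hs.ne')
  have hb' : ∀ s : ℝ, 0 < s → HasDerivAt β' (β'' s) s := fun s hs =>
    (Real.hasDerivAt_rpow_const (Or.inl hs.ne')).const_mul _
  set M : E3 → ℝ := fun y => β (‖y‖ ^ 2) with hM
  have npos : ∀ y : E3, y ≠ 0 → 0 < ‖y‖ ^ 2 := fun y hy => by
    have := norm_pos_iff.2 hy
    positivity
  have cM : ContDiffAt ℝ 2 M θ := by
    refine ContDiffAt.comp (g := β) _ ?_ (contDiff_norm_sq ℝ).contDiffAt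
    exact Real.contDiffAt_rpow_const_of_ne (npos _ hθ0).ne'
  have pM : ∀ i y, y ≠ 0 → pd i M y = 2 * β' (‖y‖ ^ 2) * y i := fun i y hy =>
    pd_comp_norm_sq (hb _ (npos y hy)) i
  have ppM : ∀ i, pd i (pd i M) θ = 2 * β' 1 + 4 * β'' 1 * (θ : E3) i ^ 2 := by
    intro i
    have e : pd i M =ᶠ[nhds (θ : E3)] fun y => (2 * β' (‖y‖ ^ 2)) * y i := by
      filter_upwards [isOpen_punctured.mem_nhds hθ0] with y hy
      exact pM i y hy
    have hβd : HasDerivAt (fun s => 2 * β' s) (2 * β'' (‖(θ : E3)‖ ^ 2)) (‖(θ : E3)‖ ^ 2) :=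
      (hb' _ (npos _ hθ0)).const_mul 2
    have d1 : DifferentiableAt ℝ (fun y : E3 => 2 * β' (‖y‖ ^ 2)) (θ : E3) :=
      (HasDerivAt.comp_hasFDerivAt (h₂ := fun s => 2 * β' s) (θ : E3) hβd (hasStrictFDerivAt_norm_sq _).hasFDerivAt).differentiableAt
    have d2 : DifferentiableAt ℝ (fun y : E3 => y i) (θ : E3) := by fun_prop
    have e2 : pd i (fun y : E3 => y i) (θ : E3) = 1 := by
      have : fderiv ℝ (fun y : E3 => y i) (θ : E3) = EuclideanSpace.proj i :=
        (EuclideanSpace.proj i : E3 →L[ℝ] ℝ).fderiv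
      rw [pd, this]
      simp
    have e3 : pd i (fun y : E3 => 2 * β' (‖y‖ ^ 2)) (θ : E3)
        = 2 * (2 * β'' (‖(θ : E3)‖ ^ 2)) * (θ : E3) i :=
      pd_comp_norm_sq (β := fun s => 2 * β' s) (β' := fun s => 2 * β'' s) hβd i
    rw [(pd_congr e i).eq_of_nhds, pd_mul d1 d2, e2, e3, hθ]
    norm_num
    ring
  have sumsq : ∑ i, (θ : E3) i ^ 2 = 1 := by
    have := EuclideanSpace.norm_sq_eq (θ : E3)
    rw [hθ] at this
    simpa using this.symm
  have lM : DegTrap.lapl M θ = (k : ℝ) * ((k : ℝ) + 1) := by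
    simp only [DegTrap.lapl, ppM, Finset.sum_add_distrib, ← Finset.mul_sum, sumsq, hβ', hβ'']
    simp
    ring
  have eu : ∑ i, (θ : E3) i * pd i w θ = 0 := by
    rw [sum_coord_mul_pd, fderiv_self_of_homogeneous (k := 0) (cw.differentiableAt (by norm_num))
      fun c hc => by rw [pow_zero, one_mul]; exact radialExt_smul _ hc _]
    simp
  have cross : ∑ i, pd i M θ * pd i w θ = 0 := by
    simp only [pM _ _ hθ0, mul_assoc]
    simp only [← Finset.mul_sum, eu, mul_zero]
  -- Write p = |y|^k w with w constant along rays. The Laplacian of |y|^k gives the eigenvalue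
  -- k(k+1), and the mixed term vanishes because one gradient is radial and the other tangential.
  have hpw : p =ᶠ[nhds (θ : E3)] fun y => M y * w y := by
    filter_upwards [isOpen_punctured.mem_nhds hθ0] with y hy
    have hy' : y ≠ 0 := hy
    have hn := norm_pos_iff.2 hy'
    have e1 : M y = ‖y‖ ^ k := by
      simp only [hM, hβ]
      rw [← Real.rpow_natCast ‖y‖ 2, ← Real.rpow_mul hn.le, ← Real.rpow_natCast]
      congr 1
      push_cast
      ring
    have e2 : w y = (‖y‖⁻¹) ^ k * p y := by
      rw [hw, radialExt, dif_pos hy']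
      exact hp.2 _ (inv_pos.2 hn) y
    rw [e1, e2, ← mul_assoc, ← mul_pow, mul_inv_cancel₀ hn.ne', one_pow, one_mul]
  have M1 : M θ = 1 := by simp [hM, hβ]
  have w1 : w θ = p θ := radialExt_coe _ _
  rw [sphLaplacian_eq_lapl hp.contMDiff, lapl_congr hpw, lapl_mul cM cw, cross, lM, M1, w1]
  ring

theorem iSup_harmonics_mono {k k' : ℕ} (h : k ≤ k') :
    (⨆ l : Fin k, smoothHarmonics l) ≤ ⨆ l : Fin k', smoothHarmonics l :=
  iSup_le fun l => le_iSup (fun l : Fin k' => smoothHarmonics l) ⟨l, l.2.trans_le h⟩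

/-- Homogeneous functions restrict to sums of spherical harmonics. -/
theorem HomSmooth.mem_iSup {k : ℕ} : ∀ {p : E3 → ℝ}, HomSmooth k p →
    (fun θ : S2 => p θ) ∈ ⨆ l : Fin (k + 1), smoothHarmonics l := by
  induction k using Nat.strong_induction_on with
  | _ k ih =>
  intro p hp
  have hq : (fun θ : S2 => DegTrap.lapl p θ) ∈ ⨆ l : Fin k, smoothHarmonics l := by
    rcases lt_or_ge k 2 with hk | hk
    · simp only [hp.lapl_eq_zero hk]
      exact Submodule.zero_mem _
    · obtain ⟨j, rfl⟩ := Nat.exists_eq_add_of_le' hk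
      exact iSup_harmonics_mono (by omega) (ih j (by omega) hp.lapl)
  -- With (Δ_{S²} + k(k+1)) g = Δp on the sphere, the difference p - g satisfies the eigenvalue
  -- equation of degree k, while g has only lower degrees.
  obtain ⟨g, hg, eg⟩ := exists_resolvent k hq
  have sg := contMDiff_of_mem_iSup hg
  have sg' : ContMDiff (𝓡 2) 𝓘(ℝ, ℝ) ∞ fun θ => -1 * g θ := contMDiff_const.mul sg
  have hm : (fun θ : S2 => p θ + -1 * g θ) ∈ smoothHarmonics k := by
    refine ⟨hp.contMDiff.add sg', fun θ => ?_⟩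
    rw [sphLaplacian_add hp.contMDiff sg', sphLaplacian_const_mul sg,
      hp.sphLaplacian, ← eg]
    ring
  have e : (fun θ : S2 => p θ) = (fun θ : S2 => p θ + -1 * g θ) + g := by
    funext θ; simp
  rw [e]
  exact Submodule.add_mem _ (Submodule.mem_iSup_of_mem (Fin.last k) (by simpa using hm))
    (iSup_harmonics_mono (Nat.le_succ k) hg)

/-! ### The spectral decomposition of the spherical Laplacian -/

theorem continuous_pd_radialExt {f : S2 → ℝ} (hf : ContMDiff (𝓡 2) 𝓘(ℝ, ℝ) ∞ f) (i : Fin 3) :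
    Continuous fun θ : S2 => pd i (radialExt f) θ := by
  refine continuous_iff_continuousAt.2 fun θ => ?_
  have h : ContinuousAt (pd i (radialExt f)) (θ : E3) :=
    (contDiffAt_pd (contDiffAt_radialExt hf θ) i).continuousAt
  exact ContinuousAt.comp (f := ((↑) : S2 → E3)) h continuous_subtype_val.continuousAt

theorem smoothHarmonics_green {l : ℕ} {f g : S2 → ℝ} (hf : ContMDiff (𝓡 2) 𝓘(ℝ, ℝ) ∞ f)
    (hg : g ∈ smoothHarmonics l) :
    ∫ θ : S2, ∑ i, pd i (radialExt f) θ * pd i (radialExt g) θ ∂sphMeas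
      = (l : ℝ) * ((l : ℝ) + 1) * ip f g := by
  have hf1 : ContDiffOn ℝ 1 (radialExt f) {0}ᶜ :=
    (contDiffOn_radialExt le_rfl hf).of_le (le_trans (by norm_num) two_le_infty)
  have hg2 : ContDiffOn ℝ 2 (radialExt g) {0}ᶜ :=
    (contDiffOn_radialExt le_rfl hg.1).of_le two_le_infty
  have h := integral_sphere_green hf1 hg2 (fun c hc y => radialExt_smul f hc y)
    fun c hc y => radialExt_smul g hc y
  have e : ∀ θ : S2, radialExt f θ * ∑ i, pd i (pd i (radialExt g)) θ
      = -((l : ℝ) * ((l : ℝ) + 1)) * (f θ * g θ) := by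
    intro θ
    have h1 := hg.2 θ
    have h2 : ∑ i, pd i (pd i (radialExt g)) (θ : E3) = sphLaplacian g θ :=
      (sphLaplacian_eq_lapl hg.1 θ).symm
    rw [h2, radialExt_coe, neg_eq_iff_eq_neg.1 h1]
    ring
  simp only [e] at h
  rw [integral_add, integral_const_mul] at h
  · have : ip f g = ∫ θ, f θ * g θ ∂sphMeas := rfl
    rw [this]; linarith
  · exact (integrable_of_continuous (hf.continuous.mul hg.1.continuous)).const_mul _
  · exact integrable_of_continuous (continuous_finsetSum _ fun i _ =>
      (continuous_pd_radialExt hf i).mul (continuous_pd_radialExt hg.1 i))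

/-- The Dirichlet form in Green's identity is symmetric, so the integral of f g is annihilated by
the nonzero difference of the eigenvalues. -/
theorem ip_smoothHarmonics {l l' : ℕ} (hl : l ≠ l') {f g : S2 → ℝ} (hf : f ∈ smoothHarmonics l)
    (hg : g ∈ smoothHarmonics l') : ip f g = 0 := by
  have h1 := smoothHarmonics_green hf.1 hg
  have h2 := smoothHarmonics_green hg.1 hf
  have h3 : ip g f = ip f g := by simp only [ip, mul_comm]
  simp only [mul_comm (pd _ (radialExt g) _)] at h2
  rw [h1, h3] at h2
  have h4 : (l' : ℝ) * (l' + 1) - l * (l + 1) ≠ 0 := by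
    have : ((l' : ℝ) - l) * (l' + l + 1) ≠ 0 := by
      refine mul_ne_zero (sub_ne_zero.2 (by exact_mod_cast hl.symm)) ?_
      positivity
    intro h; apply this; linarith
  refine (mul_eq_zero.1 ?_).resolve_left h4
  linarith

theorem harmonicSpace_isOrtho {l l' : ℕ} (hl : l ≠ l') :
    (harmonicSpace l).IsOrtho (harmonicSpace l') := by
  rw [Submodule.isOrtho_iff_le, harmonicSpace, harmonicSpace, Submodule.orthogonal_closure]
  refine Submodule.topologicalClosure_minimal _ ?_ (Submodule.isClosed_orthogonal _)
  rw [← Submodule.isOrtho_iff_le, Submodule.isOrtho_span]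
  rintro u ⟨Y, sY, eY, hY⟩ v ⟨Z, sZ, eZ, hZ⟩
  rw [L2.inner_def]
  have : ip Z Y = 0 := ip_smoothHarmonics hl.symm ⟨sZ, eZ⟩ ⟨sY, eY⟩
  rw [← this]
  refine integral_congr_ae ?_
  filter_upwards [hY, hZ] with θ h1 h2
  rw [h1, h2]
  simp [mul_comm]

/-- A continuous function on the sphere, as an element of `L²(S²)`. -/
abbrev toL2 : C(S2, ℝ) →L[ℝ] Lp ℝ 2 sphMeas := ContinuousMap.toLp 2 sphMeas ℝ

theorem exists_toL2_mem {k : ℕ} {f : S2 → ℝ} (hf : f ∈ ⨆ l : Fin k, smoothHarmonics l) :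
    ∃ g : C(S2, ℝ), (g : S2 → ℝ) = f ∧ toL2 g ∈ ⨆ l, harmonicSpace l := by
  refine Submodule.iSup_induction _ (motive := fun f => ∃ g : C(S2, ℝ), (g : S2 → ℝ) = f ∧
    toL2 g ∈ ⨆ l, harmonicSpace l) hf ?_ ⟨0, rfl, by simp⟩ ?_
  · intro l f hf
    refine ⟨⟨f, hf.1.continuous⟩, rfl, Submodule.mem_iSup_of_mem (l : ℕ) ?_⟩
    exact Submodule.le_topologicalClosure _
      (Submodule.subset_span ⟨f, hf.1, hf.2, ContinuousMap.coeFn_toLp _ _⟩)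
  · rintro _ _ ⟨f, rfl, hf⟩ ⟨g, rfl, hg⟩
    exact ⟨f + g, rfl, by rw [map_add]; exact Submodule.add_mem _ hf hg⟩

theorem HomSmooth.mul {k k' : ℕ} {p q : E3 → ℝ} (hp : HomSmooth k p) (hq : HomSmooth k' q) :
    HomSmooth (k + k') fun y => p y * q y :=
  ⟨hp.1.mul hq.1, fun c hc y => by
    change p (c • y) * q (c • y) = _ * (p y * q y)
    rw [hp.2 c hc, hq.2 c hc]; ring⟩

/-- The coordinate functions on the sphere. -/
def coordS (i : Fin 3) : C(S2, ℝ) :=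
  ⟨fun θ => (θ : E3) i, by fun_prop⟩

theorem exists_homSmooth {f : C(S2, ℝ)} (hf : f ∈ Submonoid.closure (range coordS)) :
    ∃ (k : ℕ) (p : E3 → ℝ), HomSmooth k p ∧ ∀ θ : S2, f θ = p θ := by
  induction hf using Submonoid.closure_induction with
  | mem f h =>
    obtain ⟨i, rfl⟩ := h
    exact ⟨1, fun y => y i, ⟨by fun_prop, fun c _ y => by simp⟩, fun θ => rfl⟩
  | one => exact ⟨0, fun _ => 1, ⟨contDiff_const, fun c _ y => by simp⟩, fun θ => rfl⟩
  | mul f g _ _ hf hg =>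
    obtain ⟨k, p, hp, ep⟩ := hf
    obtain ⟨k', q, hq, eq⟩ := hg
    exact ⟨k + k', _, hp.mul hq, fun θ => by simp [ep, eq]⟩

/-- The coordinates separate points, so by Stone–Weierstrass the polynomials are uniformly dense,
and uniform convergence implies L² convergence. Each monomial is homogeneous, hence a finite sum of
harmonics by `HomSmooth.mem_iSup`. -/
theorem toL2_mem_closure (f : C(S2, ℝ)) :
    toL2 f ∈ (⨆ l, harmonicSpace l).topologicalClosure := by
  set A : Subalgebra ℝ C(S2, ℝ) := Algebra.adjoin ℝ (range coordS) with hA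
  have sep : A.SeparatesPoints := by
    intro x y hxy
    have : ∃ i, (x : E3) i ≠ (y : E3) i := by
      by_contra h
      push Not at h
      exact hxy (Subtype.ext (PiLp.ext h))
    obtain ⟨i, hi⟩ := this
    exact ⟨coordS i, ⟨coordS i, Algebra.subset_adjoin ⟨i, rfl⟩, rfl⟩, hi⟩
  have dense := ContinuousMap.subalgebra_topologicalClosure_eq_top_of_separatesPoints A sep
  have hAM : ∀ g ∈ A, toL2 g ∈ (⨆ l, harmonicSpace l).topologicalClosure := by
    intro g hg
    have hg' : g ∈ Submodule.span ℝ (Submonoid.closure (range coordS) : Set C(S2, ℝ)) := by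
      rw [← Algebra.adjoin_eq_span]; exact hg
    induction hg' using Submodule.span_induction with
    | mem g h =>
      obtain ⟨k, p, hp, ep⟩ := exists_homSmooth h
      obtain ⟨g', e, hg'⟩ := exists_toL2_mem hp.mem_iSup
      have : g = g' := by
        ext θ
        rw [ep, e]
      rw [this]
      exact Submodule.le_topologicalClosure _ hg'
    | zero => simp
    | add x y hx hy h1 h2 =>
      rw [map_add]
      refine Submodule.add_mem _ (h1 ?_) (h2 ?_) <;> rw [hA, ← Subalgebra.mem_toSubmodule,
        Algebra.adjoin_eq_span] <;> assumption
    | smul a x hx h =>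
      rw [map_smul]
      refine Submodule.smul_mem _ _ (h ?_)
      rw [hA, ← Subalgebra.mem_toSubmodule, Algebra.adjoin_eq_span]
      assumption
  have hf : f ∈ closure (A : Set C(S2, ℝ)) := by
    have : f ∈ A.topologicalClosure := by rw [dense]; trivial
    exact this
  have cl : IsClosed (toL2 ⁻¹' ((⨆ l, harmonicSpace l).topologicalClosure : Set _)) :=
    (Submodule.isClosed_topologicalClosure _).preimage toL2.continuous
  exact closure_minimal (fun g hg => hAM g hg) cl hf

theorem iSup_harmonicSpace_dense : (⨆ l, harmonicSpace l).topologicalClosure = ⊤ := by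
  refine eq_top_iff.2 fun h _ => ?_
  have hd := ContinuousMap.toLp_denseRange ℝ sphMeas ℝ (p := 2) (by norm_num)
  exact closure_minimal (by rintro _ ⟨f, rfl⟩; exact toL2_mem_closure f)
    (Submodule.isClosed_topologicalClosure _) (hd h)

instance (l : ℕ) : CompleteSpace (harmonicSpace l) := by
  unfold harmonicSpace; infer_instance

theorem harmonicProj_eq (l : ℕ) (f : Lp ℝ 2 sphMeas) :
    harmonicProj l f = (harmonicSpace l).starProjection f := rfl

/-- Orthogonality and density give a Hilbert sum. Projecting the expansion onto one summand kills
all the others, which identifies its coordinates with `harmonicProj`. -/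
theorem hasSum_harmonicProj (f : Lp ℝ 2 sphMeas) : HasSum (fun l => harmonicProj l f) f := by
  have ho : OrthogonalFamily ℝ (fun l => harmonicSpace l) fun l => (harmonicSpace l).subtypeₗᵢ :=
    OrthogonalFamily.of_pairwise fun l l' hl => harmonicSpace_isOrtho hl
  have hH := IsHilbertSum.mkInternal (fun l => harmonicSpace l) ho iSup_harmonicSpace_dense.ge
  have hs := hH.hasSum_linearIsometryEquiv_symm (hH.linearIsometryEquiv f)
  rw [LinearIsometryEquiv.symm_apply_apply] at hs
  set w := hH.linearIsometryEquiv f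
  have hw : ∀ l, harmonicProj l f = (w l : Lp ℝ 2 sphMeas) := by
    intro l
    have h1 := hs.mapL (harmonicSpace l).starProjection
    have h2 := hasSum_single (f := fun k => (harmonicSpace l).starProjection
      ((harmonicSpace k).subtypeₗᵢ (w k))) l fun k hk =>
        (Submodule.starProjection_apply_eq_zero_iff _).2
          ((harmonicSpace_isOrtho hk) (w k).2)
    rw [harmonicProj_eq, h1.unique h2]
    exact Submodule.starProjection_mem_subspace_eq_self (w l)
  simp only [hw]
  exact hs

/-- Each term ⟨g, P_l f⟩ equals ⟨P_l g, P_l f⟩, as the projection is self-adjoint and idempotent. -/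
theorem enorm_inner_le_tsum (f g : Lp ℝ 2 sphMeas) :
    ‖inner ℝ f g‖ₑ ≤ ∑' l, ‖harmonicProj l f‖ₑ * ‖harmonicProj l g‖ₑ := by
  have h := (hasSum_harmonicProj f).mapL ((innerSL ℝ) g)
  simp only [innerSL_apply_apply] at h
  rw [real_inner_comm, ← h.tsum_eq]
  refine enorm_tsum_le_tsum_enorm.trans (ENNReal.tsum_le_tsum fun l => ?_)
  have e : inner ℝ g (harmonicProj l f) = inner ℝ (harmonicProj l g) (harmonicProj l f) := by
    rw [harmonicProj_eq, harmonicProj_eq, Submodule.inner_starProjection_left_eq_right]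
    congr 1
    exact (Submodule.starProjection_eq_self_iff.2 (Submodule.starProjection_apply_mem _ _)).symm
  rw [e, ← ofReal_norm, ← ofReal_norm, ← ofReal_norm, ← ENNReal.ofReal_mul (norm_nonneg _),
    mul_comm]
  exact ENNReal.ofReal_le_ofReal (norm_inner_le_norm _ _)

theorem spectralSq_coe (φ : ℝ → ℝ) (f : C(S2, ℝ)) : spectralSq φ f
    = ∑' l : ℕ, ENNReal.ofReal (φ ((l : ℝ) * ((l : ℝ) + 1))) * ‖harmonicProj l (toL2 f)‖ₑ ^ 2 := by
  have hf : MemLp f 2 sphMeas :=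
    f.continuous.memLp_of_hasCompactSupport (HasCompactSupport.of_compactSpace _)
  have e : hf.toLp f = toL2 f := Lp.ext (hf.coeFn_toLp.trans (ContinuousMap.coeFn_toLp _ f).symm)
  rw [spectralSq, dif_pos hf, e]

/-- Duality of the spectral norms for `φ` and `φ⁻¹`. -/
theorem ofReal_abs_ip_le_spectralSq {φ φ' : ℝ → ℝ} (h0 : ∀ l, 0 ≤ l → 0 ≤ φ l)
    (hφ : ∀ l, 0 ≤ l → φ l * φ' l = 1) {f g : S2 → ℝ} (hf : Continuous f) (hg : Continuous g) :
    ENNReal.ofReal |ip f g| ≤ spectralSq φ f ^ (1 / 2 : ℝ) * spectralSq φ' g ^ (1 / 2 : ℝ) := by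
  have hs := enorm_inner_le_tsum (toL2 ⟨f, hf⟩) (toL2 ⟨g, hg⟩)
  have e : inner ℝ (toL2 ⟨f, hf⟩) (toL2 ⟨g, hg⟩) = ip f g := by
    rw [ContinuousMap.inner_toLp]
    simp [ip, mul_comm]
  rw [e, Real.enorm_eq_ofReal_abs] at hs
  refine hs.trans ?_
  have e1 := spectralSq_coe φ ⟨f, hf⟩
  have e2 := spectralSq_coe φ' ⟨g, hg⟩
  simp only [ContinuousMap.coe_mk] at e1 e2
  -- Sums over the degree are integrals against counting measure, so the Cauchy–Schwarz inequality
  -- for integrals applies.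
  rw [e1, e2, ← lintegral_count, ← lintegral_count, ← lintegral_count]
  refine le_trans (le_of_eq ?_) (lintegral_sqrt_mul_sqrt_le (Measurable.of_discrete).aemeasurable
    (Measurable.of_discrete).aemeasurable)
  refine lintegral_congr fun l => ?_
  have hl : (0 : ℝ) ≤ (l : ℝ) * (l + 1) := by positivity
  have sq : ∀ a : ℝ≥0∞, (a ^ 2) ^ (1 / 2 : ℝ) = a := fun a => by
    rw [← ENNReal.rpow_natCast, ← ENNReal.rpow_mul]; norm_num
  rw [ENNReal.mul_rpow_of_nonneg _ _ (by norm_num), ENNReal.mul_rpow_of_nonneg _ _ (by norm_num),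
    sq, sq, mul_mul_mul_comm, ← ENNReal.mul_rpow_of_nonneg _ _ (by norm_num),
    ← ENNReal.ofReal_mul (h0 _ hl), hφ _ hl]
  simp

/-- The map (t,x) ↦ f(t,x,·) is continuous into C(S²), so each projected norm is continuous and the
bracket norm is a countable sum of measurable terms. -/
theorem StContinuous.measurable_bracketSq {m : ℕ} (s : ℝ) {f : ℝ → ℝ → S2 → ℝ}
    (hf : StContinuous f) : Measurable fun z : ℝ × ℝ => bracketSq m s f z.1 z.2 := by
  have hf' : Continuous fun z : (ℝ × ℝ) × S2 => f z.1.1 z.1.2 z.2 :=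
    Continuous.comp (g := fun z : ℝ × ℝ × S2 => f z.1 z.2.1 z.2.2) hf
      (f := fun z : (ℝ × ℝ) × S2 => (z.1.1, z.1.2, z.2)) (by fun_prop)
  set F : C(ℝ × ℝ, C(S2, ℝ)) := ContinuousMap.curry ⟨_, hf'⟩
  have e : ∀ z : ℝ × ℝ, bracketSq m s f z.1 z.2 = ∑' l : ℕ,
      ENNReal.ofReal ((1 + (l : ℝ) * ((l : ℝ) + 1) / aFun m z.2 ^ 2) ^ s)
        * ‖harmonicProj l (toL2 (F z))‖ₑ ^ 2 := fun z => spectralSq_coe _ (F z)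
  simp only [e]
  refine Measurable.tsum fun l => ?_
  have ca : Measurable fun z : ℝ × ℝ => aFun m z.2 := by
    unfold aFun; fun_prop
  have cp : Continuous fun z => harmonicProj l (toL2 (F z)) :=
    (harmonicSpace l).starProjection.continuous.comp (toL2.continuous.comp F.continuous)
  refine Measurable.mul ?_ ((cp.enorm.measurable).pow_const 2)
  fun_prop

/-! ### The local energy estimates -/

theorem StMeasurable.measurable_angSq {f : ℝ → ℝ → S2 → ℝ} (hf : StMeasurable f) :
    Measurable fun z : ℝ × ℝ => angSq f z.1 z.2 := by
  have h : Measurable fun z : (ℝ × ℝ) × S2 => f z.1.1 z.1.2 z.2 :=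
    Measurable.comp (g := fun z : ℝ × ℝ × S2 => f z.1 z.2.1 z.2.2) hf
      (f := fun z : (ℝ × ℝ) × S2 => (z.1.1, z.1.2, z.2)) (by fun_prop)
  exact Measurable.lintegral_prod_right' (f := fun z : (ℝ × ℝ) × S2 => ‖f z.1.1 z.1.2 z.2‖ₑ ^ 2)
    (h.enorm.pow_const 2)

theorem StMeasurable.slice {f : ℝ → ℝ → S2 → ℝ} (hf : StMeasurable f) (t x : ℝ) :
    Measurable (f t x) :=
  Measurable.comp (g := fun z : ℝ × ℝ × S2 => f z.1 z.2.1 z.2.2) hf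
    (f := fun θ : S2 => (t, x, θ)) (by fun_prop)

theorem wt_pos {m : ℕ} {x : ℝ} (hx : x ≠ 0) : 0 < wt m x :=
  pow_pos (div_pos (abs_pos.2 hx) (jb_pos x)) m

theorem StMeasurable.wt_inv_mul {m : ℕ} {f : ℝ → ℝ → S2 → ℝ} (hf : StMeasurable f) :
    StMeasurable fun t x θ => (wt m x)⁻¹ * f t x θ := by
  have h : Measurable fun z : ℝ × ℝ × S2 => wt m z.2.1 := by
    have := continuous_jb.measurable
    unfold wt
    fun_prop
  exact h.inv.mul hf

theorem angSq_eq_wtSq_mul {m : ℕ} (f : ℝ → ℝ → S2 → ℝ) (t : ℝ) {x : ℝ} (hx : x ≠ 0) :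
    angSq f t x
      = ENNReal.ofReal (wtSq m x) * angSq (fun t x θ => (wt m x)⁻¹ * f t x θ) t x := by
  have h := (wt_pos (m := m) hx).ne'
  rw [wtSq_eq, ← angSq_const_mul (fun _ x => wt m x), angSq, angSq]
  simp only [← mul_assoc, mul_inv_cancel₀ h, one_mul]

theorem angSq_le_angSq_wt {m : ℕ} (f : ℝ → ℝ → S2 → ℝ) (t : ℝ) {x : ℝ} (hx : x ≠ 0) :
    angSq f t x ≤ angSq (fun t x θ => (wt m x)⁻¹ * f t x θ) t x := by
  rw [angSq_eq_wtSq_mul (m := m) f t hx]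
  refine mul_le_of_le_one_left' ?_
  rw [ENNReal.ofReal_le_one]
  exact wtSq_le_one m x

theorem ae_ne_zero : ∀ᵐ x : ℝ, x ≠ 0 :=
  Measure.ae_ne volume 0

theorem LEStar_mono {m : ℕ} {T : ℝ} {G H : ℝ → ℝ → ℝ≥0∞}
    (h : ∀ t x, x ≠ 0 → G t x ≤ H t x) : LEStar m T G ≤ LEStar m T H := by
  refine ENNReal.tsum_le_tsum fun j => mul_le_mul_right ?_ _
  refine ENNReal.rpow_le_rpow (lintegral_mono fun t => lintegral_mono_ae ?_) (by norm_num)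
  filter_upwards [ae_restrict_of_ae ae_ne_zero] with x hx
  exact mul_le_mul_left (h t x hx) _

theorem LE_mono {m : ℕ} {T : ℝ} {G H : ℝ → ℝ → ℝ≥0∞}
    (h : ∀ t x, G t x ≤ H t x) : LE m T G ≤ LE m T H :=
  iSup_mono fun j => mul_le_mul_right (ENNReal.rpow_le_rpow (lintegral_mono fun t =>
    lintegral_mono fun x => mul_le_mul_left (h t x) _) (by norm_num)) _

theorem L1L2_add_le {m : ℕ} (hm : 1 ≤ m) {T : ℝ} {G H : ℝ → ℝ → ℝ≥0∞}
    (mG : Measurable fun z : ℝ × ℝ => G z.1 z.2) :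
    L1L2 m T (fun t x => G t x + H t x) ≤ L1L2 m T G + L1L2 m T H := by
  have mA : Measurable fun z : ℝ × ℝ => ENNReal.ofReal (aFun m z.2 ^ 2) :=
    (measurable_area_ofReal hm).comp measurable_snd
  have m1 : Measurable fun t => ∫⁻ x, G t x * ENNReal.ofReal (aFun m x ^ 2) :=
    Measurable.lintegral_prod_right' (f := fun z : ℝ × ℝ => G z.1 z.2
      * ENNReal.ofReal (aFun m z.2 ^ 2)) (by fun_prop)
  have mG' : ∀ t, Measurable fun x => G t x * ENNReal.ofReal (aFun m x ^ 2) := fun t =>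
    (mG.mul mA).comp (measurable_prodMk_left (x := t))
  rw [L1L2, L1L2, L1L2, ← lintegral_add_left (m1.pow_const _)]
  refine lintegral_mono fun t => ?_
  simp only [add_mul]
  rw [lintegral_add_left (mG' t)]
  exact ENNReal.rpow_add_le_add_rpow _ _ (by norm_num) (by norm_num)

theorem L1L2_const_mul {m : ℕ} {T : ℝ} {c : ℝ≥0∞} (hc : c ≠ ⊤) (G : ℝ → ℝ → ℝ≥0∞) :
    L1L2 m T (fun t x => c * G t x) = c ^ (1 / 2 : ℝ) * L1L2 m T G := by
  rw [L1L2, L1L2, ← lintegral_const_mul' _ _ (ENNReal.rpow_ne_top_of_nonneg (by norm_num) hc)]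
  refine lintegral_congr fun t => ?_
  simp only [mul_assoc]
  rw [lintegral_const_mul' _ _ hc, ENNReal.mul_rpow_of_nonneg _ _ (by norm_num)]

theorem ENNReal.sqrt_add_sqrt_le (a b : ℝ≥0∞) :
    a ^ (1 / 2 : ℝ) + b ^ (1 / 2 : ℝ) ≤ (4 * (a + b)) ^ (1 / 2 : ℝ) := by
  have h4 : (4 : ℝ≥0∞) ^ (1 / 2 : ℝ) = 2 := by
    rw [show (4 : ℝ≥0∞) = 2 ^ (2 : ℝ) by norm_num, ← ENNReal.rpow_mul]
    norm_num
  rw [ENNReal.mul_rpow_of_nonneg _ _ (by norm_num), h4, two_mul]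
  exact add_le_add (ENNReal.rpow_le_rpow le_self_add (by norm_num))
    (ENNReal.rpow_le_rpow le_add_self (by norm_num))

section Wave

variable {u : ℝ → ℝ → S2 → ℝ} (hu : ContDiffOn ℝ 2 (stExt u) awayAxis)
  {m : ℕ} (hm : 1 ≤ m) {T : ℝ}
  (hs : ∀ t ∈ Icc 0 T, ∃ R : ℝ, ∀ x : ℝ, R < |x| → ∀ θ, u t x θ = 0)

theorem stContinuous_dt (hu : ContDiffOn ℝ 2 (stExt u) awayAxis) : StContinuous (dt u) := by
  rw [dt_eq hu]; exact (SphereWave.mk' u hu).cvt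

theorem stContinuous_box (hu : ContDiffOn ℝ 2 (stExt u) awayAxis) (hm : 1 ≤ m) : StContinuous (box m u) := by
  rw [box_eq hu hm]; exact (SphereWave.mk' u hu).cF hm

theorem momentsOf_Ft (t x : ℝ) :
    (momentsOf hu hm hs).Ft t x = ip (box m u t x) ((SphereWave.mk' u hu).vt t x) := by
  rw [box_eq hu hm]; rfl

theorem momentsOf_Fx (t x : ℝ) :
    (momentsOf hu hm hs).Fx t x = ip (box m u t x) ((SphereWave.mk' u hu).vx t x) := by
  rw [box_eq hu hm]; rfl

theorem momentsOf_Fu (t x : ℝ) :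
    (momentsOf hu hm hs).Fu t x = ip (box m u t x) ((SphereWave.mk' u hu).v t x) := by
  rw [box_eq hu hm]; rfl

theorem en_le_energy (t : ℝ) : (momentsOf hu hm hs).en t ≤ energy m u t := by
  rw [energy_eq hu hm hs]
  exact le_mul_of_one_le_left' (by norm_num)

theorem lintegral_vt (t x : ℝ) : ∫⁻ θ, ‖(SphereWave.mk' u hu).vt t x θ‖ₑ ^ 2 ∂sphMeas
    = ENNReal.ofReal ((momentsOf hu hm hs).p t x) :=
  lintegral_enorm_sq ((SphereWave.mk' u hu).cvt.slice t x)

theorem lintegral_vx (t x : ℝ) : ∫⁻ θ, ‖(SphereWave.mk' u hu).vx t x θ‖ₑ ^ 2 ∂sphMeas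
    = ENNReal.ofReal ((momentsOf hu hm hs).q t x) :=
  lintegral_enorm_sq ((SphereWave.mk' u hu).cvx.slice t x)

theorem lintegral_v (t x : ℝ) : ∫⁻ θ, ‖(SphereWave.mk' u hu).v t x θ‖ₑ ^ 2 ∂sphMeas
    = ENNReal.ofReal ((momentsOf hu hm hs).n t x) :=
  lintegral_enorm_sq ((SphereWave.mk' u hu).cv.slice t x)

/-- The estimate for a forcing in the sum space. -/
theorem lossy_le_of_split {C : ℝ≥0}
    (H : ∀ K : ℝ≥0∞, K ≠ ⊤ → (∀ t ∈ Icc 0 T, (momentsOf hu hm hs).en t ≤ K) →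
      (momentsOf hu hm hs).lossy
        ≤ C * ((momentsOf hu hm hs).en 0 + (momentsOf hu hm hs).work) ^ (1 / 2 : ℝ))
    {F₁ F₂ : ℝ → ℝ → S2 → ℝ} (m1 : StMeasurable F₁) (m2 : StMeasurable F₂)
    (hF : ∀ t x θ, box m u t x θ = F₁ t x θ + F₂ t x θ) (h0 : energy m u 0 ≠ ⊤)
    (hL1 : L1L2 m T (angSq F₁) ≠ ⊤)
    (hL2 : LEStar m T (angSq fun t x θ => (wt m x)⁻¹ * F₂ t x θ) ≠ ⊤) :
    (momentsOf hu hm hs).lossy ≤ (C + C ^ 2 : ℝ≥0) * (energy m u 0 ^ (1 / 2 : ℝ) + 9 *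
      (L1L2 m T (angSq F₁) + LEStar m T (angSq fun t x θ => (wt m x)⁻¹ * F₂ t x θ))) := by
  set S := momentsOf hu hm hs with hS
  have bt : ∀ t x, ENNReal.ofReal |S.Ft t x|
      ≤ angSq F₁ t x ^ (1 / 2 : ℝ) * ENNReal.ofReal (S.p t x) ^ (1 / 2 : ℝ)
        + angSq F₂ t x ^ (1 / 2 : ℝ) * ENNReal.ofReal (S.p t x) ^ (1 / 2 : ℝ) := by
    intro t x
    rw [hS, momentsOf_Ft, ← lintegral_vt]
    exact ofReal_abs_ip_add_le (hF t x) (m1.slice t x) (m2.slice t x)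
      ((SphereWave.mk' u hu).cvt.slice t x).measurable
  have bx : ∀ t x, ENNReal.ofReal |S.Fx t x|
      ≤ (angSq F₁ t x ^ (1 / 2 : ℝ) + angSq F₂ t x ^ (1 / 2 : ℝ))
        * ENNReal.ofReal (S.q t x) ^ (1 / 2 : ℝ) := by
    intro t x
    rw [hS, momentsOf_Fx, ← lintegral_vx, add_mul]
    exact ofReal_abs_ip_add_le (hF t x) (m1.slice t x) (m2.slice t x)
      ((SphereWave.mk' u hu).cvx.slice t x).measurable
  have bu : ∀ t x, ENNReal.ofReal |S.Fu t x|
      ≤ (angSq F₁ t x ^ (1 / 2 : ℝ) + angSq F₂ t x ^ (1 / 2 : ℝ))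
        * ENNReal.ofReal (S.n t x) ^ (1 / 2 : ℝ) := by
    intro t x
    rw [hS, momentsOf_Fu, ← lintegral_v, add_mul]
    exact ofReal_abs_ip_add_le (hF t x) (m1.slice t x) (m2.slice t x)
      ((SphereWave.mk' u hu).cv.slice t x).measurable
  have mono : ∀ t x, x ≠ 0 → angSq F₂ t x ^ (1 / 2 : ℝ)
      ≤ angSq (fun t x θ => (wt m x)⁻¹ * F₂ t x θ) t x ^ (1 / 2 : ℝ) := fun t x hx =>
    ENNReal.rpow_le_rpow (angSq_le_angSq_wt F₂ t hx) (by norm_num)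
  have hE := en_le_energy hu hm hs 0
  -- For finiteness only, F₂ is placed in L¹L² at the cost of √T; the 4 comes from √a + √b ≤
  -- √(4(a+b)).
  obtain ⟨K, hK, hKe⟩ := S.exists_en_le hm
    (Φ := fun t x => 4 * (angSq F₁ t x + angSq F₂ t x))
    ((m1.measurable_angSq.add m2.measurable_angSq).const_mul 4)
    (fun t x => (bt t x).trans (by
      rw [← add_mul]; exact mul_le_mul_left (ENNReal.sqrt_add_sqrt_le _ _) _))
    (ne_top_of_le_ne_top h0 hE) (by
      rw [L1L2_const_mul (by norm_num)]
      refine ENNReal.mul_ne_top (ENNReal.rpow_ne_top_of_nonneg (by norm_num) (by norm_num)) ?_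
      refine ne_top_of_le_ne_top (ENNReal.add_ne_top.2 ⟨hL1, ?_⟩)
        (L1L2_add_le hm m1.measurable_angSq)
      refine ne_top_of_le_ne_top (ENNReal.mul_ne_top (ENNReal.rpow_ne_top_of_nonneg (by norm_num)
        ENNReal.ofReal_ne_top) hL2) ((L1L2_le_LEStar hm m2.measurable_angSq).trans
          (mul_le_mul_right (LEStar_mono fun t x hx => angSq_le_angSq_wt F₂ t hx) _)))
  have hst := S.lossy_ne_top hm hK hKe
  -- In the pairing with ∂_t u the factor W is moved from F₂ onto p; in the other pairings it is
  -- simply dropped.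
  have hw := S.work_le_of_split hm m1.measurable_angSq (m2.wt_inv_mul (m := m)).measurable_angSq hst
    (fun t x hx => (bt t x).trans (le_of_eq (by
      rw [angSq_eq_wtSq_mul (m := m) F₂ t hx, ENNReal.ofReal_mul (wtSq_nonneg m x),
        ENNReal.mul_rpow_of_nonneg _ _ (by norm_num), ENNReal.mul_rpow_of_nonneg _ _ (by norm_num)]
      ring)))
    (fun t x hx => (bx t x).trans (mul_le_mul_left (add_le_add_right (mono t x hx) _) _))
    (fun t x hx => (bu t x).trans (mul_le_mul_left (add_le_add_right (mono t x hx) _) _))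
  have h1 : S.lossy ≤ C * (energy m u 0 + (0 + 9 * (L1L2 m T (angSq F₁)
      + LEStar m T (angSq fun t x θ => (wt m x)⁻¹ * F₂ t x θ)) * S.lossy)) ^ (1 / 2 : ℝ) := by
    refine (H K hK hKe).trans ?_
    rw [zero_add]
    gcongr
  refine (ENNReal.le_of_le_sqrt hst h1).trans (le_of_eq ?_)
  rw [ENNReal.zero_rpow_of_pos (by norm_num), add_zero]

theorem bracket_mul_bracket (m : ℕ) (s x : ℝ) {l : ℝ} (hl : 0 ≤ l) :
    (1 + l / aFun m x ^ 2) ^ s * (1 + l / aFun m x ^ 2) ^ (-s) = 1 := by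
  have : 0 < 1 + l / aFun m x ^ 2 := by
    have := aFun_pos m x
    positivity
  rw [← Real.rpow_add this]
  simp

/-- The estimate with a loss of angular regularity. -/
theorem lossy_le_of_loss {C : ℝ≥0}
    (H : ∀ K : ℝ≥0∞, K ≠ ⊤ → (∀ t ∈ Icc 0 T, (momentsOf hu hm hs).en t ≤ K) →
      (momentsOf hu hm hs).lossy
        ≤ C * ((momentsOf hu hm hs).en 0 + (momentsOf hu hm hs).work) ^ (1 / 2 : ℝ))
    (s : ℝ) (h0 : energy m u 0 ≠ ⊤) (hL : LEStar m T (angSq (box m u)) ≠ ⊤) :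
    (momentsOf hu hm hs).lossy ≤ (C + C ^ 2 : ℝ≥0) * (energy m u 0 ^ (1 / 2 : ℝ)
      + LEStar m T (bracketSq m s (box m u)) ^ (1 / 2 : ℝ)
        * LE m T (bracketDerivSq m (-s) u) ^ (1 / 2 : ℝ)
      + 2 * LEStar m T (angSq (box m u))) := by
  set S := momentsOf hu hm hs with hS
  have cb := stContinuous_box hu hm
  have cd := stContinuous_dt hu
  have mb : StMeasurable (box m u) := Continuous.measurable cb
  have bt : ∀ t x, ENNReal.ofReal |S.Ft t x|
      ≤ angSq (box m u) t x ^ (1 / 2 : ℝ) * ENNReal.ofReal (S.p t x) ^ (1 / 2 : ℝ) := by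
    intro t x
    rw [hS, momentsOf_Ft, ← lintegral_vt]
    exact ofReal_abs_ip_le (mb.slice t x) ((SphereWave.mk' u hu).cvt.slice t x).measurable
  -- The symbols (1 + λ/a²)^s and (1 + λ/a²)^{-s} are reciprocal, so the duality holds for every
  -- real s.
  have bl : ∀ t x, ENNReal.ofReal |S.Ft t x| ≤ bracketSq m s (box m u) t x ^ (1 / 2 : ℝ)
      * bracketSq m (-s) (dt u) t x ^ (1 / 2 : ℝ) := by
    intro t x
    rw [hS, momentsOf_Ft, ← dt_eq hu]
    refine ofReal_abs_ip_le_spectralSq (fun l hl => ?_) (fun l hl => bracket_mul_bracket m s x hl)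
      (cb.slice t x) (cd.slice t x)
    have := aFun_pos m x
    positivity
  have bx : ∀ t x, ENNReal.ofReal |S.Fx t x|
      ≤ angSq (box m u) t x ^ (1 / 2 : ℝ) * ENNReal.ofReal (S.q t x) ^ (1 / 2 : ℝ) := by
    intro t x
    rw [hS, momentsOf_Fx, ← lintegral_vx]
    exact ofReal_abs_ip_le (mb.slice t x) ((SphereWave.mk' u hu).cvx.slice t x).measurable
  have bu : ∀ t x, ENNReal.ofReal |S.Fu t x|
      ≤ angSq (box m u) t x ^ (1 / 2 : ℝ) * ENNReal.ofReal (S.n t x) ^ (1 / 2 : ℝ) := by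
    intro t x
    rw [hS, momentsOf_Fu, ← lintegral_v]
    exact ofReal_abs_ip_le (mb.slice t x) ((SphereWave.mk' u hu).cv.slice t x).measurable
  have hE := en_le_energy hu hm hs 0
  obtain ⟨K, hK, hKe⟩ := S.exists_en_le hm mb.measurable_angSq bt (ne_top_of_le_ne_top h0 hE)
    (ne_top_of_le_ne_top (ENNReal.mul_ne_top (ENNReal.rpow_ne_top_of_nonneg (by norm_num)
      ENNReal.ofReal_ne_top) hL) (L1L2_le_LEStar hm mb.measurable_angSq))
  have hst := S.lossy_ne_top hm hK hKe
  have hw := S.work_le_of_loss hm mb.measurable_angSq (cb.measurable_bracketSq s)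
    (cd.measurable_bracketSq (m := m) (-s)) bl bx bu
  -- Only the ∂_t component of the norm of ∂u is needed.
  have hΘ : LE m T (bracketSq m (-s) (dt u)) ≤ LE m T (bracketDerivSq m (-s) u) :=
    LE_mono fun t x => by
      rw [bracketDerivSq, add_assoc]; exact le_self_add
  have h1 : S.lossy ≤ C * (energy m u 0 + (LEStar m T (bracketSq m s (box m u))
      * LE m T (bracketDerivSq m (-s) u) + 2 * LEStar m T (angSq (box m u)) * S.lossy))
        ^ (1 / 2 : ℝ) := by
    refine (H K hK hKe).trans ?_
    have hw' := hw.trans (add_le_add_left (mul_le_mul_right hΘ _) _)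
    gcongr
  refine (ENNReal.le_of_le_sqrt hst h1).trans (le_of_eq ?_)
  rw [ENNReal.mul_rpow_of_nonneg _ _ (by norm_num)]

end Wave

end DegTrap

end

/-! ### Both estimates with a common constant -/

open DegTrap
open scoped ENNReal NNReal Manifold ContDiff

theorem theorem1p1 (m : ℕ) (hm : 1 ≤ m) :
    ∃ C : ℝ≥0, ∀ (T : ℝ) (u : ℝ → ℝ → S2 → ℝ), 0 < T →
      ContMDiff (𝓘(ℝ, ℝ).prod (𝓘(ℝ, ℝ).prod (𝓡 2))) 𝓘(ℝ, ℝ) 2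
        (fun p : ℝ × ℝ × S2 => u p.1 p.2.1 p.2.2) →
      (∀ t ∈ Set.Icc 0 T, ∃ R : ℝ, ∀ x : ℝ, R < |x| → ∀ θ : S2, u t x θ = 0) →
      lossyLHS m T u ≤ C * (energy m u 0 ^ (1 / 2 : ℝ) + sumNorm m T (box m u)) ∧
      lossyLHS m T u ≤ C * (energy m u 0 ^ (1 / 2 : ℝ)
        + LEStar m T (bracketSq m (loss m) (box m u)) ^ (1 / 2 : ℝ)
          * LE m T (bracketDerivSq m (-loss m) u) ^ (1 / 2 : ℝ)
        + LEStar m T (angSq (box m u))) := by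
  obtain ⟨C, hC⟩ := exists_lossy_le hm
  -- The 9 dominates the factors 9 and 2 in front of the forcing norms. The 1 makes D nonzero, so
  -- that D·∞ = ∞ settles the infinite cases.
  set D : ℝ≥0 := 1 + 9 * (C + C ^ 2) with hD
  have hD0 : (D : ℝ≥0∞) ≠ 0 := by
    rw [hD]
    exact ENNReal.coe_ne_zero.2 (by positivity)
  have hCD : ((C + C ^ 2 : ℝ≥0) : ℝ≥0∞) * 9 ≤ D := by
    rw [hD]; push_cast; rw [mul_comm]; exact le_add_self
  have key : ∀ {a b c : ℝ≥0∞}, c ≤ 9 → ((C + C ^ 2 : ℝ≥0) : ℝ≥0∞) * (a + c * b) ≤ D * (a + b) :=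
    fun {a b c} hc => calc
      _ ≤ ((C + C ^ 2 : ℝ≥0) : ℝ≥0∞) * (9 * a + 9 * b) := by
        gcongr
        exact le_mul_of_one_le_left' (by norm_num)
      _ = ((C + C ^ 2 : ℝ≥0) : ℝ≥0∞) * 9 * (a + b) := by ring
      _ ≤ _ := by gcongr
  refine ⟨D, fun T u hT hu hs => ?_⟩
  have hu' : ContDiffOn ℝ 2 (stExt u) awayAxis := fun w hw =>
    (contDiffAt_stExt two_le_infty hu hw).contDiffWithinAt
  have H := hC T (momentsOf hu' hm hs) hT.le
  rw [lossyLHS_eq hu' hm hs]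
  by_cases h0 : energy m u 0 = ⊤
  · simp [h0, ENNReal.mul_top hD0]
  constructor
  · rw [mul_comm, ← ENNReal.div_le_iff_le_mul (Or.inl hD0) (Or.inl ENNReal.coe_ne_top), ← tsub_le_iff_left]
    refine le_iInf fun F₁ => le_iInf fun F₂ => le_iInf fun m1 => le_iInf fun m2 => le_iInf fun hF => ?_
    rw [tsub_le_iff_left, ENNReal.div_le_iff_le_mul (Or.inl hD0) (Or.inl ENNReal.coe_ne_top), mul_comm]
    by_cases hL1 : L1L2 m T (angSq F₁) = ⊤
    · simp [hL1, ENNReal.mul_top hD0]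
    by_cases hL2 : LEStar m T (angSq fun t x θ => (wt m x)⁻¹ * F₂ t x θ) = ⊤
    · simp [hL2, ENNReal.mul_top hD0]
    exact (lossy_le_of_split hu' hm hs H m1 m2 hF h0 hL1 hL2).trans (key le_rfl)
  · by_cases hL : LEStar m T (angSq (box m u)) = ⊤
    · simp [hL, ENNReal.mul_top hD0]
    exact (lossy_le_of_loss hu' hm hs H (loss m) h0 hL).trans (key (by norm_num))
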